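/- Let $\mathbb D$ be the open unit disk and $\mathbb T=\partial\mathbb D$. For a bounded analytic function $b$ on $\mathbb D$ with $\|b\|_{H^\infty}=\sup_{\mathbb D}|b|\le 1$, let $H(b)$ be the de Branges–Rovnyak space, i.e. the reproducing kernel Hilbert space on $\mathbb D$ with kernel \[k^b(z,\omega)=\frac{1-\overline{b(\omega)}\,b(z)}{1-\overline{\omega}z},\qquad z,\omega\in\mathbb D,\] and let $\sigma(b)=\{\lambda\in\mathbb T:\ \liminf_{z\to\lambda,\,z\in\mathbb D}|b(z)|<1\}$ be the boundary spectrum of $b$. For $\zeta\in\mathbb T$, let $\mathcal D_\zeta$ be the local Dirichlet space of all $f$ holomorphic on $\mathbb D$ with \[D_\zeta(f)=\frac1\pi\int_{\mathbb D}|f'(z)|^2\,\frac{1-|z|^2}{|z-\zeta|^2}\,dA(z)<\infty,\] equipped with the norm $\|f\|^2=\|f\|_{H^2}^2+D_\zeta(f)$. The embedding $X\hookrightarrow\mathcal D_\zeta$ means that $X\subseteq\mathcal D_\zeta$ and that the inclusion is bounded. Let $\zeta\in\mathbb T$. (1) Let $b$ be analytic on $\mathbb D$ with $\|b\|_{H^\infty}=1$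 and assume that $\sigma(b)$ is closed. Then $H(b)\hookrightarrow\mathcal D_\zeta$ if and only if $\zeta\notin\sigma(b)$. (2) In particular, let $u$ be an inner function (a bounded analytic function on $\mathbb D$ whose radial boundary values have modulus $1$ almost everywhere on $\mathbb T$), and let $K_u=H^2\ominus uH^2$ be its model space, with the norm of $H^2$. Then $K_u\hookrightarrow\mathcal D_\zeta$ if and only if $\zeta\notin\sigma(u)$. -/

import Mathlib

open scoped ComplexConjugate ENNReal NNReal Topology

noncomputable section

namespace LocalDirichlet

/-! ### Analytic functions on the unit disk

A function on the open unit disk is represented by a function `ℂ → ℂ`; its values outside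
`Metric.ball 0 1` play no role. -/

/-- `f` is holomorphic on the open unit disk. -/
def IsHol (f : ℂ → ℂ) : Prop := DifferentiableOn ℂ f (Metric.ball 0 1)

/-- The supremum norm `‖b‖_{H^∞}` over the unit disk, with values in `[0, ∞]`. -/
def hInftyNorm (b : ℂ → ℂ) : ℝ≥0∞ := ⨆ z ∈ Metric.ball (0 : ℂ) 1, ‖b z‖ₑ

/-- The boundary spectrum `σ(b) = {λ ∈ 𝕋 : liminf_{z → λ, |z| < 1} |b z| < 1}`. -/
def boundarySpectrum (b : ℂ → ℂ) : Set ℂ :=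
  {l | ‖l‖ = 1 ∧ Filter.liminf (fun z => ‖b z‖ₑ) (𝓝[Metric.ball 0 1] l) < 1}

/-- An inner function: bounded and holomorphic on the disk, with unimodular radial boundary
values almost everywhere on the unit circle. -/
structure IsInner (u : ℂ → ℂ) : Prop where
  isHol : IsHol u
  bounded : hInftyNorm u < ∞
  unimodular : ∀ᵐ θ : ℝ, ∃ l : ℂ, ‖l‖ = 1 ∧
    Filter.Tendsto (fun r : ℝ => u (r * Complex.exp (θ * Complex.I))) (𝓝[<] 1) (𝓝 l)

/-! ### The Hardy space `H²` -/

/-- The `n`-th Taylor coefficient of `f` at the origin. -/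
def taylorCoeff (f : ℂ → ℂ) (n : ℕ) : ℂ := iteratedDeriv n f 0 / (n.factorial : ℂ)

/-- The squared Hardy norm `‖f‖²_{H²} = ∑ |aₙ|²`, with values in `[0, ∞]`. -/
def hardyNormSq (f : ℂ → ℂ) : ℝ≥0∞ := ∑' n, ‖taylorCoeff f n‖ₑ ^ 2

/-- The Hardy space `H²` of the disk. -/
def hardySpace : Set (ℂ → ℂ) := {f | IsHol f ∧ hardyNormSq f < ∞}

/-- The inner product `⟨f, g⟩_{H²} = ∑ aₙ(f) conj (aₙ(g))`; the series converges absolutely for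
`f, g ∈ H²`. -/
def hardyInner (f g : ℂ → ℂ) : ℂ := ∑' n, taylorCoeff f n * conj (taylorCoeff g n)

/-- The model space `K_u = H² ⊖ u H²`. -/
def modelSpace (u : ℂ → ℂ) : Set (ℂ → ℂ) :=
  {f | f ∈ hardySpace ∧ ∀ h ∈ hardySpace, hardyInner f (fun z => u z * h z) = 0}

/-! ### The local Dirichlet space -/

/-- The local Dirichlet integral
`D_ζ(f) = (1/π) ∫_𝔻 |f'(z)|² (1 - |z|²) / |z - ζ|² dA(z)`, with values in `[0, ∞]`. -/
def dirichletIntegral (ζ : ℂ) (f : ℂ → ℂ) : ℝ≥0∞ :=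
  ENNReal.ofReal (1 / Real.pi) *
    ∫⁻ z in Metric.ball (0 : ℂ) 1,
      ENNReal.ofReal (‖deriv f z‖ ^ 2 * ((1 - ‖z‖ ^ 2) / ‖z - ζ‖ ^ 2))

/-- The local Dirichlet space `𝒟_ζ`. -/
def dirichletSpace (ζ : ℂ) : Set (ℂ → ℂ) := {f | IsHol f ∧ dirichletIntegral ζ f < ∞}

/-- The squared norm `‖f‖²_{H²} + D_ζ(f)` of `𝒟_ζ`. -/
def dirichletNormSq (ζ : ℂ) (f : ℂ → ℂ) : ℝ≥0∞ := hardyNormSq f + dirichletIntegral ζ f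

/-- Bounded inclusion into `𝒟_ζ` of a space `E` of functions on the disk, where `toFun` reads an
element of `E` as a function and `normSq` is the squared norm of `E`. -/
def EmbedsInDirichlet (ζ : ℂ) {E : Type*} (toFun : E → ℂ → ℂ) (normSq : E → ℝ≥0∞) : Prop :=
  (∀ f : E, toFun f ∈ dirichletSpace ζ) ∧
    ∃ C : ℝ≥0, ∀ f : E, dirichletNormSq ζ (toFun f) ≤ C * normSq f

/-- The embedding `K_u ↪ 𝒟_ζ`, where `K_u` carries the norm of `H²`. -/
def ModelSpaceEmbeds (u : ℂ → ℂ) (ζ : ℂ) : Prop :=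
  EmbedsInDirichlet ζ (fun f : modelSpace u => (f : ℂ → ℂ))
    (fun f : modelSpace u => hardyNormSq (f : ℂ → ℂ))

/-! ### The de Branges–Rovnyak space -/

/-- The kernel `k^b(z, ω) = (1 - conj (b ω) b z) / (1 - conj ω z)`. -/
def dbrKernel (b : ℂ → ℂ) (z w : ℂ) : ℂ := (1 - conj (b w) * b z) / (1 - conj w * z)

/-- The kernel `k^b` on the unit disk, as an operator-valued matrix. -/
def dbrMatrix (b : ℂ → ℂ) : Matrix Complex.UnitDisc Complex.UnitDisc (ℂ →L[ℂ] ℂ) :=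
  Matrix.of fun z w => dbrKernel b z w • (1 : ℂ →L[ℂ] ℂ)

/-- The Schur class: holomorphic functions `b` on the unit disk with `‖b‖_{H^∞} ≤ 1`. -/
structure SchurFunction where
  toFun : ℂ → ℂ
  isHol : IsHol toFun
  norm_le : hInftyNorm toFun ≤ 1

instance : CoeFun SchurFunction (fun _ => ℂ → ℂ) := ⟨SchurFunction.toFun⟩

lemma SchurFunction.norm_apply_le (b : SchurFunction) {z : ℂ} (hz : z ∈ Metric.ball (0 : ℂ) 1) :
    ‖b z‖ ≤ 1 := by
  have h : ‖b z‖ₑ ≤ 1 := (le_iSup₂_of_le (f := fun z _ => ‖b.toFun z‖ₑ) z hz le_rfl).trans b.norm_le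
  have h2 := ENNReal.toReal_mono ENNReal.one_ne_top h
  simpa using h2

lemma one_sub_conj_mul_ne_zero {w z : ℂ} (hw : ‖w‖ < 1) (hz : ‖z‖ ≤ 1) : 1 - conj w * z ≠ 0 := by
  intro h
  have h1 : ‖conj w * z‖ = 1 := by rw [← sub_eq_zero.mp h]; simp
  rw [norm_mul, RCLike.norm_conj] at h1
  nlinarith [norm_nonneg w, norm_nonneg z]

/-- A finite combination of Szegő kernels. -/
def szegoSum (s : Finset Complex.UnitDisc) (a : Complex.UnitDisc → ℂ) (z : ℂ) : ℂ :=
  ∑ x ∈ s, a x / (1 - conj (x : ℂ) * z)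

lemma differentiableAt_szegoSum (s : Finset Complex.UnitDisc) (a : Complex.UnitDisc → ℂ) {z : ℂ}
    (hz : ‖z‖ ≤ 1) : DifferentiableAt ℂ (szegoSum s a) z := by
  unfold szegoSum
  refine DifferentiableAt.fun_sum fun x _ => ?_
  exact (differentiableAt_const _).div (by fun_prop) (one_sub_conj_mul_ne_zero x.norm_lt_one hz)

lemma diffContOnCl_szegoSum (s : Finset Complex.UnitDisc) (a : Complex.UnitDisc → ℂ) :
    DiffContOnCl ℂ (szegoSum s a) (Metric.ball 0 1) := by
  refine DifferentiableOn.diffContOnCl fun z hz => ?_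
  rw [closure_ball _ one_ne_zero, mem_closedBall_zero_iff] at hz
  exact (differentiableAt_szegoSum s a hz).differentiableWithinAt

lemma conj_szegoSum (s : Finset Complex.UnitDisc) (a : Complex.UnitDisc → ℂ) {z : ℂ}
    (hz : ‖z‖ = 1) :
    conj (szegoSum s a z) = ∑ x ∈ s, conj (a x) * (z / (z - x)) := by
  unfold szegoSum
  rw [map_sum]
  refine Finset.sum_congr rfl fun x _ => ?_
  have hz0 : z ≠ 0 := by intro h; simp [h] at hz
  have hc : conj z = z⁻¹ := by rw [Complex.inv_eq_conj hz]
  have hzx : z - x ≠ 0 := by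
    intro h
    have := x.norm_lt_one
    rw [← sub_eq_zero.mp h] at this
    linarith
  simp only [map_div₀, map_sub, map_one, map_mul, Complex.conj_conj, hc]
  have h2 : 1 - (x : ℂ) * z⁻¹ = (z - x) / z := by field_simp
  rw [h2]
  field_simp

lemma circleIntegrable_mul_conj {h : ℂ → ℂ} (hh : DiffContOnCl ℂ h (Metric.ball 0 1))
    (s : Finset Complex.UnitDisc) (a : Complex.UnitDisc → ℂ) :
    CircleIntegrable (fun z => h z * conj (szegoSum s a z)) 0 1 := by
  refine ContinuousOn.circleIntegrable zero_le_one ?_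
  have h1 := hh.continuousOn
  have h2 := (diffContOnCl_szegoSum s a).continuousOn
  rw [closure_ball _ one_ne_zero] at h1 h2
  exact (h1.mono Metric.sphere_subset_closedBall).mul
    (Complex.continuous_conj.comp_continuousOn (h2.mono Metric.sphere_subset_closedBall))

lemma circleAverage_mul_conj {h : ℂ → ℂ} (hh : DiffContOnCl ℂ h (Metric.ball 0 1))
    (s : Finset Complex.UnitDisc) (a : Complex.UnitDisc → ℂ) :
    Real.circleAverage (fun z => h z * conj (szegoSum s a z)) 0 1
      = ∑ x ∈ s, conj (a x) * h x := by
  have h1 : Real.circleAverage (fun z => h z * conj (szegoSum s a z)) 0 1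
      = Real.circleAverage (fun z => ∑ x ∈ s, conj (a x) • (((z - 0) / (z - x)) • h z)) 0 1 := by
    refine Real.circleAverage_congr_sphere fun z hz => ?_
    have hz1 : ‖z‖ = 1 := by simpa using hz
    simp only [conj_szegoSum s a hz1, Finset.mul_sum, smul_eq_mul, sub_zero]
    exact Finset.sum_congr rfl fun x _ => by ring
  rw [h1, Real.circleAverage_fun_sum]
  · refine Finset.sum_congr rfl fun x _ => ?_
    rw [Real.circleAverage_fun_smul, DiffContOnCl.circleAverage_smul_div]
    · rfl
    · simpa using hh
    · simpa using x.norm_lt_one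
  · intro x _
    refine ContinuousOn.circleIntegrable zero_le_one ?_
    have h1 := hh.continuousOn
    rw [closure_ball _ one_ne_zero] at h1
    have h4 : ContinuousOn (fun z : ℂ => (z - 0) / (z - x)) (Metric.sphere 0 1) := ?_
    · exact (h4.smul (h1.mono Metric.sphere_subset_closedBall)).const_smul (conj (a x))
    refine ContinuousOn.div (by fun_prop) (by fun_prop) fun z hz => ?_
    intro h
    have h3 := x.norm_lt_one
    rw [← sub_eq_zero.mp h] at h3
    rw [mem_sphere_zero_iff_norm] at hz
    linarith

/-- Positivity of `k^b` for `b` continuous up to the boundary. -/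
lemma dbrKernel_nonneg_of_diffContOnCl {b : ℂ → ℂ} (hb : DiffContOnCl ℂ b (Metric.ball 0 1))
    (hb1 : ∀ z ∈ Metric.closedBall (0 : ℂ) 1, ‖b z‖ ≤ 1)
    (s : Finset Complex.UnitDisc) (c : Complex.UnitDisc → ℂ) :
    0 ≤ (∑ x ∈ s, ∑ y ∈ s, dbrKernel b y x * c x * conj (c y)).re := by
  set f := szegoSum s c with hf
  set g := szegoSum s (fun x => c x * conj (b x)) with hg
  have hfd : DiffContOnCl ℂ f (Metric.ball 0 1) := diffContOnCl_szegoSum _ _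
  have hgd : DiffContOnCl ℂ g (Metric.ball 0 1) := diffContOnCl_szegoSum _ _
  have hkd : DiffContOnCl ℂ (fun z => f z - 2 * (b z * g z)) (Metric.ball 0 1) :=
    hfd.sub ((hb.smul hgd).const_smul (2 : ℂ))
  have hi1 := circleIntegrable_mul_conj hkd s c
  have hi2 := circleIntegrable_mul_conj hgd s (fun x => c x * conj (b x))
  have key : (∑ x ∈ s, ∑ y ∈ s, dbrKernel b y x * c x * conj (c y))
      = Real.circleAverage (fun z => (f z - 2 * (b z * g z)) * conj (f z) + g z * conj (g z)) 0 1 := by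
    rw [Real.circleAverage_fun_add hi1 hi2, circleAverage_mul_conj hkd,
      circleAverage_mul_conj hgd, ← Finset.sum_add_distrib, Finset.sum_comm]
    refine Finset.sum_congr rfl fun y _ => ?_
    simp only [map_mul, Complex.conj_conj]
    have e : conj (c y) * (f y - 2 * (b y * g y)) + conj (c y) * b y * g y
        = conj (c y) * (f y - b y * g y) := by ring
    rw [e, hf, hg]
    unfold szegoSum
    rw [Finset.mul_sum, ← Finset.sum_sub_distrib, Finset.mul_sum]
    refine Finset.sum_congr rfl fun x _ => ?_
    unfold dbrKernel
    ring
  have hre := Complex.reCLM.circleAverage_comp_comm (hi1.add hi2)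
  have hpos : 0 ≤ Real.circleAverage (Complex.reCLM ∘
      (fun z => (f z - 2 * (b z * g z)) * conj (f z) + g z * conj (g z))) 0 1 := by
    refine Real.circleAverage_nonneg_of_nonneg fun z hz => ?_
    have hz1 : z ∈ Metric.closedBall (0 : ℂ) 1 := by
      rw [abs_one] at hz
      exact Metric.sphere_subset_closedBall hz
    have hbz := hb1 z hz1
    have h1 : (f z - 2 * (b z * g z)) * conj (f z) + g z * conj (g z)
        = ((‖f z‖ ^ 2 + ‖g z‖ ^ 2 : ℝ) : ℂ) - 2 * (b z * g z * conj (f z)) := by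
      push_cast
      rw [← Complex.mul_conj', ← Complex.mul_conj']
      ring
    have h2 : (b z * g z * conj (f z)).re ≤ ‖g z‖ * ‖f z‖ := by
      refine (Complex.re_le_norm _).trans ?_
      rw [norm_mul, norm_mul, RCLike.norm_conj]
      have := mul_nonneg (norm_nonneg (g z)) (norm_nonneg (f z))
      nlinarith
    simp only [Function.comp_apply, Complex.reCLM_apply, h1]
    rw [Complex.sub_re, Complex.ofReal_re]
    have h3 : (2 * (b z * g z * conj (f z))).re = 2 * (b z * g z * conj (f z)).re := by simp
    rw [h3]
    nlinarith [sq_nonneg (‖f z‖ - ‖g z‖)]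
  rw [key]
  exact hpos.trans_eq hre

lemma dbrKernel_nonneg (b : SchurFunction) (s : Finset Complex.UnitDisc)
    (c : Complex.UnitDisc → ℂ) :
    0 ≤ (∑ x ∈ s, ∑ y ∈ s, dbrKernel b y x * c x * conj (c y)).re := by
  have hb : ∀ x : Complex.UnitDisc, Filter.Tendsto (fun r : ℝ => b (r * x)) (𝓝[<] 1) (𝓝 (b x)) := by
    intro x
    have hx : (x : ℂ) ∈ Metric.ball (0 : ℂ) 1 := by simpa using x.norm_lt_one
    have h1 : ContinuousAt b (x : ℂ) :=
      (b.isHol.differentiableAt (Metric.isOpen_ball.mem_nhds hx)).continuousAt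
    have h2 : Filter.Tendsto (fun r : ℝ => (r : ℂ) * x) (𝓝[<] 1) (𝓝 (x : ℂ)) := by
      have : Continuous (fun r : ℝ => (r : ℂ) * x) := by fun_prop
      have h3 := (this.tendsto 1).mono_left (nhdsWithin_le_nhds (s := Set.Iio (1 : ℝ)))
      simpa using h3
    exact h1.tendsto.comp h2
  have hlim : Filter.Tendsto (fun r : ℝ =>
      (∑ x ∈ s, ∑ y ∈ s, dbrKernel (fun z => b (r * z)) y x * c x * conj (c y)).re) (𝓝[<] 1)
      (𝓝 (∑ x ∈ s, ∑ y ∈ s, dbrKernel b y x * c x * conj (c y)).re) := by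
    refine (Complex.continuous_re.tendsto _).comp ?_
    refine tendsto_finsetSum _ fun x _ => tendsto_finsetSum _ fun y _ => ?_
    unfold dbrKernel
    refine Filter.Tendsto.mul_const _ (Filter.Tendsto.mul_const _ (Filter.Tendsto.div_const ?_ _))
    exact tendsto_const_nhds.sub
      (((Complex.continuous_conj.tendsto _).comp (hb x)).mul (hb y))
  refine ge_of_tendsto hlim ?_
  filter_upwards [Ioo_mem_nhdsLT (zero_lt_one (α := ℝ))] with r hr
  have hmem : ∀ z ∈ Metric.closedBall (0 : ℂ) 1, (r : ℂ) * z ∈ Metric.ball (0 : ℂ) 1 := by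
    intro z hz
    rw [mem_closedBall_zero_iff] at hz
    rw [mem_ball_zero_iff, norm_mul, Complex.norm_real, Real.norm_of_nonneg hr.1.le]
    nlinarith [hr.1, hr.2, norm_nonneg z]
  refine dbrKernel_nonneg_of_diffContOnCl ?_ (fun z hz => b.norm_apply_le (hmem z hz)) s c
  refine DifferentiableOn.diffContOnCl ?_
  rw [closure_ball _ one_ne_zero]
  exact b.isHol.comp (by fun_prop) hmem

theorem posSemidef_dbrMatrix (b : SchurFunction) : (dbrMatrix b).PosSemidef := by
  have htfae := RKHS.posSemidef_tfae (K := dbrMatrix b)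
  refine (htfae.out 0 2).mpr ?_
  refine ⟨?_, fun v => ?_⟩
  · ext x y
    simp [dbrMatrix, dbrKernel, Matrix.conjTranspose_apply, mul_comm]
  · have h := dbrKernel_nonneg b v.support v
    rw [← Complex.conj_re] at h
    convert h using 1
    simp only [Finsupp.sum, map_sum, dbrMatrix, Matrix.of_apply, RCLike.re_to_complex, Complex.re_sum]
    refine Finset.sum_congr rfl fun x _ => Finset.sum_congr rfl fun y _ => ?_
    simp [mul_comm]

instance (b : SchurFunction) : Fact (dbrMatrix b).PosSemidef := ⟨posSemidef_dbrMatrix b⟩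

/-- The de Branges–Rovnyak space `H(b)`: the reproducing kernel Hilbert space with kernel `k^b`. -/
abbrev DeBrangesRovnyak (b : SchurFunction) : Type := RKHS.OfKernel (dbrMatrix b)

/-- A function on the unit disk, extended by zero to `ℂ`. -/
def extendDisc (f : Complex.UnitDisc → ℂ) (z : ℂ) : ℂ :=
  if h : ‖z‖ < 1 then f (Complex.UnitDisc.mk z h) else 0

/-- The embedding `H(b) ↪ 𝒟_ζ`. -/
def DeBrangesRovnyakEmbeds (b : SchurFunction) (ζ : ℂ) : Prop :=
  EmbedsInDirichlet ζ (fun f : DeBrangesRovnyak b => extendDisc f)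
    (fun f : DeBrangesRovnyak b => ‖f‖ₑ ^ 2)

end LocalDirichlet

end

open scoped ComplexConjugate ENNReal NNReal Topology

noncomputable section

namespace LocalDirichlet

/-! ### Taylor coefficients and Parseval's identity -/

/-! Necessity is tested on the kernels `k_w = k^b(·, w)`, for which `‖k_w‖² = (1 - |b(w)|²)/(1 -
|w|²)`. By Schwarz–Pick, `|k_w'(w)|` is of order `(1 - |w|)⁻²` as long as `|b(w)|` stays away from
`1`. The mean value inequality on a disk of radius `(1 - |w|)/2` then makes `D_ζ(k_w)` at least a
constant times `1/((1 - |w|) |w - ζ|²)`, whereas boundedness of the embedding allows only `O(1/(1 -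
|w|))`. Letting `w → ζ` along points with `|b(w)| ≤ c < 1` gives a contradiction
(`notMem_boundarySpectrum_of_kernel_bound`).

Sufficiency has three stages. (a) Off the spectrum `|b| ≥ 1/2` near `ζ`, and `|b|` has radial limits
`1` almost everywhere on an arc around `ζ`: for `H(b)` because `σ(b)` is closed, for inner `u` by
definition. A maximum principle with a barrier gives `1 - |b(z)| = O(1 - |z|)` near `ζ`
(`one_sub_norm_le_of_unimodular`). Julia's inequality then provides a unimodular `β` with `Re (1 - β
b(z)) ≤ C (|z - ζ|² + 1 - |z|)` on the disk (`exists_re_one_sub_le`). (b) Put `φ = 1 - β b`. Then `1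
- conj (b x) b y = φ y + conj (φ x) - φ y conj (φ x)`, so for a Szegő sum `F` the quadratic form of
`k^b` is at most `2 Re ⟨φF, F⟩`, hence at most `2C ‖(z - ζ)F‖²` in `H²`
(`dbrForm_le_circleAverage`). (c) By Riesz representation, as in Douglas' lemma, every `f`
controlled by the form of `k^b` is the image of some `g ∈ H²` under the adjoint of multiplication by
`z - ζ`. Its coefficients are `g (n+1) - conj ζ * g n`, so `f = a + (z - ζ)G` with `‖G‖ ≤ ‖g‖`. The
local Douglas formula bounds `D_ζ(f)` by `‖G‖²` (`dirichletIntegral_le_tsum`).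

Stages (b) and (c) see the space only through `|∑ conj (c x) f x|² ≤ ‖f‖² · dbrForm b s c`. That
inequality is proved separately for `H(b)` and for `K_u`, so the identification of the two spaces is
never needed. -/

lemma hasSum_taylorCoeff {f : ℂ → ℂ} (hf : IsHol f) {z : ℂ} (hz : z ∈ Metric.ball (0 : ℂ) 1) :
    HasSum (fun n => taylorCoeff f n * z ^ n) (f z) := by
  have h := Complex.hasSum_taylorSeries_on_ball hf hz
  refine h.congr_fun fun n => ?_
  simp only [taylorCoeff, sub_zero, smul_eq_mul]
  ring

/-- Pointwise convergence on the disk forces radius of convergence at least `1`; uniqueness of power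
series does the rest. It serves to read off the coefficients of functions known only through a
series. -/
lemma taylorCoeff_of_hasSum {f : ℂ → ℂ} {a : ℕ → ℂ}
    (h : ∀ z ∈ Metric.ball (0 : ℂ) 1, HasSum (fun n => a n * z ^ n) (f z)) :
    IsHol f ∧ ∀ n, taylorCoeff f n = a n := by
  have hn : ∀ y : ℂ, ‖y‖ₑ < 1 ↔ ‖y‖ < 1 := fun y => by rw [← ofReal_norm, ENNReal.ofReal_lt_one]
  have hp : HasFPowerSeriesOnBall f (FormalMultilinearSeries.ofScalars ℂ a) 0 1 := by
    refine ⟨?_, one_pos, ?_⟩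
    · refine ENNReal.le_of_forall_nnreal_lt fun r hr => ?_
      have hr1 : (r : ℝ) < 1 := by exact_mod_cast hr
      refine FormalMultilinearSeries.le_radius_of_tendsto _ (l := 0) ?_
      have h0 := (h (r : ℂ) (by simpa using hr1)).summable.tendsto_atTop_zero.norm
      simpa [FormalMultilinearSeries.ofScalars_norm] using h0
    · intro y hy
      have hy1 : y ∈ Metric.ball (0 : ℂ) 1 := by simpa [hn] using hy
      have := h y hy1
      simpa [FormalMultilinearSeries.ofScalars_apply_eq, mul_comm] using this
  have hd : IsHol f := by
    have := hp.differentiableOn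
    intro z hz
    exact (this z (by simpa [hn] using hz)).mono (fun w hw => by simpa [hn] using hw)
  refine ⟨hd, fun n => ?_⟩
  have h2 : HasFPowerSeriesAt f (FormalMultilinearSeries.ofScalars ℂ (taylorCoeff f)) 0 := by
    rw [hasFPowerSeriesAt_iff]
    filter_upwards [Metric.ball_mem_nhds (0 : ℂ) one_pos] with z hz
    simpa [mul_comm] using hasSum_taylorCoeff hd hz
  have h3 := h2.eq_formalMultilinearSeries hp.hasFPowerSeriesAt
  have h4 := congrArg (fun p => FormalMultilinearSeries.coeff p n) h3
  simpa using h4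

lemma taylorCoeff_deriv (f : ℂ → ℂ) (n : ℕ) :
    taylorCoeff (deriv f) n = (n + 1) * taylorCoeff f (n + 1) := by
  unfold taylorCoeff
  rw [iteratedDeriv_succ', Nat.factorial_succ]
  have h1 : (n.factorial : ℂ) ≠ 0 := by exact_mod_cast n.factorial_ne_zero
  have h2 : (n + 1 : ℂ) ≠ 0 := by exact_mod_cast n.succ_ne_zero
  push_cast
  field_simp

lemma IsHol.deriv {f : ℂ → ℂ} (hf : IsHol f) : IsHol (deriv f) :=
  DifferentiableOn.deriv hf Metric.isOpen_ball

lemma IsHol.continuousOn_sphere {f : ℂ → ℂ} (hf : IsHol f) {r : ℝ} (hr : r < 1) :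
    ContinuousOn f (Metric.sphere 0 r) :=
  hf.continuousOn.mono fun z hz => by
    rw [mem_sphere_zero_iff_norm] at hz
    rw [mem_ball_zero_iff, hz]
    exact hr

lemma circleAverage_pow_mul_conj_pow (m n : ℕ) :
    Real.circleAverage (fun z : ℂ => z ^ m * conj (z ^ n)) 0 1 = if m = n then 1 else 0 := by
  rw [Real.circleAverage_eq_circleIntegral one_ne_zero]
  have h : (∮ z in C(0, 1), (z - 0)⁻¹ • (z ^ m * conj (z ^ n)))
      = ∮ z in C(0, 1), (z - 0) ^ ((m : ℤ) - n - 1) := by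
    refine circleIntegral.integral_congr zero_le_one fun z hz => ?_
    have hz1 : ‖z‖ = 1 := by simpa using hz
    have hz0 : z ≠ 0 := by intro h; simp [h] at hz1
    have hc : conj z = z⁻¹ := by rw [Complex.inv_eq_conj hz1]
    simp only [map_pow, hc, sub_zero, smul_eq_mul]
    rw [zpow_sub₀ hz0, zpow_sub₀ hz0]
    simp
    field_simp
  rw [h]
  split_ifs with hmn
  · subst hmn
    have : ((m : ℤ) - m - 1) = -1 := by ring
    simp only [this, zpow_neg_one]
    rw [circleIntegral.integral_sub_center_inv _ one_ne_zero, smul_eq_mul]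
    exact inv_mul_cancel₀ (by simp [Real.pi_ne_zero])
  · rw [circleIntegral.integral_sub_zpow_of_ne]
    · simp
    · omega

/-- Parseval's identity for an absolutely convergent power series on the unit circle. -/
lemma hasSum_norm_sq_circleAverage {a : ℕ → ℂ} {G : ℂ → ℂ} (ha : Summable fun n => ‖a n‖)
    (hG : ∀ z ∈ Metric.sphere (0 : ℂ) 1, HasSum (fun n => a n * z ^ n) (G z)) :
    HasSum (fun n => ‖a n‖ ^ 2) (Real.circleAverage (fun z => ‖G z‖ ^ 2) 0 1) := by
  have hprod : Summable fun p : ℕ × ℕ => ‖a p.1‖ * ‖a p.2‖ :=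
    ha.mul_of_nonneg ha (fun _ => norm_nonneg _) (fun _ => norm_nonneg _)
  set F : ℕ × ℕ → ℂ → ℂ := fun p z => (a p.1 * conj (a p.2)) * (z ^ p.1 * conj (z ^ p.2)) with hF
  have hs : ∀ z ∈ Metric.sphere (0 : ℂ) 1, HasSum (fun p => F p z) (G z * conj (G z)) := by
    intro z hz
    have hz1 : ‖z‖ = 1 := by simpa using hz
    have h1 := hG z hz
    have h2 : HasSum (fun n => conj (a n * z ^ n)) (conj (G z)) :=
      (Complex.hasSum_conj (f := fun n => conj (a n * z ^ n))).mp (by simpa using h1)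
    have h3 : Summable fun p : ℕ × ℕ => (a p.1 * z ^ p.1) * conj (a p.2 * z ^ p.2) := by
      refine Summable.of_norm ?_
      simpa [hz1] using hprod
    refine (h1.mul h2 h3).congr_fun fun p => ?_
    simp only [hF, map_mul]
    ring
  have key : HasSum (fun p => Real.circleAverage (F p) 0 1)
      (Real.circleAverage (fun z => G z * conj (G z)) 0 1) := by
    unfold Real.circleAverage
    refine HasSum.const_smul _ ?_
    have hmem : ∀ t, circleMap 0 1 t ∈ Metric.sphere (0 : ℂ) 1 := fun t => by simp
    refine intervalIntegral.hasSum_integral_of_dominated_convergence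
      (fun p _ => ‖a p.1‖ * ‖a p.2‖) (fun p => ?_) (fun p => ?_) ?_ ?_ ?_
    · refine Continuous.aestronglyMeasurable ?_
      simp only [hF]
      fun_prop
    · refine Filter.Eventually.of_forall fun t _ => ?_
      have hz1 : ‖circleMap 0 1 t‖ = 1 := by simp
      simp only [hF, norm_mul, norm_pow, RCLike.norm_conj, hz1]
      simp
    · exact Filter.Eventually.of_forall fun t _ => hprod
    · simp
    · exact Filter.Eventually.of_forall fun t _ => hs _ (hmem t)
  have e1 : ∀ p : ℕ × ℕ, Real.circleAverage (F p) 0 1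
      = if p.1 = p.2 then ((‖a p.1‖ ^ 2 : ℝ) : ℂ) else 0 := by
    intro p
    have : F p = fun z => (a p.1 * conj (a p.2)) • (z ^ p.1 * conj (z ^ p.2)) := rfl
    rw [this, Real.circleAverage_fun_smul, circleAverage_pow_mul_conj_pow]
    split_ifs with h
    · rw [← h, Complex.mul_conj']
      simp
    · simp
  simp only [e1] at key
  have e2 : Real.circleAverage (fun z => G z * conj (G z)) 0 1
      = ((Real.circleAverage (fun z => ‖G z‖ ^ 2) 0 1 : ℝ) : ℂ) := by
    unfold Real.circleAverage
    simp only [Complex.mul_conj', Complex.real_smul, smul_eq_mul]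
    push_cast
    rw [← intervalIntegral.integral_ofReal]
    simp
  rw [e2] at key
  -- Orthogonality of the powers leaves only the diagonal of the double series.
  have inj : Function.Injective (fun n : ℕ => (n, n)) := fun m n h => (Prod.mk.inj h).1
  have key2 := (inj.hasSum_iff (f := fun p : ℕ × ℕ =>
    if p.1 = p.2 then ((‖a p.1‖ ^ 2 : ℝ) : ℂ) else 0) (by
      rintro ⟨m, n⟩ h
      have : m ≠ n := fun e => h ⟨m, by simp [e]⟩
      simp [this])).mpr key
  rw [← Complex.hasSum_ofReal]
  refine key2.congr_fun fun n => ?_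
  simp

lemma hasSum_circleAverage_of_isHol {f : ℂ → ℂ} (hf : IsHol f) {r : ℝ} (hr0 : 0 ≤ r) (hr : r < 1) :
    HasSum (fun n => ‖taylorCoeff f n‖ ^ 2 * r ^ (2 * n))
      (Real.circleAverage (fun z => ‖f z‖ ^ 2) 0 r) := by
  have hz : ((r : ℂ)) ∈ Metric.ball (0 : ℂ) 1 := by
    rw [mem_ball_zero_iff, Complex.norm_real, Real.norm_of_nonneg hr0]
    exact hr
  rw [Real.circleAverage_eq_circleAverage_zero_one]
  have := hasSum_norm_sq_circleAverage (a := fun n => taylorCoeff f n * (r : ℂ) ^ n)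
    (G := fun z => f (r * z)) (hasSum_taylorCoeff hf hz).summable.norm (fun z hz => by
      have hz1 : ‖z‖ = 1 := by simpa using hz
      refine (hasSum_taylorCoeff hf (z := r * z) ?_).congr_fun fun n => by ring
      rw [mem_ball_zero_iff, norm_mul, hz1, Complex.norm_real, Real.norm_of_nonneg hr0]
      simpa using hr)
  simp only [add_zero]
  convert! this using 2 with n
  rw [norm_mul, norm_pow, Complex.norm_real, Real.norm_of_nonneg hr0, mul_pow, pow_mul' r 2 n]

/-! ### The Hardy norm through circle averages -/

/-- Parseval on the circle of radius `r` controls each finite partial sum, and in a finite sum one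
may let `r → 1`. -/
lemma hardyNormSq_le_of_circleAverage_le {f : ℂ → ℂ} (hf : IsHol f) {B : ℝ → ℝ} {M : ℝ}
    (h : ∀ r ∈ Set.Ioo (0 : ℝ) 1, Real.circleAverage (fun z => ‖f z‖ ^ 2) 0 r ≤ B r)
    (hB : Filter.Tendsto B (𝓝[<] 1) (𝓝 M)) :
    hardyNormSq f ≤ ENNReal.ofReal M := by
  unfold hardyNormSq
  refine ENNReal.tsum_le_of_sum_range_le fun N => ?_
  have e : ∀ n, ‖taylorCoeff f n‖ₑ ^ 2 = ENNReal.ofReal (‖taylorCoeff f n‖ ^ 2) := fun n => by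
    rw [ENNReal.ofReal_pow (norm_nonneg _), ofReal_norm]
  simp only [e]
  rw [← ENNReal.ofReal_sum_of_nonneg (fun _ _ => sq_nonneg _)]
  refine ENNReal.ofReal_le_ofReal ?_
  have ht : Filter.Tendsto (fun r : ℝ => ∑ n ∈ Finset.range N, ‖taylorCoeff f n‖ ^ 2 * r ^ (2 * n))
      (𝓝[<] 1) (𝓝 (∑ n ∈ Finset.range N, ‖taylorCoeff f n‖ ^ 2)) := by
    have hc : Continuous (fun r : ℝ =>
      ∑ n ∈ Finset.range N, ‖taylorCoeff f n‖ ^ 2 * r ^ (2 * n)) := by fun_prop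
    simpa using (hc.tendsto 1).mono_left nhdsWithin_le_nhds
  refine le_of_tendsto_of_tendsto ht hB ?_
  filter_upwards [Ioo_mem_nhdsLT (zero_lt_one (α := ℝ))] with r hr
  refine le_trans ?_ (h r hr)
  exact sum_le_hasSum _ (fun n _ => mul_nonneg (sq_nonneg _) (pow_nonneg hr.1.le _))
    (hasSum_circleAverage_of_isHol hf hr.1.le hr.2)

lemma summable_norm_sq_of_hardyNormSq {f : ℂ → ℂ} (hf : hardyNormSq f < ∞) :
    Summable fun n => ‖taylorCoeff f n‖ ^ 2 := by
  have h := ENNReal.summable_toReal hf.ne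
  simpa using h

lemma hardyNormSq_eq_ofReal {f : ℂ → ℂ} (hf : hardyNormSq f < ∞) :
    hardyNormSq f = ENNReal.ofReal (∑' n, ‖taylorCoeff f n‖ ^ 2) := by
  rw [ENNReal.ofReal_tsum_of_nonneg (fun _ => sq_nonneg _) (summable_norm_sq_of_hardyNormSq hf)]
  unfold hardyNormSq
  congr 1
  ext n
  rw [ENNReal.ofReal_pow (norm_nonneg _), ofReal_norm]

lemma circleAverage_le_tsum {f : ℂ → ℂ} (hf : f ∈ hardySpace) {r : ℝ} (hr0 : 0 ≤ r) (hr : r < 1) :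
    Real.circleAverage (fun z => ‖f z‖ ^ 2) 0 r ≤ ∑' n, ‖taylorCoeff f n‖ ^ 2 := by
  refine hasSum_le (fun n => ?_) (hasSum_circleAverage_of_isHol hf.1 hr0 hr)
    (summable_norm_sq_of_hardyNormSq hf.2).hasSum
  exact mul_le_of_le_one_right (sq_nonneg _) (pow_le_one₀ hr0 hr.le)

/-! ### Area integrals in polar coordinates -/

lemma lintegral_Ioo_circleMap {ψ : ℂ → ℝ} {c : ℂ} {r : ℝ} (hψ : ContinuousOn ψ (Metric.sphere c |r|))
    (h0 : ∀ z, 0 ≤ ψ z) :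
    ∫⁻ θ in Set.Ioo (-Real.pi) Real.pi, ENNReal.ofReal (ψ (circleMap c r θ))
      = ENNReal.ofReal (2 * Real.pi * Real.circleAverage ψ c r) := by
  have hc : Continuous fun θ => ψ (circleMap c r θ) :=
    hψ.comp_continuous (by fun_prop) fun θ => by simp
  rw [← MeasureTheory.ofReal_integral_eq_lintegral_ofReal
    ((hc.integrableOn_Icc (a := -Real.pi) (b := Real.pi)).mono_set Set.Ioo_subset_Icc_self)
    (Filter.Eventually.of_forall fun θ => h0 _)]
  congr 1
  rw [Real.circleAverage_eq_integral_add (-Real.pi), smul_eq_mul,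
    mul_inv_cancel_left₀ (by positivity), intervalIntegral.integral_comp_add_right
      (fun θ => ψ (circleMap c r θ)), ← MeasureTheory.integral_Ioc_eq_integral_Ioo,
    ← intervalIntegral.integral_of_le (by linarith [Real.pi_pos])]
  congr 1 <;> ring

lemma lintegral_ball_eq_lintegral_circleAverage {ψ : ℂ → ℝ} {c : ℂ} {R : ℝ}
    (hψ : ContinuousOn ψ (Metric.ball c R)) (h0 : ∀ z, 0 ≤ ψ z) :
    ∫⁻ z in Metric.ball c R, ENNReal.ofReal (ψ z)
      = ∫⁻ r in Set.Ioo 0 R, ENNReal.ofReal (r * (2 * Real.pi * Real.circleAverage ψ c r)) := by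
  classical
  set Ψ : ℂ → ℝ≥0∞ := (Metric.ball c R).indicator fun z => ENNReal.ofReal (ψ z) with hΨ
  have hm : Measurable Ψ := by
    have h1 : ContinuousOn (fun z => ENNReal.ofReal (ψ z)) (Metric.ball c R) :=
      ENNReal.continuous_ofReal.comp_continuousOn hψ
    have := h1.measurable_piecewise (g := fun _ => (0 : ℝ≥0∞)) continuousOn_const
      (Metric.isOpen_ball.measurableSet)
    have e : (Metric.ball c R).piecewise (fun z => ENNReal.ofReal (ψ z)) (fun _ => 0) = Ψ :=
      Set.piecewise_eq_indicator
    rwa [e] at this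
  rw [← MeasureTheory.lintegral_indicator Metric.isOpen_ball.measurableSet,
    ← MeasureTheory.lintegral_add_left_eq_self _ c,
    ← Complex.lintegral_comp_polarCoord_symm, polarCoord_target,
    MeasureTheory.Measure.volume_eq_prod, ← MeasureTheory.Measure.prod_restrict,
    MeasureTheory.lintegral_prod]
  · rw [← MeasureTheory.lintegral_indicator measurableSet_Ioi,
      ← MeasureTheory.lintegral_indicator measurableSet_Ioo]
    refine MeasureTheory.lintegral_congr fun r => ?_
    have e : ∀ θ : ℝ, c + Complex.polarCoord.symm (r, θ) = circleMap c r θ := fun θ => by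
      rw [Complex.polarCoord_symm_apply]
      simp [circleMap, Complex.exp_mul_I]
    by_cases hr0 : 0 < r
    · by_cases hrR : r < R
      · rw [Set.indicator_of_mem (show r ∈ Set.Ioi 0 from hr0),
          Set.indicator_of_mem (show r ∈ Set.Ioo 0 R from ⟨hr0, hrR⟩), ENNReal.ofReal_mul hr0.le,
          ← lintegral_Ioo_circleMap (hψ.mono ?_) h0,
          ← MeasureTheory.lintegral_const_mul' _ _ ENNReal.ofReal_ne_top]
        · refine MeasureTheory.lintegral_congr fun θ => ?_
          simp only [e, smul_eq_mul]
          rw [Set.indicator_of_mem]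
          simp [circleMap, abs_of_pos hr0, hrR]
        · rw [abs_of_pos hr0]
          exact Metric.sphere_subset_closedBall.trans (Metric.closedBall_subset_ball hrR)
      · rw [Set.indicator_of_mem (show r ∈ Set.Ioi 0 from hr0),
          Set.indicator_of_notMem (fun h : r ∈ Set.Ioo 0 R => hrR h.2)]
        simp only [e, smul_eq_mul]
        refine (MeasureTheory.lintegral_congr fun θ => ?_).trans MeasureTheory.lintegral_zero
        rw [Set.indicator_of_notMem, mul_zero]
        simpa [mem_ball_iff_norm, circleMap, abs_of_pos hr0] using hrR
    · rw [Set.indicator_of_notMem (fun h : r ∈ Set.Ioi 0 => hr0 h),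
        Set.indicator_of_notMem (fun h : r ∈ Set.Ioo 0 R => hr0 h.1)]
  · refine Measurable.aemeasurable ?_
    have h1 : Measurable fun p : ℝ × ℝ => c + Complex.polarCoord.symm p := by
      have : (fun p : ℝ × ℝ => c + Complex.polarCoord.symm p)
          = fun p : ℝ × ℝ => c + (p.1 : ℂ) * (Real.cos p.2 + Real.sin p.2 * Complex.I) := by
        ext p
        rw [Complex.polarCoord_symm_apply]
      rw [this]
      exact Continuous.measurable (by fun_prop)
    exact (ENNReal.measurable_ofReal.comp measurable_fst).mul (hm.comp h1)

/-- The mean value property of the holomorphic function `h²`, followed by the triangle inequality.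
-/
lemma norm_sq_le_circleAverage {h : ℂ → ℂ} {c : ℂ} {r R : ℝ} (hr : 0 ≤ r) (hrR : r < R)
    (hh : DifferentiableOn ℂ h (Metric.ball c R)) :
    ‖h c‖ ^ 2 ≤ Real.circleAverage (fun z => ‖h z‖ ^ 2) c r := by
  have hd : DiffContOnCl ℂ (fun z => h z ^ 2) (Metric.ball c |r|) := by
    rw [abs_of_nonneg hr]
    refine DifferentiableOn.diffContOnCl ((hh.pow 2).mono ?_)
    exact Metric.closure_ball_subset_closedBall.trans (Metric.closedBall_subset_ball hrR)
  have h1 := hd.circleAverage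
  rw [← norm_pow, ← h1]
  unfold Real.circleAverage
  rw [norm_smul, Real.norm_of_nonneg (by positivity), smul_eq_mul]
  refine mul_le_mul_of_nonneg_left ?_ (by positivity)
  refine (intervalIntegral.norm_integral_le_integral_norm
    (by positivity : (0 : ℝ) ≤ 2 * Real.pi)).trans_eq ?_
  congr 1
  ext θ
  rw [norm_pow]

lemma lintegral_Ioo_ofReal {a b : ℝ} (hab : a ≤ b) {g : ℝ → ℝ} (hg : Continuous g)
    (h0 : ∀ x ∈ Set.Ioo a b, 0 ≤ g x) :
    ∫⁻ x in Set.Ioo a b, ENNReal.ofReal (g x) = ENNReal.ofReal (∫ x in a..b, g x) := by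
  rw [intervalIntegral.integral_of_le hab, MeasureTheory.integral_Ioc_eq_integral_Ioo,
    MeasureTheory.ofReal_integral_eq_lintegral_ofReal]
  · exact (hg.integrableOn_Icc (a := a) (b := b)).mono_set Set.Ioo_subset_Icc_self
  · exact (MeasureTheory.ae_restrict_iff' measurableSet_Ioo).mpr (Filter.Eventually.of_forall h0)

/-- The mean value inequality for `|h|²` on a disk. -/
lemma norm_sq_mul_area_le {h : ℂ → ℂ} {c : ℂ} {R : ℝ} (hR : 0 ≤ R)
    (hh : DifferentiableOn ℂ h (Metric.ball c R)) :
    ENNReal.ofReal (Real.pi * R ^ 2 * ‖h c‖ ^ 2)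
      ≤ ∫⁻ z in Metric.ball c R, ENNReal.ofReal (‖h z‖ ^ 2) := by
  have hc : ContinuousOn (fun z => ‖h z‖ ^ 2) (Metric.ball c R) := hh.continuousOn.norm.pow 2
  rw [lintegral_ball_eq_lintegral_circleAverage hc (fun z => sq_nonneg _)]
  have e : ENNReal.ofReal (Real.pi * R ^ 2 * ‖h c‖ ^ 2)
      = ∫⁻ r in Set.Ioo 0 R, ENNReal.ofReal (r * (2 * Real.pi * ‖h c‖ ^ 2)) := by
    rw [lintegral_Ioo_ofReal hR (by fun_prop)
      (fun x hx => mul_nonneg hx.1.le (by positivity)), intervalIntegral.integral_mul_const,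
      integral_id]
    congr 1
    ring
  rw [e]
  refine MeasureTheory.setLIntegral_mono' measurableSet_Ioo fun r hr => ?_
  refine ENNReal.ofReal_le_ofReal (mul_le_mul_of_nonneg_left ?_ hr.1.le)
  exact mul_le_mul_of_nonneg_left (norm_sq_le_circleAverage hr.1.le hr.2 hh) (by positivity)

/-- Parseval on each circle, then integration in `r`: the weight of the `k`-th coefficient is `2π
∫₀¹ (r^(2k+1) - r^(2k+3)) dr = π/((k+1)(k+2))`. -/
lemma lintegral_norm_sq_mul_one_sub_norm_sq {H : ℂ → ℂ} (hH : IsHol H) :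
    ∫⁻ z in Metric.ball (0 : ℂ) 1, ENNReal.ofReal (‖H z‖ ^ 2 * (1 - ‖z‖ ^ 2))
      = ENNReal.ofReal Real.pi *
        ∑' k : ℕ, ENNReal.ofReal (‖taylorCoeff H k‖ ^ 2 / ((k + 1) * (k + 2))) := by
  -- The absolute value changes nothing on the disk, but makes the integrand nonnegative on all of
  -- `ℂ`, as the polar formula requires.
  have e0 : ∫⁻ z in Metric.ball (0 : ℂ) 1, ENNReal.ofReal (‖H z‖ ^ 2 * (1 - ‖z‖ ^ 2))
      = ∫⁻ z in Metric.ball (0 : ℂ) 1, ENNReal.ofReal (‖H z‖ ^ 2 * |1 - ‖z‖ ^ 2|) := by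
    refine MeasureTheory.setLIntegral_congr_fun Metric.isOpen_ball.measurableSet fun z hz => ?_
    rw [mem_ball_zero_iff] at hz
    rw [abs_of_nonneg (by nlinarith [norm_nonneg z])]
  have hc : ContinuousOn (fun z => ‖H z‖ ^ 2 * |1 - ‖z‖ ^ 2|) (Metric.ball 0 1) :=
    (hH.continuousOn.norm.pow 2).mul (by fun_prop)
  rw [e0, lintegral_ball_eq_lintegral_circleAverage hc (fun z => by positivity)]
  have e1 : ∀ r ∈ Set.Ioo (0 : ℝ) 1, ENNReal.ofReal (r * (2 * Real.pi *
      Real.circleAverage (fun z => ‖H z‖ ^ 2 * |1 - ‖z‖ ^ 2|) 0 r))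
      = ∑' k : ℕ, ENNReal.ofReal
        ((2 * Real.pi * ‖taylorCoeff H k‖ ^ 2) * (r ^ (2 * k + 1) - r ^ (2 * k + 3))) := by
    intro r hr
    have h1 : Real.circleAverage (fun z => ‖H z‖ ^ 2 * |1 - ‖z‖ ^ 2|) 0 r
        = (1 - r ^ 2) * Real.circleAverage (fun z => ‖H z‖ ^ 2) 0 r := by
      rw [← smul_eq_mul, ← Real.circleAverage_fun_smul]
      refine Real.circleAverage_congr_sphere fun z hz => ?_
      have hz1 : ‖z‖ = r := by simpa [abs_of_pos hr.1] using hz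
      simp only [hz1, smul_eq_mul]
      rw [abs_of_nonneg (by nlinarith [hr.1, hr.2]), mul_comm]
    have h2 := (hasSum_circleAverage_of_isHol hH hr.1.le hr.2).mul_left
      (r * (2 * Real.pi * (1 - r ^ 2)))
    rw [h1, show r * (2 * Real.pi * ((1 - r ^ 2) * Real.circleAverage (fun z => ‖H z‖ ^ 2) 0 r))
      = r * (2 * Real.pi * (1 - r ^ 2)) * Real.circleAverage (fun z => ‖H z‖ ^ 2) 0 r by ring,
      ← h2.tsum_eq, ENNReal.ofReal_tsum_of_nonneg _ h2.summable]
    · congr 1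
      ext k
      congr 1
      ring
    · intro k
      have : 0 ≤ 1 - r ^ 2 := by nlinarith [hr.1, hr.2]
      have := hr.1
      positivity
  rw [MeasureTheory.setLIntegral_congr_fun measurableSet_Ioo e1, MeasureTheory.lintegral_tsum,
    ← ENNReal.tsum_mul_left]
  · congr 1
    ext k
    rw [lintegral_Ioo_ofReal zero_le_one (by fun_prop), ← ENNReal.ofReal_mul Real.pi_pos.le]
    · congr 1
      rw [intervalIntegral.integral_const_mul, intervalIntegral.integral_sub
        ((continuous_pow _).intervalIntegrable _ _) ((continuous_pow _).intervalIntegrable _ _),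
        integral_pow, integral_pow]
      have h1 : (k + 1 : ℝ) ≠ 0 := by positivity
      have h2 : (k + 2 : ℝ) ≠ 0 := by positivity
      have h3 : (2 * (k : ℝ) + 1 + 1) ≠ 0 := by positivity
      have h4 : (2 * (k : ℝ) + 3 + 1) ≠ 0 := by positivity
      push_cast
      simp only [one_pow, ne_eq, Nat.add_eq_zero_iff, not_false_eq_true, zero_pow, sub_zero,
        one_ne_zero, and_false]
      field_simp
      ring
    · intro r hr
      have : r ^ (2 * k + 3) ≤ r ^ (2 * k + 1) := pow_le_pow_of_le_one hr.1.le hr.2.le (by omega)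
      have := sub_nonneg.mpr this
      positivity
  · intro k
    exact (ENNReal.continuous_ofReal.comp (by fun_prop)).measurable.aemeasurable

/-! ### The local Dirichlet integral of `a + (z - ζ) g` -/

lemma one_sub_conj_mul_norm {ζ : ℂ} (hζ : ‖ζ‖ = 1) (z : ℂ) : ‖1 - conj ζ * z‖ = ‖z - ζ‖ := by
  have h : 1 - conj ζ * z = conj ζ * (ζ - z) := by
    rw [mul_sub, Complex.conj_mul', hζ]
    simp
  rw [h, norm_mul, RCLike.norm_conj, hζ, one_mul, norm_sub_rev]

/-- The telescoping identity behind the formula `D_ζ(a + (z - ζ) g) = ‖g‖²`. -/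
lemma telescoping_identity (S g : ℂ) {n : ℝ} (hn : 0 < n) :
    ‖S - n * g‖ ^ 2 / (n * (n + 1)) = ‖g‖ ^ 2 + ‖S‖ ^ 2 / n - ‖S + g‖ ^ 2 / (n + 1) := by
  have h1 : ‖S - n * g‖ ^ 2 = ‖S‖ ^ 2 - 2 * n * (S * conj g).re + n ^ 2 * ‖g‖ ^ 2 := by
    simp only [← Complex.normSq_eq_norm_sq, Complex.normSq_apply]
    simp
    ring
  have h2 : ‖S + g‖ ^ 2 = ‖S‖ ^ 2 + 2 * (S * conj g).re + ‖g‖ ^ 2 := by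
    simp only [← Complex.normSq_eq_norm_sq, Complex.normSq_apply]
    simp
    ring
  rw [h1, h2]
  field_simp
  ring

/-- The hypothesis on coefficients says `f = a + (z - ζ) ∑ g n zⁿ`. With `H = f'/(1 - conj ζ z)` the
Dirichlet integral becomes `∑ |H_k|²/((k+1)(k+2))`, a telescoping sum in the partial sums `S` of `∑
ζ^j g j`. -/
lemma dirichletIntegral_le_tsum {ζ : ℂ} (hζ : ‖ζ‖ = 1) {f : ℂ → ℂ} (hf : IsHol f) {g : ℕ → ℂ}
    (hg : Summable fun n => ‖g n‖ ^ 2)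
    (hfg : ∀ n, taylorCoeff f (n + 1) = g n - ζ * g (n + 1)) :
    dirichletIntegral ζ f ≤ ENNReal.ofReal (∑' n, ‖g n‖ ^ 2) := by
  have hζ0 : ζ ≠ 0 := by intro h; simp [h] at hζ
  have hζc : conj ζ = ζ⁻¹ := by rw [Complex.inv_eq_conj hζ]
  set S : ℕ → ℂ := fun n => ∑ j ∈ Finset.range n, ζ ^ j * g j with hS
  set H : ℂ → ℂ := fun z => deriv f z / (1 - conj ζ * z) with hHdef
  have hne : ∀ z ∈ Metric.ball (0 : ℂ) 1, 1 - conj ζ * z ≠ 0 := fun z hz h => by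
    rw [mem_ball_zero_iff] at hz
    have := one_sub_conj_mul_norm hζ z
    rw [h, norm_zero, eq_comm, norm_eq_zero, sub_eq_zero] at this
    rw [this] at hz
    linarith
  have hH : IsHol H := DifferentiableOn.div hf.deriv (by fun_prop) hne
  have hrec0 : taylorCoeff H 0 = taylorCoeff f 1 := by
    have : taylorCoeff H 0 = taylorCoeff (deriv f) 0 := by simp [taylorCoeff, hHdef]
    rw [this, taylorCoeff_deriv]
    simp
  have hrec : ∀ k, taylorCoeff H (k + 1) - conj ζ * taylorCoeff H k
      = (k + 2) * taylorCoeff f (k + 2) := by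
    -- Comparison of coefficients in `(1 - conj ζ z) H = f'`; the shifted sequence is `0` at index
    -- `0`.
    have h1 := taylorCoeff_of_hasSum (f := deriv f)
      (a := fun n => taylorCoeff H n - conj ζ * (if n = 0 then 0 else taylorCoeff H (n - 1)))
      (fun z hz => by
        have h2 := hasSum_taylorCoeff hH hz
        have h3 : HasSum (fun n => conj ζ * (if n = 0 then 0 else taylorCoeff H (n - 1)) * z ^ n)
            (conj ζ * z * H z) := by
          rw [← hasSum_nat_add_iff' 1]
          simp only [Finset.range_one, Finset.sum_singleton, if_true, mul_zero, zero_mul, sub_zero]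
          refine (h2.mul_left (conj ζ * z)).congr_fun fun n => ?_
          simp only [Nat.add_eq_zero_iff, one_ne_zero, and_false, if_false, Nat.add_sub_cancel]
          ring
        have h4 := h2.sub h3
        have h5 : H z - conj ζ * z * H z = deriv f z := by
          have := hne z hz
          simp only [hHdef]
          field_simp
        rw [h5] at h4
        exact h4.congr_fun fun n => by ring)
    intro k
    have h2 := h1.2 (k + 1)
    rw [taylorCoeff_deriv] at h2
    simp only [Nat.add_eq_zero_iff, one_ne_zero, and_false, if_false, Nat.add_sub_cancel] at h2
    rw [← h2]
    push_cast
    ring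
  have hform : ∀ k, ζ ^ k * taylorCoeff H k = S (k + 1) - (k + 1) * (ζ ^ (k + 1) * g (k + 1)) := by
    intro k
    induction k with
    | zero =>
      rw [hrec0, hfg]
      simp [hS]
    | succ k ih =>
      have h1 := hrec k
      rw [hfg (k + 1)] at h1
      have h2 : ζ ^ (k + 1) * taylorCoeff H (k + 1) = ζ ^ k * taylorCoeff H k
          + ζ ^ (k + 1) * ((k + 2) * (g (k + 1) - ζ * g (k + 1 + 1))) := by
        rw [← h1, hζc]
        field_simp
        ring
      have h3 : S (k + 1 + 1) = S (k + 1) + ζ ^ (k + 1) * g (k + 1) := Finset.sum_range_succ _ _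
      rw [h2, ih, h3]
      push_cast
      ring
  have hterm : ∀ k : ℕ, ‖taylorCoeff H k‖ ^ 2 / ((k + 1) * (k + 2))
      = ‖g (k + 1)‖ ^ 2 + ‖S (k + 1)‖ ^ 2 / (k + 1) - ‖S (k + 2)‖ ^ 2 / (k + 2) := by
    intro k
    have h1 : ‖taylorCoeff H k‖ = ‖S (k + 1) - ((k + 1 : ℝ) : ℂ) * (ζ ^ (k + 1) * g (k + 1))‖ := by
      have := congrArg norm (hform k)
      rw [norm_mul, norm_pow, hζ, one_pow, one_mul] at this
      rw [this]
      push_cast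
      rfl
    have h2 := telescoping_identity (S (k + 1)) (ζ ^ (k + 1) * g (k + 1))
      (n := (k : ℝ) + 1) (by positivity)
    rw [h1, show (k : ℝ) + 2 = k + 1 + 1 by ring, h2, norm_mul, norm_pow, hζ, one_pow, one_mul]
    congr 3
    exact congrArg norm (Finset.sum_range_succ _ _).symm
  have hsum : ∀ N : ℕ, ∑ k ∈ Finset.range N, ‖taylorCoeff H k‖ ^ 2 / ((k + 1) * (k + 2))
      = ∑ k ∈ Finset.range (N + 1), ‖g k‖ ^ 2 - ‖S (N + 1)‖ ^ 2 / (N + 1) := by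
    intro N
    induction N with
    | zero => simp [hS]
    | succ N ih =>
      rw [Finset.sum_range_succ, ih, Finset.sum_range_succ _ (N + 1), hterm]
      push_cast
      ring
  have hle : ∑' k : ℕ, ENNReal.ofReal (‖taylorCoeff H k‖ ^ 2 / ((k + 1) * (k + 2)))
      ≤ ENNReal.ofReal (∑' n, ‖g n‖ ^ 2) := by
    refine ENNReal.tsum_le_of_sum_range_le fun N => ?_
    rw [← ENNReal.ofReal_sum_of_nonneg (fun _ _ => by positivity)]
    refine ENNReal.ofReal_le_ofReal ?_
    rw [hsum]
    -- Only an upper bound is wanted, so the nonnegative remainder `‖S (N+1)‖²/(N+1)` is dropped.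
    have h1 := hg.sum_le_tsum (Finset.range (N + 1)) (fun _ _ => sq_nonneg _)
    have h2 : 0 ≤ ‖S (N + 1)‖ ^ 2 / ((N : ℝ) + 1) := by positivity
    linarith
  unfold dirichletIntegral
  have e : ∫⁻ z in Metric.ball (0 : ℂ) 1,
      ENNReal.ofReal (‖deriv f z‖ ^ 2 * ((1 - ‖z‖ ^ 2) / ‖z - ζ‖ ^ 2))
      = ∫⁻ z in Metric.ball (0 : ℂ) 1, ENNReal.ofReal (‖H z‖ ^ 2 * (1 - ‖z‖ ^ 2)) := by
    refine MeasureTheory.setLIntegral_congr_fun Metric.isOpen_ball.measurableSet fun z hz => ?_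
    simp only [hHdef, norm_div, one_sub_conj_mul_norm hζ z]
    congr 1
    ring
  rw [e, lintegral_norm_sq_mul_one_sub_norm_sq hH, ← mul_assoc,
    ← ENNReal.ofReal_mul (by positivity), one_div, inv_mul_cancel₀ Real.pi_ne_zero]
  simpa using hle

/-! ### Two-point estimates for the kernel -/

lemma norm_dbrMatrix_apply (b : SchurFunction) (z w : Complex.UnitDisc) :
    ‖dbrMatrix b z w‖ = ‖dbrKernel b z w‖ := by
  simp [dbrMatrix, norm_smul]

/-- Cauchy–Schwarz for the kernel functions at `z` and `w` in `H(b)`. -/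
lemma norm_dbrKernel_sq_le (b : SchurFunction) (z w : Complex.UnitDisc) :
    ‖dbrKernel b z w‖ ^ 2 ≤ ‖dbrKernel b z z‖ * ‖dbrKernel b w w‖ := by
  have h := RKHS.norm_kernel_sq_le (DeBrangesRovnyak b) z w
  simpa only [RKHS.OfKernel.kernel_ofKernel, norm_dbrMatrix_apply] using h

lemma dbrKernel_self (b : ℂ → ℂ) (w : ℂ) :
    dbrKernel b w w = (((1 - ‖b w‖ ^ 2) / (1 - ‖w‖ ^ 2) : ℝ) : ℂ) := by
  unfold dbrKernel
  rw [Complex.conj_mul', Complex.conj_mul']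
  push_cast
  rfl

lemma one_sub_norm_sq_nonneg (b : SchurFunction) {z : ℂ} (hz : z ∈ Metric.ball (0 : ℂ) 1) :
    0 ≤ 1 - ‖b z‖ ^ 2 := by
  nlinarith [b.norm_apply_le hz, norm_nonneg (b z)]

lemma norm_dbrKernel_self (b : SchurFunction) {z : ℂ} (hz : ‖z‖ < 1) :
    ‖dbrKernel b z z‖ = (1 - ‖b z‖ ^ 2) / (1 - ‖z‖ ^ 2) := by
  rw [dbrKernel_self, Complex.norm_real, Real.norm_of_nonneg]
  exact div_nonneg (one_sub_norm_sq_nonneg b (by simpa using hz)) (by nlinarith [norm_nonneg z])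

/-- The Cauchy–Schwarz bound for `k^b` with denominators cleared. It yields Schwarz–Pick, and
Julia's inequality when `w` tends to the boundary. -/
lemma norm_one_sub_conj_mul_sq_le (b : SchurFunction) {z w : ℂ} (hz : ‖z‖ < 1) (hw : ‖w‖ < 1) :
    ‖1 - conj (b w) * b z‖ ^ 2 * ((1 - ‖z‖ ^ 2) * (1 - ‖w‖ ^ 2))
      ≤ (1 - ‖b z‖ ^ 2) * (1 - ‖b w‖ ^ 2) * ‖1 - conj w * z‖ ^ 2 := by
  have h := norm_dbrKernel_sq_le b (Complex.UnitDisc.mk z hz) (Complex.UnitDisc.mk w hw)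
  simp only [Complex.UnitDisc.coe_mk] at h
  rw [norm_dbrKernel_self b hz, norm_dbrKernel_self b hw] at h
  have h1 : 0 < ‖1 - conj w * z‖ := norm_pos_iff.mpr (one_sub_conj_mul_ne_zero hw hz.le)
  have h2 : 0 < 1 - ‖z‖ ^ 2 := by nlinarith [norm_nonneg z]
  have h3 : 0 < 1 - ‖w‖ ^ 2 := by nlinarith [norm_nonneg w]
  unfold dbrKernel at h
  rw [norm_div, div_pow, div_mul_div_comm, div_le_div_iff₀ (by positivity) (by positivity)] at h
  exact h

lemma norm_one_sub_conj_mul_sq_sub (a c : ℂ) :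
    ‖1 - conj c * a‖ ^ 2 - ‖a - c‖ ^ 2 = (1 - ‖a‖ ^ 2) * (1 - ‖c‖ ^ 2) := by
  simp only [← Complex.normSq_eq_norm_sq, Complex.normSq_apply]
  simp
  ring

/-- The Schwarz–Pick inequality for pseudohyperbolic distances. -/
lemma norm_sub_mul_le (b : SchurFunction) {z w : ℂ} (hz : ‖z‖ < 1) (hw : ‖w‖ < 1) :
    ‖b z - b w‖ * ‖1 - conj w * z‖ ≤ ‖1 - conj (b w) * b z‖ * ‖z - w‖ := by
  have h := norm_one_sub_conj_mul_sq_le b hz hw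
  rw [← norm_one_sub_conj_mul_sq_sub z w, ← norm_one_sub_conj_mul_sq_sub (b z) (b w)] at h
  refine abs_le_of_sq_le_sq' ?_ (by positivity) |>.2
  rw [mul_pow, mul_pow]
  linarith

/-- Infinitesimal Schwarz–Pick: the two-point inequality divided by `‖z - w‖`, as `z → w`. -/
lemma norm_deriv_mul_le (b : SchurFunction) {w : ℂ} (hw : ‖w‖ < 1) :
    ‖deriv b w‖ * (1 - ‖w‖ ^ 2) ≤ 1 - ‖b w‖ ^ 2 := by
  have hwb : w ∈ Metric.ball (0 : ℂ) 1 := by simpa using hw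
  have hd : HasDerivAt b (deriv b w) w :=
    (b.isHol.differentiableAt (Metric.isOpen_ball.mem_nhds hwb)).hasDerivAt
  have h1 := (hasDerivAt_iff_tendsto_slope.mp hd).norm
  have hc : ContinuousAt b w := hd.continuousAt
  have h2 : Filter.Tendsto (fun z => ‖1 - conj w * z‖) (𝓝[≠] w) (𝓝 ‖1 - conj w * w‖) :=
    ((by fun_prop : Continuous fun z => ‖1 - conj w * z‖).tendsto w).mono_left nhdsWithin_le_nhds
  have h3 : Filter.Tendsto (fun z => ‖1 - conj (b w) * b z‖) (𝓝[≠] w)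
      (𝓝 ‖1 - conj (b w) * b w‖) := by
    have : ContinuousAt (fun z => ‖1 - conj (b w) * b z‖) w := by fun_prop
    exact this.tendsto.mono_left nhdsWithin_le_nhds
  have e1 : ‖1 - conj w * w‖ = 1 - ‖w‖ ^ 2 := by
    rw [Complex.conj_mul', ← Complex.ofReal_pow, ← Complex.ofReal_one, ← Complex.ofReal_sub,
      Complex.norm_real, Real.norm_of_nonneg (by nlinarith [norm_nonneg w])]
  have e2 : ‖1 - conj (b w) * b w‖ = 1 - ‖b w‖ ^ 2 := by
    rw [Complex.conj_mul', ← Complex.ofReal_pow, ← Complex.ofReal_one, ← Complex.ofReal_sub,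
      Complex.norm_real, Real.norm_of_nonneg (one_sub_norm_sq_nonneg b hwb)]
  rw [← e1, ← e2]
  refine le_of_tendsto_of_tendsto (h1.mul h2) h3 ?_
  filter_upwards [self_mem_nhdsWithin,
    nhdsWithin_le_nhds (Metric.isOpen_ball.mem_nhds hwb)] with z hz hzb
  have hz0 : 0 < ‖z - w‖ := norm_pos_iff.mpr (sub_ne_zero.mpr hz)
  have h := norm_sub_mul_le b (by simpa using hzb) hw
  rw [slope_def_field, norm_div, div_mul_eq_mul_div, div_le_iff₀ hz0]
  exact h

/-! ### Necessity: testing the embedding on kernel functions -/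

lemma dirichletIntegral_congr {f g : ℂ → ℂ} (ζ : ℂ) (h : Set.EqOn f g (Metric.ball 0 1)) :
    dirichletIntegral ζ f = dirichletIntegral ζ g := by
  unfold dirichletIntegral
  congr 1
  refine MeasureTheory.setLIntegral_congr_fun Metric.isOpen_ball.measurableSet fun z hz => ?_
  rw [(h.eventuallyEq_of_mem (Metric.isOpen_ball.mem_nhds hz)).deriv_eq]

lemma isHol_dbrKernel {b : ℂ → ℂ} (hb : IsHol b) {w : ℂ} (hw : ‖w‖ < 1) :
    IsHol fun z => dbrKernel b z w := by
  unfold dbrKernel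
  refine DifferentiableOn.div ?_ (by fun_prop) fun z hz =>
    one_sub_conj_mul_ne_zero hw (mem_ball_zero_iff.mp hz).le
  have hb' : DifferentiableOn ℂ b (Metric.ball 0 1) := hb
  fun_prop

/-- The numerator of `k_w'(w)` is `(1 - |b w|²) conj w - conj (b w) b'(w) (1 - |w|²)`, and
Schwarz–Pick bounds the second term by `|b w| (1 - |b w|²)`. -/
lemma le_norm_deriv_dbrKernel (b : SchurFunction) {w : ℂ} (hw : ‖w‖ < 1) :
    (1 - ‖b w‖ ^ 2) * (‖w‖ - ‖b w‖)
      ≤ ‖deriv (fun z => dbrKernel b z w) w‖ * (1 - ‖w‖ ^ 2) ^ 2 := by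
  have hwb : w ∈ Metric.ball (0 : ℂ) 1 := by simpa using hw
  have hd : HasDerivAt b (deriv b w) w :=
    (b.isHol.differentiableAt (Metric.isOpen_ball.mem_nhds hwb)).hasDerivAt
  have hne : 1 - conj w * w ≠ 0 := one_sub_conj_mul_ne_zero hw hw.le
  have h1 : HasDerivAt (fun z => dbrKernel b z w)
      (((0 - conj (b w) * deriv b w) * (1 - conj w * w)
        - (1 - conj (b w) * b w) * (0 - conj w * 1)) / (1 - conj w * w) ^ 2) w := by
    refine HasDerivAt.div ?_ ?_ hne
    · exact (hasDerivAt_const _ _).sub (hd.const_mul _)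
    · exact (hasDerivAt_const _ _).sub ((hasDerivAt_id w).const_mul _)
  have hw1 : 0 < 1 - ‖w‖ ^ 2 := by nlinarith [norm_nonneg w]
  have hbw := one_sub_norm_sq_nonneg b hwb
  have e : (0 - conj (b w) * deriv b w) * (1 - conj w * w)
        - (1 - conj (b w) * b w) * (0 - conj w * 1)
      = ((1 - ‖b w‖ ^ 2 : ℝ) : ℂ) * conj w
        - conj (b w) * deriv b w * ((1 - ‖w‖ ^ 2 : ℝ) : ℂ) := by
    rw [Complex.conj_mul', Complex.conj_mul']
    push_cast
    ring
  have e2 : (1 - conj w * w) ^ 2 = (((1 - ‖w‖ ^ 2) ^ 2 : ℝ) : ℂ) := by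
    rw [Complex.conj_mul']
    push_cast
    rfl
  rw [h1.deriv, e, e2, norm_div, Complex.norm_real, Real.norm_of_nonneg (by positivity),
    div_mul_cancel₀ _ (by positivity)]
  refine le_trans ?_ (norm_sub_norm_le _ _)
  rw [norm_mul, norm_mul, norm_mul, Complex.norm_real, Complex.norm_real, RCLike.norm_conj,
    RCLike.norm_conj, Real.norm_of_nonneg hbw, Real.norm_of_nonneg hw1.le]
  have := mul_le_mul_of_nonneg_left (norm_deriv_mul_le b hw) (norm_nonneg (b w))
  nlinarith

/-- A lower bound for the local Dirichlet integral, from the mean value inequality on a disk of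
hyperbolic size. -/
lemma ofReal_le_dirichletIntegral {ζ : ℂ} (hζ : ‖ζ‖ = 1) {f : ℂ → ℂ} (hf : IsHol f) {w : ℂ}
    (hw : ‖w‖ < 1) :
    ENNReal.ofReal ((1 - ‖w‖) ^ 3 * ‖deriv f w‖ ^ 2 / (32 * ‖w - ζ‖ ^ 2))
      ≤ dirichletIntegral ζ f := by
  set d := 1 - ‖w‖ with hd
  have hd0 : 0 < d := by linarith
  have ht : d ≤ ‖w - ζ‖ := by
    have := norm_sub_norm_le ζ w
    rw [norm_sub_rev] at this
    linarith
  have hsub : Metric.ball w (d / 2) ⊆ Metric.ball 0 1 := by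
    intro z hz
    rw [mem_ball_iff_norm] at hz
    rw [mem_ball_zero_iff]
    have : ‖z‖ ≤ ‖z - w‖ + ‖w‖ := by simpa using norm_add_le (z - w) w
    linarith
  have h1 := norm_sq_mul_area_le (c := w) (R := d / 2) (by linarith) (hf.deriv.mono hsub)
  unfold dirichletIntegral
  have ht0 : 0 < ‖w - ζ‖ := hd0.trans_le ht
  -- On the disk of radius `d/2` one has `1 - |z|² ≥ d/2` and `|z - ζ| ≤ 2|w - ζ|`, so the weight is
  -- at least `d/(8|w - ζ|²)`. The area factor `π(d/2)²` then turns `8` into `32`.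
  have h2 : ENNReal.ofReal (d / (8 * ‖w - ζ‖ ^ 2)) *
      ∫⁻ z in Metric.ball w (d / 2), ENNReal.ofReal (‖deriv f z‖ ^ 2)
      ≤ ∫⁻ z in Metric.ball (0 : ℂ) 1,
        ENNReal.ofReal (‖deriv f z‖ ^ 2 * ((1 - ‖z‖ ^ 2) / ‖z - ζ‖ ^ 2)) := by
    rw [← MeasureTheory.lintegral_const_mul' _ _ ENNReal.ofReal_ne_top]
    refine le_trans ?_ (MeasureTheory.lintegral_mono_set hsub)
    refine MeasureTheory.setLIntegral_mono' Metric.isOpen_ball.measurableSet fun z hz => ?_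
    rw [← ENNReal.ofReal_mul (by positivity), mul_comm]
    refine ENNReal.ofReal_le_ofReal (mul_le_mul_of_nonneg_left ?_ (sq_nonneg _))
    have hz1 := mem_ball_zero_iff.mp (hsub hz)
    rw [mem_ball_iff_norm] at hz
    have h3 : ‖z‖ ≤ ‖z - w‖ + ‖w‖ := by simpa using norm_add_le (z - w) w
    have h4 : ‖z - ζ‖ ≤ 2 * ‖w - ζ‖ := by
      have : ‖z - ζ‖ ≤ ‖z - w‖ + ‖w - ζ‖ := by simpa using norm_add_le (z - w) (w - ζ)
      linarith
    have h5 : 0 < ‖z - ζ‖ := by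
      have := norm_sub_norm_le ζ z
      rw [norm_sub_rev] at this
      linarith
    have h6 : d / 2 ≤ 1 - ‖z‖ ^ 2 := by nlinarith [norm_nonneg z]
    calc d / (8 * ‖w - ζ‖ ^ 2) = (d / 2) / (2 * ‖w - ζ‖) ^ 2 := by field_simp; ring
      _ ≤ (1 - ‖z‖ ^ 2) / ‖z - ζ‖ ^ 2 := by
        refine div_le_div₀ (by linarith) h6 (by positivity) ?_
        exact pow_le_pow_left₀ h5.le h4 2
  refine le_trans ?_ (mul_le_mul_right h2 _)
  refine le_trans ?_ (mul_le_mul_right (mul_le_mul_right h1 _) _)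
  rw [← ENNReal.ofReal_mul (by positivity), ← ENNReal.ofReal_mul (by positivity)]
  refine ENNReal.ofReal_le_ofReal (le_of_eq ?_)
  have := Real.pi_ne_zero
  field_simp
  ring

/-- Common to both necessity statements: the hypothesis is the embedding inequality tested on kernel
functions, with the squared norm of `k_w` on the right. -/
lemma notMem_boundarySpectrum_of_kernel_bound {ζ : ℂ} (hζ : ‖ζ‖ = 1) (b : SchurFunction) (C : ℝ≥0)
    (h : ∀ w : ℂ, ‖w‖ < 1 → dirichletIntegral ζ (fun z => dbrKernel b z w)
      ≤ C * ENNReal.ofReal ((1 - ‖b w‖ ^ 2) / (1 - ‖w‖ ^ 2))) :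
    ζ ∉ boundarySpectrum b := by
  rintro ⟨-, hlt⟩
  obtain ⟨c, hc1, hc2⟩ := exists_between hlt
  have hfreq := Filter.frequently_lt_of_liminf_lt (by isBoundedDefault) hc1
  set c' := c.toReal with hc'
  have hcfin : c ≠ ∞ := (hc2.trans ENNReal.one_lt_top).ne
  have hc'1 : c' < 1 := by
    have := (ENNReal.toReal_lt_toReal hcfin ENNReal.one_ne_top).mpr hc2
    simpa using this
  have hc'0 : 0 ≤ c' := ENNReal.toReal_nonneg
  have hb : ∃ᶠ z in 𝓝[Metric.ball 0 1] ζ, ‖b z‖ < c' := by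
    refine hfreq.mono fun z hz => ?_
    have := (ENNReal.toReal_lt_toReal enorm_ne_top hcfin).mpr hz
    simpa using this
  -- A lower bound for `(1 - |b w|²)(|w| - |b w|)` when `|b w| < c'` and `|w| > (1 + c')/2`.
  set κ := (1 - c' ^ 2) * ((1 - c') / 2) with hκ
  have hκ0 : 0 < κ := by
    have h1 : 0 < 1 - c' ^ 2 := by nlinarith
    have h2 : 0 < (1 - c') / 2 := by linarith
    positivity
  -- The bounds below combine to `κ² ≤ 512 C |w - ζ|²`, where `512 = 32 · 4²`; this is excluded in
  -- advance by taking `w` close to `ζ`.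
  have hev : ∀ᶠ z in 𝓝[Metric.ball (0 : ℂ) 1] ζ, ‖z‖ < 1 ∧ (1 + c') / 2 < ‖z‖ ∧
      512 * C * ‖z - ζ‖ ^ 2 < κ ^ 2 := by
    have h1 : ∀ᶠ z in 𝓝 ζ, (1 + c') / 2 < ‖z‖ :=
      continuous_norm.continuousAt.eventually_const_lt (by simp only [hζ]; linarith)
    have h2 : ∀ᶠ z in 𝓝 ζ, 512 * C * ‖z - ζ‖ ^ 2 < κ ^ 2 := by
      have : ContinuousAt (fun z => 512 * (C : ℝ) * ‖z - ζ‖ ^ 2) ζ := by fun_prop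
      refine this.eventually_lt_const ?_
      simp only [sub_self, norm_zero]
      linarith [pow_pos hκ0 2]
    filter_upwards [self_mem_nhdsWithin, nhdsWithin_le_nhds h1, nhdsWithin_le_nhds h2]
      with z hz hz1 hz2
    exact ⟨by simpa using hz, hz1, hz2⟩
  obtain ⟨w, hbw, hw, hw1, hw2⟩ := (hb.and_eventually hev).exists
  have hlow := ofReal_le_dirichletIntegral hζ (isHol_dbrKernel b.isHol hw) hw
  have hup := hlow.trans (h w hw)
  rw [← ENNReal.ofReal_coe_nnreal, ← ENNReal.ofReal_mul C.coe_nonneg,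
    ENNReal.ofReal_le_ofReal_iff] at hup
  swap
  · exact mul_nonneg C.coe_nonneg (div_nonneg (one_sub_norm_sq_nonneg b (by simpa using hw))
      (by nlinarith [norm_nonneg w]))
  have hder := le_norm_deriv_dbrKernel b hw
  set d := 1 - ‖w‖ with hd
  set X := ‖deriv (fun z => dbrKernel b z w) w‖ with hX
  have hd0 : 0 < d := by linarith
  have hX0 : 0 ≤ X := norm_nonneg _
  have hwd : ‖w‖ = 1 - d := by linarith
  have hκ1 : κ ≤ X * (4 * d ^ 2) := by
    have h1 : κ ≤ (1 - ‖b w‖ ^ 2) * (‖w‖ - ‖b w‖) := by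
      refine mul_le_mul ?_ (by linarith) (by linarith) ?_
      · nlinarith [norm_nonneg (b w)]
      · nlinarith [norm_nonneg (b w)]
    have h2 : (1 - ‖w‖ ^ 2) ^ 2 ≤ 4 * d ^ 2 := by
      have : 1 - ‖w‖ ^ 2 ≤ 2 * d := by nlinarith [sq_nonneg d]
      have h3 : 0 ≤ 1 - ‖w‖ ^ 2 := by nlinarith [norm_nonneg w]
      nlinarith
    exact (h1.trans hder).trans (mul_le_mul_of_nonneg_left h2 hX0)
  have ht0 : 0 < ‖w - ζ‖ := by
    have := norm_sub_norm_le ζ w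
    rw [norm_sub_rev] at this
    linarith
  have hk : (1 - ‖b w‖ ^ 2) / (1 - ‖w‖ ^ 2) ≤ 1 / d := by
    refine div_le_div₀ zero_le_one (by nlinarith [norm_nonneg (b w)]) hd0 ?_
    nlinarith [norm_nonneg w]
  have hup2 : d ^ 3 * X ^ 2 / (32 * ‖w - ζ‖ ^ 2) ≤ C * (1 / d) :=
    hup.trans (mul_le_mul_of_nonneg_left hk C.coe_nonneg)
  rw [mul_one_div, div_le_div_iff₀ (by positivity) hd0] at hup2
  have : κ ^ 2 ≤ (X * (4 * d ^ 2)) ^ 2 := pow_le_pow_left₀ hκ0.le hκ1 2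
  nlinarith

/-! ### Approximating boundary data by real parts of entire functions -/

/-- Nonnegative frequencies are powers of `z`; negative ones are conjugates of powers on the circle.
-/
lemma exists_differentiable_of_mem_span_fourier {g : C(AddCircle (2 * Real.pi), ℂ)}
    (hg : g ∈ Submodule.span ℂ (Set.range (fourier (T := 2 * Real.pi)))) :
    ∃ p₁ p₂ : ℂ → ℂ, Differentiable ℂ p₁ ∧ Differentiable ℂ p₂ ∧
      ∀ x, g x = p₁ (AddCircle.toCircle x) + conj (p₂ (AddCircle.toCircle x)) := by
  induction hg using Submodule.span_induction with
  | mem g hg =>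
    obtain ⟨n, rfl⟩ := hg
    rcases Int.eq_nat_or_neg n with ⟨m, rfl | rfl⟩
    · refine ⟨fun z => z ^ m, fun _ => 0, by fun_prop, by fun_prop, fun x => ?_⟩
      simp [fourier_apply, AddCircle.toCircle_nsmul]
    · refine ⟨fun _ => 0, fun z => z ^ m, by fun_prop, by fun_prop, fun x => ?_⟩
      simp [fourier_apply, AddCircle.toCircle_nsmul, AddCircle.toCircle_neg, ← Circle.coe_inv_eq_conj]
  | zero => exact ⟨fun _ => 0, fun _ => 0, by fun_prop, by fun_prop, fun x => by simp⟩
  | add g₁ g₂ _ _ h₁ h₂ =>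
    obtain ⟨p₁, p₂, hp₁, hp₂, hp⟩ := h₁
    obtain ⟨r₁, r₂, hr₁, hr₂, hr⟩ := h₂
    refine ⟨fun z => p₁ z + r₁ z, fun z => p₂ z + r₂ z, by fun_prop, by fun_prop, fun x => ?_⟩
    simp only [ContinuousMap.add_apply, hp, hr, map_add]
    ring
  | smul c g _ h =>
    obtain ⟨p₁, p₂, hp₁, hp₂, hp⟩ := h
    refine ⟨fun z => c * p₁ z, fun z => conj c * p₂ z, by fun_prop, by fun_prop, fun x => ?_⟩
    simp only [ContinuousMap.smul_apply, hp, map_mul, Complex.conj_conj, smul_eq_mul]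
    ring

/-- Trigonometric polynomials are dense, and `p₁ + conj p₂` has the same real part as the entire
function `p₁ + p₂`. This replaces a solution of the Dirichlet problem with boundary data `q`. -/
lemma exists_differentiable_re_approx {q : ℂ → ℝ} (hq : ContinuousOn q (Metric.sphere 0 1)) {δ : ℝ}
    (hδ : 0 < δ) :
    ∃ p : ℂ → ℂ, Differentiable ℂ p ∧ ∀ z ∈ Metric.sphere (0 : ℂ) 1, |(p z).re - q z| ≤ δ := by
  have : Fact (0 < 2 * Real.pi) := ⟨by positivity⟩
  have hc : Continuous fun x : AddCircle (2 * Real.pi) => (q (AddCircle.toCircle x) : ℂ) := by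
    refine Complex.continuous_ofReal.comp (hq.comp_continuous ?_ fun x => ?_)
    · exact continuous_subtype_val.comp AddCircle.continuous_toCircle
    · rw [mem_sphere_zero_iff_norm]
      exact Circle.norm_coe _
  set Q : C(AddCircle (2 * Real.pi), ℂ) := ⟨_, hc⟩ with hQ
  have hmem : Q ∈ closure ((Submodule.span ℂ (Set.range (fourier (T := 2 * Real.pi))) :
      Submodule ℂ _) : Set C(AddCircle (2 * Real.pi), ℂ)) := by
    rw [← Submodule.topologicalClosure_coe, span_fourier_closure_eq_top]
    trivial
  obtain ⟨g, hg, hgQ⟩ := Metric.mem_closure_iff.mp hmem δ hδ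
  obtain ⟨p₁, p₂, hp₁, hp₂, hp⟩ := exists_differentiable_of_mem_span_fourier hg
  refine ⟨fun z => p₁ z + p₂ z, by fun_prop, fun z hz => ?_⟩
  have hz1 : ‖z‖ = 1 := by simpa using hz
  obtain ⟨x, hx⟩ := (AddCircle.homeomorphCircle (T := 2 * Real.pi) (by positivity)).surjective
    ⟨z, by simpa [Submonoid.unitSphere] using hz1⟩
  have hx' : (AddCircle.toCircle x : ℂ) = z := by
    rw [AddCircle.homeomorphCircle_apply] at hx
    rw [hx]
  have h1 : ‖Q x - g x‖ ≤ δ := by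
    rw [← dist_eq_norm]
    exact (ContinuousMap.dist_apply_le_dist x).trans hgQ.le
  have h2 : (p₁ z + p₂ z).re - q z = - (Q x - g x).re := by
    rw [hp x, hx']
    simp [hQ, hx']
  rw [h2, abs_neg]
  exact (Complex.abs_re_le_norm _).trans h1

lemma circleAverage_re {p : ℂ → ℂ} (hp : ContinuousOn p (Metric.sphere 0 1)) :
    Real.circleAverage (fun z => (p z).re) 0 1 = (Real.circleAverage p 0 1).re :=
  Complex.reCLM.circleAverage_comp_comm (ContinuousOn.circleIntegrable zero_le_one hp)

/-- Positivity and Harnack's inequality for real parts of holomorphic functions. -/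
lemma re_nonneg_and_le {p : ℂ → ℂ} (hp : Differentiable ℂ p)
    (h0 : ∀ z ∈ Metric.sphere (0 : ℂ) 1, 0 ≤ (p z).re) {w : ℂ} (hw : ‖w‖ < 1) :
    0 ≤ (p w).re ∧
      (p w).re ≤ 2 / (1 - ‖w‖) * Real.circleAverage (fun z => (p z).re) 0 1 := by
  have hwb : w ∈ Metric.ball (0 : ℂ) 1 := by simpa using hw
  have hP := (hp.diffContOnCl (s := Metric.ball 0 1)).circleAverage_poissonKernel_smul' hwb
  have hne : ∀ z ∈ Metric.sphere (0 : ℂ) 1, 1 - ‖w‖ ≤ ‖z - w‖ := fun z hz => by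
    have hz1 : ‖z‖ = 1 := by simpa using hz
    have := norm_sub_norm_le z w
    linarith
  have hcK : ContinuousOn (fun z : ℂ => (‖z - 0‖ ^ 2 - ‖w - 0‖ ^ 2) / ‖(z - 0) - (w - 0)‖ ^ 2)
      (Metric.sphere 0 1) := by
    refine ContinuousOn.div (by fun_prop) (by fun_prop) fun z hz => ?_
    have := hne z hz
    simp only [sub_zero]
    have : 0 < ‖z - w‖ := by linarith
    positivity
  have hcp : ContinuousOn p (Metric.sphere 0 1) := hp.continuous.continuousOn
  have hcKp : ContinuousOn (fun z : ℂ =>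
      ((‖z - 0‖ ^ 2 - ‖w - 0‖ ^ 2) / ‖(z - 0) - (w - 0)‖ ^ 2) • p z) (Metric.sphere 0 1) :=
    hcK.smul hcp
  rw [← hP, ← circleAverage_re hcKp]
  have hmem : ∀ z, z ∈ Metric.sphere (0 : ℂ) |1| → z ∈ Metric.sphere (0 : ℂ) 1 := by simp
  have hw1 : 0 < 1 - ‖w‖ := by linarith
  constructor
  · refine Real.circleAverage_nonneg_of_nonneg fun z hz => ?_
    have hz := hmem z hz
    have hz1 : ‖z‖ = 1 := by simpa using hz
    rw [Complex.smul_re, smul_eq_mul]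
    refine mul_nonneg (div_nonneg ?_ (sq_nonneg _)) (h0 z hz)
    simp only [sub_zero, hz1]
    nlinarith [norm_nonneg w]
  · rw [← smul_eq_mul, ← Real.circleAverage_fun_smul]
    have hci1 := ContinuousOn.circleIntegrable (c := (0 : ℂ)) zero_le_one
      (Complex.continuous_re.comp_continuousOn hcKp)
    have hci2 := ContinuousOn.circleIntegrable (c := (0 : ℂ)) zero_le_one
      ((Complex.continuous_re.comp_continuousOn hcp).const_smul (2 / (1 - ‖w‖)))
    refine Real.circleAverage_mono hci1 hci2 fun z hz => ?_
    have hz := hmem z hz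
    have hz1 : ‖z‖ = 1 := by simpa using hz
    rw [Complex.smul_re, smul_eq_mul, smul_eq_mul]
    refine mul_le_mul_of_nonneg_right ?_ (h0 z hz)
    simp only [sub_zero, hz1]
    have h1 := hne z hz
    -- The bound on the Poisson kernel that gives Harnack's constant.
    calc (1 ^ 2 - ‖w‖ ^ 2) / ‖z - w‖ ^ 2 ≤ (2 * (1 - ‖w‖)) / (1 - ‖w‖) ^ 2 := by
          refine div_le_div₀ (by linarith) (by nlinarith [norm_nonneg w]) (by positivity) ?_
          exact pow_le_pow_left₀ hw1.le h1 2
      _ = 2 / (1 - ‖w‖) := by field_simp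

/-! ### Boundary contact of a function which is unimodular on an arc -/

/-- Maximum principle for `exp(-A(1 - conj z₀ w) - p w)/b(s w)` on the lens cut from the disk by a
ball around the radial projection `z₀` of `z`. On the circular part `Re p` dominates `-log |b(s
·)|`; on the inner part the barrier `A (1 - Re (conj z₀ w))` does. Dilating by `s < 1` keeps
everything regular up to the boundary. -/
lemma neg_log_norm_le_of_barrier (b : SchurFunction) {ζ : ℂ} {ε : ℝ} (hε : ε ≤ 1)
    (hb : ∀ z, ‖z‖ < 1 → ‖z - ζ‖ < ε → 1 / 2 ≤ ‖b z‖) (hζ : ‖ζ‖ = 1)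
    {z : ℂ} (hz : ‖z‖ < 1) (hzζ : ‖z - ζ‖ < ε / 4) {s : ℝ} (hs0 : 0 < s) (hs1 : s < 1)
    (hs : 1 - s < ε / 4) {p : ℂ → ℂ} (hp : Differentiable ℂ p)
    (hp0 : ∀ w ∈ Metric.sphere (0 : ℂ) 1, 0 ≤ (p w).re)
    (hpb : ∀ w ∈ Metric.sphere (0 : ℂ) 1, ‖w - ζ‖ ≤ 3 * ε / 4 →
      - Real.log ‖b (s * w)‖ ≤ (p w).re) :
    - Real.log ‖b (s * z)‖ ≤ 32 * Real.log 2 / ε ^ 2 * (1 - ‖z‖) + (p z).re := by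
  have hε0 : 0 < ε := by linarith [norm_nonneg (z - ζ)]
  have hzd : 1 - ‖z‖ ≤ ‖z - ζ‖ := by
    have := norm_sub_norm_le ζ z
    rw [norm_sub_rev] at this
    linarith
  have hz0 : 0 < ‖z‖ := by linarith
  have hz0' : (‖z‖ : ℂ) ≠ 0 := by exact_mod_cast hz0.ne'
  set A := 32 * Real.log 2 / ε ^ 2 with hA
  have hA0 : 0 ≤ A := by have := Real.log_nonneg one_le_two; positivity
  set z₀ : ℂ := z / ‖z‖ with hz₀
  have hz₀1 : ‖z₀‖ = 1 := by
    rw [hz₀, norm_div, Complex.norm_real, norm_norm, div_self hz0.ne']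
  have hzz₀ : ‖z - z₀‖ = 1 - ‖z‖ := by
    have : z - z₀ = z₀ * ((‖z‖ - 1 : ℝ) : ℂ) := by
      rw [hz₀]
      push_cast
      field_simp
    rw [this, norm_mul, hz₀1, one_mul, Complex.norm_real, Real.norm_eq_abs,
      abs_of_nonpos (by linarith)]
    ring
  have hz₀ζ : ‖z₀ - ζ‖ ≤ ε / 2 := by
    have : ‖z₀ - ζ‖ ≤ ‖z₀ - z‖ + ‖z - ζ‖ := by simpa using norm_add_le (z₀ - z) (z - ζ)
    rw [norm_sub_rev z₀ z, hzz₀] at this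
    linarith
  -- The barrier is nonnegative on the closed disk, vanishes there only at `z₀`, and equals `1 -
  -- |z|` at the point `z = |z| z₀`.
  have hre : ∀ w : ℂ, 1 - (conj z₀ * w).re = (‖w - z₀‖ ^ 2 + (1 - ‖w‖ ^ 2)) / 2 := by
    intro w
    have h1 : ‖w - z₀‖ ^ 2 = ‖w‖ ^ 2 + ‖z₀‖ ^ 2 - 2 * (conj z₀ * w).re := by
      simp only [← Complex.normSq_eq_norm_sq, Complex.normSq_apply]
      simp
      ring
    rw [h1, hz₀1]
    ring
  set U := Metric.ball (0 : ℂ) 1 ∩ Metric.ball z₀ (ε / 4) with hU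
  have hcl : ∀ w ∈ closure U, ‖w‖ ≤ 1 ∧ ‖w - z₀‖ ≤ ε / 4 := fun w hw => by
    have h1 := Metric.closure_ball_subset_closedBall (closure_mono Set.inter_subset_left hw)
    have h2 := Metric.closure_ball_subset_closedBall (closure_mono Set.inter_subset_right hw)
    exact ⟨by simpa using h1, by simpa [dist_eq_norm] using h2⟩
  have hsw : ∀ w ∈ closure U, ‖(s : ℂ) * w‖ < 1 ∧ ‖(s : ℂ) * w - ζ‖ < ε ∧ ‖w - ζ‖ ≤ 3 * ε / 4 := by
    intro w hw
    obtain ⟨h1, h2⟩ := hcl w hw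
    have h3 : ‖w - ζ‖ ≤ 3 * ε / 4 := by
      have : ‖w - ζ‖ ≤ ‖w - z₀‖ + ‖z₀ - ζ‖ := by simpa using norm_add_le (w - z₀) (z₀ - ζ)
      linarith
    refine ⟨?_, ?_, h3⟩
    · rw [norm_mul, Complex.norm_real, Real.norm_of_nonneg hs0.le]
      nlinarith [norm_nonneg w]
    · have h4 : ‖(s : ℂ) * w - w‖ ≤ 1 - s := by
        have : (s : ℂ) * w - w = ((s - 1 : ℝ) : ℂ) * w := by push_cast; ring
        rw [this, norm_mul, Complex.norm_real, Real.norm_eq_abs, abs_of_nonpos (by linarith)]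
        nlinarith [norm_nonneg w]
      have : ‖(s : ℂ) * w - ζ‖ ≤ ‖(s : ℂ) * w - w‖ + ‖w - ζ‖ := by
        simpa using norm_add_le ((s : ℂ) * w - w) (w - ζ)
      linarith
  have hbpos : ∀ w ∈ closure U, 1 / 2 ≤ ‖b (s * w)‖ := fun w hw =>
    hb _ (hsw w hw).1 (hsw w hw).2.1
  set Φ : ℂ → ℂ := fun w => Complex.exp (-(A * (1 - conj z₀ * w)) - p w) / b (s * w) with hΦ
  have hΦd : DiffContOnCl ℂ Φ U := by
    refine DifferentiableOn.diffContOnCl fun w hw => DifferentiableAt.differentiableWithinAt ?_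
    have hbd : DifferentiableAt ℂ b ((s : ℂ) * w) := b.isHol.differentiableAt
      (Metric.isOpen_ball.mem_nhds (by simpa using (hsw w hw).1))
    have hbs : DifferentiableAt ℂ (fun w => b ((s : ℂ) * w)) w :=
      DifferentiableAt.comp w (f := fun w => (s : ℂ) * w) hbd (by fun_prop)
    have hpw := hp w
    refine DifferentiableAt.div (by fun_prop) hbs ?_
    intro h
    have := hbpos w hw
    rw [h, norm_zero] at this
    linarith
  have hΦn : ∀ w ∈ closure U, ‖Φ w‖ = Real.exp (-(A * (1 - (conj z₀ * w).re)) - (p w).re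
      - Real.log ‖b (s * w)‖) := by
    intro w hw
    have hpos : 0 < ‖b (s * w)‖ := by linarith [hbpos w hw]
    simp only [hΦ]
    rw [norm_div, Complex.norm_exp, Real.exp_sub _ (Real.log _), Real.exp_log hpos]
    congr 2
    simp
  have hp0' : ∀ w, ‖w‖ ≤ 1 → 0 ≤ (p w).re := fun w hw => by
    rcases hw.lt_or_eq with h | h
    · exact (re_nonneg_and_le hp hp0 h).1
    · exact hp0 w (by simpa using h)
  have hfr : ∀ w ∈ frontier U, ‖Φ w‖ ≤ 1 := by
    intro w hw
    have hwc : w ∈ closure U := frontier_subset_closure hw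
    obtain ⟨h1, h2⟩ := hcl w hwc
    rw [hΦn w hwc, Real.exp_le_one_iff]
    have hUo : IsOpen U := Metric.isOpen_ball.inter Metric.isOpen_ball
    have hwU : w ∉ U := by
      rw [hUo.frontier_eq] at hw
      exact hw.2
    have hren : 0 ≤ 1 - (conj z₀ * w).re := by
      rw [hre]
      have : ‖w‖ ^ 2 ≤ 1 := pow_le_one₀ (norm_nonneg _) h1
      have := sq_nonneg ‖w - z₀‖
      linarith
    by_cases hw1 : ‖w‖ = 1
    · have h3 := hpb w (by simpa using hw1) (hsw w hwc).2.2
      have := mul_nonneg hA0 hren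
      linarith
    · have hw1' : ‖w‖ < 1 := lt_of_le_of_ne h1 hw1
      have hw2 : ε / 4 ≤ ‖w - z₀‖ := by
        by_contra hlt
        exact hwU ⟨by simpa using hw1', by simpa [dist_eq_norm] using hlt⟩
      -- At distance `ε/4` from `z₀` the barrier is at least `ε²/32`; with the factor `A` this is
      -- exactly `log 2`, the largest value `-log |b|` can take where `|b| ≥ 1/2`.
      have h3 : (ε / 4) ^ 2 / 2 ≤ 1 - (conj z₀ * w).re := by
        rw [hre]
        have h4 : ‖w‖ ^ 2 ≤ 1 := pow_le_one₀ (norm_nonneg _) h1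
        have h5 : (ε / 4) ^ 2 ≤ ‖w - z₀‖ ^ 2 := pow_le_pow_left₀ (by linarith) hw2 2
        linarith
      have h4 : Real.log 2 ≤ A * (1 - (conj z₀ * w).re) := by
        refine le_trans (le_of_eq ?_) (mul_le_mul_of_nonneg_left h3 hA0)
        rw [hA]
        field_simp
        ring
      have h5 : - Real.log ‖b (s * w)‖ ≤ Real.log 2 := by
        have := Real.log_le_log (by norm_num) (hbpos w hwc)
        rw [one_div, Real.log_inv] at this
        linarith
      have := hp0' w h1
      linarith
  have hzU : z ∈ U := ⟨by simpa using hz, by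
    rw [mem_ball_iff_norm, hzz₀]
    linarith⟩
  have hbd : Bornology.IsBounded U := Metric.isBounded_ball.subset Set.inter_subset_left
  have hfin := Complex.norm_le_of_forall_mem_frontier_norm_le hbd hΦd hfr (subset_closure hzU)
  rw [hΦn z (subset_closure hzU), Real.exp_le_one_iff, hre, hzz₀] at hfin
  have e : ((1 - ‖z‖) ^ 2 + (1 - ‖z‖ ^ 2)) / 2 = 1 - ‖z‖ := by ring
  rw [e] at hfin
  linarith

/-- If `|b|` is bounded below near `ζ` and has radial limits `1` almost everywhere on an arc
around `ζ`, then `1 - |b(z)| = O(1 - |z|)` near `ζ`. -/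
lemma one_sub_norm_le_of_unimodular (b : SchurFunction) {ζ : ℂ} (hζ : ‖ζ‖ = 1) {ε : ℝ}
    (hε0 : 0 < ε) (hε : ε ≤ 1) (hb : ∀ z, ‖z‖ < 1 → ‖z - ζ‖ < ε → 1 / 2 ≤ ‖b z‖)
    (hlim : ∀ᵐ θ : ℝ, ‖circleMap 0 1 θ - ζ‖ < ε →
      Filter.Tendsto (fun s : ℝ => ‖b (s * circleMap 0 1 θ)‖) (𝓝[<] 1) (𝓝 1))
    {z : ℂ} (hz : ‖z‖ < 1) (hzζ : ‖z - ζ‖ < ε / 4) :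
    1 - ‖b z‖ ≤ 32 * Real.log 2 / ε ^ 2 * (1 - ‖z‖) := by
  set A := 32 * Real.log 2 / ε ^ 2 with hA
  -- A continuous cutoff, `1` for `|w - ζ| ≤ 3ε/4` and `0` for `|w - ζ| ≥ ε`. The `max` with `1/2`
  -- in `q` makes the logarithm continuous and bounded everywhere, and is inactive where `χ = 1`
  -- once `1 - s < ε/4`.
  set χ : ℂ → ℝ := fun w => max 0 (min 1 (4 - 4 * ‖w - ζ‖ / ε)) with hχ
  set q : ℝ → ℂ → ℝ := fun s w => χ w * (- Real.log (max (1 / 2) ‖b (s * w)‖)) with hq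
  have hχ0 : ∀ w, 0 ≤ χ w := fun w => le_max_left _ _
  have hχ1 : ∀ w, χ w ≤ 1 := fun w => max_le zero_le_one (min_le_left _ _)
  have hmem : ∀ s : ℝ, 0 < s → s < 1 → ∀ w : ℂ, ‖w‖ ≤ 1 → (s : ℂ) * w ∈ Metric.ball (0 : ℂ) 1 := by
    intro s hs0 hs1 w hw
    rw [mem_ball_zero_iff, norm_mul, Complex.norm_real, Real.norm_of_nonneg hs0.le]
    nlinarith [norm_nonneg w]
  have hlog : ∀ s : ℝ, 0 < s → s < 1 → ∀ w : ℂ, ‖w‖ ≤ 1 →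
      0 ≤ - Real.log (max (1 / 2) ‖b (s * w)‖) ∧
        - Real.log (max (1 / 2) ‖b (s * w)‖) ≤ Real.log 2 := by
    intro s hs0 hs1 w hw
    have h1 : max (1 / 2) ‖b (s * w)‖ ≤ 1 :=
      max_le (by norm_num) (b.norm_apply_le (hmem s hs0 hs1 w hw))
    have h2 : Real.log (1 / 2) ≤ Real.log (max (1 / 2) ‖b (s * w)‖) :=
      Real.log_le_log (by norm_num) (le_max_left _ _)
    rw [one_div, Real.log_inv] at h2
    have h3 := Real.log_nonpos (by positivity) h1
    rw [one_div] at h3 ⊢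
    constructor <;> linarith
  have hcont : ∀ s : ℝ, 0 < s → s < 1 → ContinuousOn (q s) (Metric.sphere 0 1) := by
    intro s hs0 hs1
    have h1 : ContinuousOn (fun w : ℂ => b (s * w)) (Metric.sphere 0 1) :=
      b.isHol.continuousOn.comp (by fun_prop) fun w hw => hmem s hs0 hs1 w (by
        rw [mem_sphere_zero_iff_norm] at hw
        exact hw.le)
    have h2 : ContinuousOn (fun w : ℂ => Real.log (max (1 / 2) ‖b (s * w)‖)) (Metric.sphere 0 1) := by
      refine ContinuousOn.log (continuousOn_const.sup h1.norm) fun w _ => ?_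
      have : (1 / 2 : ℝ) ≤ max (1 / 2) ‖b (s * w)‖ := le_max_left _ _
      linarith
    have h3 : Continuous χ := by fun_prop
    exact h3.continuousOn.mul h2.neg
  have hstep : ∀ s : ℝ, 0 < s → s < 1 → 1 - s < ε / 4 →
      - Real.log ‖b (s * z)‖ ≤ A * (1 - ‖z‖)
        + 2 / (1 - ‖z‖) * Real.circleAverage (q s) 0 1 := by
    intro s hs0 hs1 hs
    have hK : 0 < 2 / (1 - ‖z‖) := div_pos two_pos (by linarith)
    refine le_of_forall_pos_le_add fun δ' hδ' => ?_
    -- Approximating `q s + δ` within `δ` gives `q s ≤ Re p ≤ q s + 2δ`, so `Re p` is a nonnegative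
    -- majorant; after Harnack the loss is exactly `δ'`.
    set δ := δ' / (2 * (2 / (1 - ‖z‖))) with hδ
    have hδ0 : 0 < δ := by positivity
    obtain ⟨p, hp, hpq⟩ := exists_differentiable_re_approx
      (q := fun w => q s w + δ) ((hcont s hs0 hs1).add continuousOn_const) hδ0
    have hq0 : ∀ w ∈ Metric.sphere (0 : ℂ) 1, 0 ≤ q s w := fun w hw =>
      mul_nonneg (hχ0 w) (hlog s hs0 hs1 w (by
        rw [mem_sphere_zero_iff_norm] at hw
        exact hw.le)).1
    have hp1 : ∀ w ∈ Metric.sphere (0 : ℂ) 1, q s w ≤ (p w).re := fun w hw => by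
      have := (abs_le.mp (hpq w hw)).1
      linarith
    have hp2 : ∀ w ∈ Metric.sphere (0 : ℂ) 1, (p w).re ≤ q s w + 2 * δ := fun w hw => by
      have := (abs_le.mp (hpq w hw)).2
      linarith
    have hp0 : ∀ w ∈ Metric.sphere (0 : ℂ) 1, 0 ≤ (p w).re := fun w hw =>
      (hq0 w hw).trans (hp1 w hw)
    have hbar := neg_log_norm_le_of_barrier b hε hb hζ hz hzζ hs0 hs1 hs hp hp0 (by
      intro w hw hwζ
      refine le_trans (le_of_eq ?_) (hp1 w hw)
      have hw1 : ‖w‖ = 1 := by simpa using hw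
      have h1 : χ w = 1 := by
        have : 1 ≤ 4 - 4 * ‖w - ζ‖ / ε := by
          rw [le_sub_comm, div_le_iff₀ hε0]
          linarith
        simp only [hχ]
        rw [min_eq_left this, max_eq_right zero_le_one]
      have h2 : 1 / 2 ≤ ‖b (s * w)‖ := by
        refine hb _ (by simpa using hmem s hs0 hs1 w hw1.le) ?_
        have h4 : ‖(s : ℂ) * w - w‖ ≤ 1 - s := by
          have : (s : ℂ) * w - w = ((s - 1 : ℝ) : ℂ) * w := by push_cast; ring
          rw [this, norm_mul, Complex.norm_real, Real.norm_eq_abs, abs_of_nonpos (by linarith), hw1]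
          linarith
        have : ‖(s : ℂ) * w - ζ‖ ≤ ‖(s : ℂ) * w - w‖ + ‖w - ζ‖ := by
          simpa using norm_add_le ((s : ℂ) * w - w) (w - ζ)
        linarith
      simp only [hq]
      rw [h1, one_mul, max_eq_right h2])
    have hhar := (re_nonneg_and_le hp hp0 hz).2
    have havg : Real.circleAverage (fun w => (p w).re) 0 1
        ≤ Real.circleAverage (q s) 0 1 + 2 * δ := by
      have hi := ContinuousOn.circleIntegrable (c := (0 : ℂ)) zero_le_one (hcont s hs0 hs1)
      have h1 : Real.circleAverage (fun w => q s w + 2 * δ) 0 1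
          = Real.circleAverage (q s) 0 1 + 2 * δ := by
        rw [Real.circleAverage_fun_add hi (circleIntegrable_const _ _ _), Real.circleAverage_const]
      rw [← h1]
      refine Real.circleAverage_mono ?_ (hi.add (circleIntegrable_const _ _ _)) fun w hw =>
        hp2 w (by simpa using hw)
      exact ContinuousOn.circleIntegrable zero_le_one
        (Complex.continuous_re.comp hp.continuous).continuousOn
    have h3 := mul_le_mul_of_nonneg_left havg hK.le
    have h4 : 2 / (1 - ‖z‖) * (2 * δ) = δ' := by
      rw [hδ, ← mul_assoc, mul_comm _ (2 : ℝ), mul_div_cancel₀ _ (by positivity)]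
    rw [mul_add, h4] at h3
    linarith
  have hIoo : Set.Ioo (0 : ℝ) 1 ∈ 𝓝[<] (1 : ℝ) := Ioo_mem_nhdsLT zero_lt_one
  have hnorm : ∀ θ, ‖circleMap 0 1 θ‖ ≤ 1 := fun θ => by simp
  -- Unimodular radial limits enter here: the boundary data tend to `0` almost everywhere and stay
  -- below `log 2`. Since `z` is fixed while `s → 1`, the large Harnack factor `2/(1 - |z|)` is
  -- harmless.
  have hqlim : Filter.Tendsto (fun s => Real.circleAverage (q s) 0 1) (𝓝[<] 1) (𝓝 0) := by
    have h1 : Filter.Tendsto (fun s => ∫ θ in (0 : ℝ)..2 * Real.pi, q s (circleMap 0 1 θ))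
        (𝓝[<] 1) (𝓝 (∫ θ in (0 : ℝ)..2 * Real.pi, (0 : ℝ))) := by
      refine intervalIntegral.tendsto_integral_filter_of_dominated_convergence
        (fun _ => Real.log 2) ?_ ?_ ?_ ?_
      · filter_upwards [hIoo] with s hs
        refine Continuous.aestronglyMeasurable ?_
        exact (hcont s hs.1 hs.2).comp_continuous (by fun_prop) fun θ => by simp
      · filter_upwards [hIoo] with s hs
        refine Filter.Eventually.of_forall fun θ _ => ?_
        have h2 := hlog s hs.1 hs.2 _ (hnorm θ)
        simp only [hq]
        rw [Real.norm_of_nonneg (mul_nonneg (hχ0 _) h2.1)]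
        exact (mul_le_of_le_one_left h2.1 (hχ1 _)).trans h2.2
      · simp
      · filter_upwards [hlim] with θ hθ _
        by_cases h2 : ‖circleMap 0 1 θ - ζ‖ < ε
        · have h3 := hθ h2
          have h4 : Filter.Tendsto (fun s : ℝ => max (1 / 2) ‖b (s * circleMap 0 1 θ)‖)
              (𝓝[<] 1) (𝓝 1) := by
            have := (tendsto_const_nhds (x := (1 / 2 : ℝ))).max h3
            rwa [max_eq_right (by norm_num : (1 / 2 : ℝ) ≤ 1)] at this
          have h5 := ((h4.log one_ne_zero).neg).const_mul (χ (circleMap 0 1 θ))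
          simpa [hq] using h5
        · have h3 : χ (circleMap 0 1 θ) = 0 := by
            refine max_eq_left ((min_le_right _ _).trans ?_)
            rw [sub_nonpos, le_div_iff₀ hε0]
            linarith
          simp only [hq, h3, zero_mul]
          exact tendsto_const_nhds
    have h2 := h1.const_smul (2 * Real.pi)⁻¹
    simpa [Real.circleAverage] using h2
  have hbz : 1 / 2 ≤ ‖b z‖ := hb z hz (by linarith)
  have hleft : Filter.Tendsto (fun s : ℝ => - Real.log ‖b (s * z)‖) (𝓝[<] 1)
      (𝓝 (- Real.log ‖b z‖)) := by
    have h1 : ContinuousAt b z :=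
      (b.isHol.differentiableAt (Metric.isOpen_ball.mem_nhds (by simpa using hz))).continuousAt
    have h2 : Filter.Tendsto (fun s : ℝ => (s : ℂ) * z) (𝓝[<] 1) (𝓝 z) := by
      have : Continuous (fun s : ℝ => (s : ℂ) * z) := by fun_prop
      simpa using (this.tendsto 1).mono_left (nhdsWithin_le_nhds (s := Set.Iio (1 : ℝ)))
    exact ((h1.tendsto.comp h2).norm.log (by positivity)).neg
  have hright := (hqlim.const_mul (2 / (1 - ‖z‖))).const_add (A * (1 - ‖z‖))
  rw [mul_zero, add_zero] at hright
  have hfin : - Real.log ‖b z‖ ≤ A * (1 - ‖z‖) := by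
    refine le_of_tendsto_of_tendsto hleft hright ?_
    filter_upwards [hIoo, Ioo_mem_nhdsLT (show 1 - ε / 4 < 1 by linarith)] with s hs hs'
    exact hstep s hs.1 hs.2 (by linarith [hs'.1])
  have := Real.log_le_sub_one_of_pos (show 0 < ‖b z‖ by linarith)
  linarith

/-- Julia's inequality at a boundary point of finite angular derivative, in the form
`Re (1 - β b(z)) = O(|z - ζ|² + 1 - |z|)`. -/
lemma exists_re_one_sub_le (b : SchurFunction) {ζ : ℂ} (hζ : ‖ζ‖ = 1) {η A : ℝ} (hη : 0 < η)
    (hA : ∀ z, ‖z‖ < 1 → ‖z - ζ‖ < η → 1 - ‖b z‖ ≤ A * (1 - ‖z‖)) :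
    ∃ (β : ℂ) (C : ℝ), ‖β‖ = 1 ∧ 0 ≤ C ∧
      ∀ z, ‖z‖ < 1 → (1 - β * b z).re ≤ C * (‖z - ζ‖ ^ 2 + (1 - ‖z‖)) := by
  have hA2 : ∀ z, ‖z‖ < 1 → ‖z - ζ‖ < η → 1 - ‖b z‖ ^ 2 ≤ 2 * |A| * (1 - ‖z‖ ^ 2) := by
    intro z hz hzη
    have h1 := hA z hz hzη
    have h2 := b.norm_apply_le (z := z) (by simpa using hz)
    have h3 : A * (1 - ‖z‖) ≤ |A| * (1 - ‖z‖) :=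
      mul_le_mul_of_nonneg_right (le_abs_self A) (by linarith)
    have h4 : |A| * (1 - ‖z‖) ≤ |A| * (1 - ‖z‖ ^ 2) :=
      mul_le_mul_of_nonneg_left (by nlinarith [norm_nonneg z]) (abs_nonneg A)
    nlinarith [norm_nonneg (b z)]
  set r : ℕ → ℝ := fun n => 1 - 1 / ((n : ℝ) + 2) with hr
  have hr01 : ∀ n, 0 < r n ∧ r n < 1 := fun n => by
    have h1 : 1 / ((n : ℝ) + 2) < 1 := by
      rw [div_lt_one (by positivity)]
      linarith [Nat.cast_nonneg (α := ℝ) n]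
    have h2 : 0 < 1 / ((n : ℝ) + 2) := by positivity
    simp only [hr]
    constructor <;> linarith
  have hrlim : Filter.Tendsto r Filter.atTop (𝓝 1) := by
    have h1 : Filter.Tendsto (fun n : ℕ => 1 / ((n : ℝ) + 2)) Filter.atTop (𝓝 0) := by
      have := (tendsto_one_div_add_atTop_nhds_zero_nat (𝕜 := ℝ)).comp (Filter.tendsto_add_atTop_nat 1)
      refine this.congr fun n => ?_
      simp only [Function.comp_apply]
      push_cast
      ring_nf
    simpa [hr] using h1.const_sub 1
  have hnorm : ∀ n, ‖(r n : ℂ) * ζ‖ = r n := fun n => by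
    rw [norm_mul, hζ, mul_one, Complex.norm_real, Real.norm_of_nonneg (hr01 n).1.le]
  have hdist : ∀ n, ‖(r n : ℂ) * ζ - ζ‖ = 1 - r n := fun n => by
    have : (r n : ℂ) * ζ - ζ = ((r n - 1 : ℝ) : ℂ) * ζ := by push_cast; ring
    rw [this, norm_mul, hζ, mul_one, Complex.norm_real, Real.norm_eq_abs,
      abs_of_nonpos (by linarith [(hr01 n).2])]
    ring
  -- A cluster point along the radius suffices for `β`; `hA` forces it to be unimodular.
  obtain ⟨β, -, φ, hφ, hβ⟩ := (isCompact_closedBall (0 : ℂ) 1).tendsto_subseq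
    (x := fun n => conj (b (r n * ζ))) (fun n => by
      rw [mem_closedBall_zero_iff, RCLike.norm_conj]
      exact b.norm_apply_le (by rw [mem_ball_zero_iff, hnorm]; exact (hr01 n).2))
  have hrφ := hrlim.comp hφ.tendsto_atTop
  have hnear : ∀ᶠ n in Filter.atTop, ‖(r (φ n) : ℂ) * ζ - ζ‖ < η := by
    have h1 : Filter.Tendsto (fun n => 1 - r (φ n)) Filter.atTop (𝓝 0) := by
      simpa using hrφ.const_sub 1
    filter_upwards [h1.eventually_lt_const hη] with n hn
    rwa [hdist]
  have hβ1 : ‖β‖ = 1 := by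
    refine tendsto_nhds_unique hβ.norm ?_
    have h1 : Filter.Tendsto (fun n => 1 - A * (1 - r (φ n))) Filter.atTop (𝓝 1) := by
      simpa using ((hrφ.const_sub 1).const_mul A).const_sub 1
    refine tendsto_of_tendsto_of_tendsto_of_le_of_le' h1 tendsto_const_nhds ?_ ?_
    · filter_upwards [hnear] with n hn
      have := hA _ (by rw [hnorm]; exact (hr01 _).2) hn
      rw [hnorm] at this
      simp only [Function.comp_apply, RCLike.norm_conj]
      linarith
    · refine Filter.Eventually.of_forall fun n => ?_
      simp only [Function.comp_apply, RCLike.norm_conj]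
      exact b.norm_apply_le (by rw [mem_ball_zero_iff, hnorm]; exact (hr01 _).2)
  -- The two-point inequality at `z` and `r ζ`: by `hA2` the factor `1 - |b(r ζ)|²` is at most `2|A|
  -- W`, so `W` cancels and `r → 1` is possible.
  have hjulia : ∀ z, ‖z‖ < 1 →
      ‖1 - β * b z‖ ^ 2 * (1 - ‖z‖ ^ 2) ≤ (1 - ‖b z‖ ^ 2) * (2 * |A|) * ‖z - ζ‖ ^ 2 := by
    intro z hz
    rw [← one_sub_conj_mul_norm hζ z]
    have h1 : Filter.Tendsto (fun n => ‖1 - conj (b (r (φ n) * ζ)) * b z‖ ^ 2 * (1 - ‖z‖ ^ 2))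
        Filter.atTop (𝓝 (‖1 - β * b z‖ ^ 2 * (1 - ‖z‖ ^ 2))) :=
      (((hβ.mul_const (b z)).const_sub 1).norm.pow 2).mul_const _
    have h2 : Filter.Tendsto (fun n => (1 - ‖b z‖ ^ 2) * (2 * |A|) *
        ‖1 - conj ((r (φ n) : ℂ) * ζ) * z‖ ^ 2) Filter.atTop
        (𝓝 ((1 - ‖b z‖ ^ 2) * (2 * |A|) * ‖1 - conj ζ * z‖ ^ 2)) := by
      have hc : Continuous fun t : ℝ => (1 - ‖b z‖ ^ 2) * (2 * |A|) *
        ‖1 - conj ((t : ℂ) * ζ) * z‖ ^ 2 := by fun_prop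
      simpa [Function.comp_def] using (hc.tendsto 1).comp hrφ
    refine le_of_tendsto_of_tendsto h1 h2 ?_
    filter_upwards [hnear] with n hn
    have hlt : ‖(r (φ n) : ℂ) * ζ‖ < 1 := by rw [hnorm]; exact (hr01 _).2
    have h3 := norm_one_sub_conj_mul_sq_le b hz hlt
    have h4 := hA2 _ hlt hn
    set W := 1 - ‖(r (φ n) : ℂ) * ζ‖ ^ 2 with hW
    have hW0 : 0 < W := by nlinarith [norm_nonneg ((r (φ n) : ℂ) * ζ)]
    have h5 : 0 ≤ (1 - ‖b z‖ ^ 2) * ‖1 - conj ((r (φ n) : ℂ) * ζ) * z‖ ^ 2 :=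
      mul_nonneg (one_sub_norm_sq_nonneg b (by simpa using hz)) (sq_nonneg _)
    have h6 := mul_le_mul_of_nonneg_left h4 h5
    refine le_of_mul_le_mul_right ?_ hW0
    linarith
  -- The terms with `A` serve near `ζ`, through `2 Re (1 - βb) = |1 - βb|² + 1 - |b|²`. The term
  -- `2/η²` covers `|z - ζ| ≥ η`, where the real part is trivially at most `2`.
  refine ⟨β, 2 * |A| ^ 2 + 2 * |A| + 2 / η ^ 2, hβ1, by positivity, fun z hz => ?_⟩
  have hbz := b.norm_apply_le (z := z) (by simpa using hz)
  have hd0 : 0 ≤ 1 - ‖z‖ := by linarith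
  by_cases hzη : ‖z - ζ‖ < η
  · have e : (1 - β * b z).re = (‖1 - β * b z‖ ^ 2 + (1 - ‖b z‖ ^ 2)) / 2 := by
      have h1 : ‖1 - β * b z‖ ^ 2 = 1 - 2 * (β * b z).re + ‖β * b z‖ ^ 2 := by
        simp only [← Complex.normSq_eq_norm_sq, Complex.normSq_apply]
        simp
        ring
      rw [h1, norm_mul, hβ1, one_mul, Complex.sub_re, Complex.one_re]
      ring
    have h1 := hjulia z hz
    have h2 := hA2 z hz hzη
    have hz2 : 0 < 1 - ‖z‖ ^ 2 := by nlinarith [norm_nonneg z]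
    have h3 : ‖1 - β * b z‖ ^ 2 ≤ 4 * |A| ^ 2 * ‖z - ζ‖ ^ 2 := by
      refine le_of_mul_le_mul_right (h1.trans ?_) hz2
      have h4 : 0 ≤ 2 * |A| * ‖z - ζ‖ ^ 2 := by positivity
      have := mul_le_mul_of_nonneg_right h2 h4
      linarith
    have h4 : 1 - ‖b z‖ ^ 2 ≤ 4 * |A| * (1 - ‖z‖) := by
      refine h2.trans ?_
      have : 1 - ‖z‖ ^ 2 ≤ 2 * (1 - ‖z‖) := by nlinarith [norm_nonneg z]
      have := mul_le_mul_of_nonneg_left this (by positivity : 0 ≤ 2 * |A|)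
      linarith
    rw [e]
    have p1 : 0 ≤ 2 / η ^ 2 * (‖z - ζ‖ ^ 2 + (1 - ‖z‖)) := by positivity
    have p2 : 0 ≤ |A| ^ 2 * (1 - ‖z‖) := by positivity
    have p3 : 0 ≤ |A| * ‖z - ζ‖ ^ 2 := by positivity
    linarith
  · have h1 : (1 - β * b z).re ≤ 2 := by
      refine (Complex.re_le_norm _).trans ((norm_sub_le _ _).trans ?_)
      rw [norm_mul, hβ1, norm_one]
      linarith
    have h2 : η ^ 2 ≤ ‖z - ζ‖ ^ 2 := pow_le_pow_left₀ hη.le (not_lt.mp hzη) 2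
    have h3 : 2 ≤ 2 / η ^ 2 * ‖z - ζ‖ ^ 2 := by
      rw [div_mul_eq_mul_div, le_div_iff₀ (by positivity)]
      linarith
    have p1 : 0 ≤ (2 * |A| ^ 2 + 2 * |A|) * (‖z - ζ‖ ^ 2 + (1 - ‖z‖)) := by positivity
    have p2 : 0 ≤ 2 / η ^ 2 * (1 - ‖z‖) := by positivity
    linarith

/-! ### Comparing the quadratic form of `k^b` with the one of `(z - ζ) H²` -/

/-- The quadratic form of the kernel `k^b` at a finite combination of point evaluations. -/
def dbrForm (b : ℂ → ℂ) (s : Finset Complex.UnitDisc) (c : Complex.UnitDisc → ℂ) : ℝ :=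
  (∑ x ∈ s, ∑ y ∈ s, dbrKernel b y x * c x * conj (c y)).re

lemma continuousOn_szegoSum (s : Finset Complex.UnitDisc) (a : Complex.UnitDisc → ℂ) :
    ContinuousOn (szegoSum s a) (Metric.closedBall 0 1) := by
  have h := (diffContOnCl_szegoSum s a).continuousOn
  rwa [closure_ball _ one_ne_zero] at h

lemma circleAverage_norm_sq_szegoSum (s : Finset Complex.UnitDisc) (a : Complex.UnitDisc → ℂ) :
    ((Real.circleAverage (fun z => ‖szegoSum s a z‖ ^ 2) 0 1 : ℝ) : ℂ)
      = ∑ x ∈ s, conj (a x) * szegoSum s a x := by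
  rw [← circleAverage_mul_conj (diffContOnCl_szegoSum s a)]
  unfold Real.circleAverage
  simp only [Complex.mul_conj', Complex.real_smul, smul_eq_mul]
  push_cast
  rw [← intervalIntegral.integral_ofReal]
  simp

/-- With `φ = 1 - βb` the form equals `2 Re T` minus the squared `H²` norm of the Szegő sum with
coefficients `c x * conj (φ x)`; the square is discarded. -/
lemma dbrForm_le_re_sum {b : ℂ → ℂ} {β : ℂ} (hβ : ‖β‖ = 1) (s : Finset Complex.UnitDisc)
    (c : Complex.UnitDisc → ℂ) :
    dbrForm b s c ≤ 2 * (∑ y ∈ s, conj (c y) * ((1 - β * b y) * szegoSum s c y)).re := by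
  set φ : ℂ → ℂ := fun z => 1 - β * b z with hφ
  set T := ∑ y ∈ s, conj (c y) * (φ y * szegoSum s c y) with hT
  have hββ : β * conj β = 1 := by rw [Complex.mul_conj', hβ]; simp
  have h1 : ∑ x ∈ s, ∑ y ∈ s, dbrKernel b y x * c x * conj (c y)
      = T + conj T - ∑ x ∈ s, conj (c x * conj (φ x)) * szegoSum s (fun x => c x * conj (φ x)) x := by
    have e1 : T = ∑ x ∈ s, ∑ y ∈ s, φ y * (c x * conj (c y)) / (1 - conj (x : ℂ) * y) := by
      rw [Finset.sum_comm, hT]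
      refine Finset.sum_congr rfl fun y _ => ?_
      unfold szegoSum
      rw [Finset.mul_sum, Finset.mul_sum]
      exact Finset.sum_congr rfl fun x _ => by ring
    have e2 : conj T = ∑ x ∈ s, ∑ y ∈ s, conj (φ x) * (c x * conj (c y)) / (1 - conj (x : ℂ) * y) := by
      rw [e1, map_sum, Finset.sum_comm]
      simp only [map_sum]
      refine Finset.sum_congr rfl fun x _ => Finset.sum_congr rfl fun y _ => ?_
      simp only [map_div₀, map_mul, map_sub, map_one, Complex.conj_conj]
      rw [mul_comm (conj (y : ℂ)) (x : ℂ)]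
      ring
    have e3 : ∑ x ∈ s, conj (c x * conj (φ x)) * szegoSum s (fun x => c x * conj (φ x)) x
        = ∑ x ∈ s, ∑ y ∈ s, φ y * conj (φ x) * (c x * conj (c y)) / (1 - conj (x : ℂ) * y) := by
      rw [Finset.sum_comm]
      refine Finset.sum_congr rfl fun y _ => ?_
      unfold szegoSum
      rw [Finset.mul_sum]
      refine Finset.sum_congr rfl fun x _ => ?_
      simp only [map_mul, Complex.conj_conj]
      ring
    rw [e2, e3, e1, ← Finset.sum_add_distrib, ← Finset.sum_sub_distrib]
    refine Finset.sum_congr rfl fun x _ => ?_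
    rw [← Finset.sum_add_distrib, ← Finset.sum_sub_distrib]
    refine Finset.sum_congr rfl fun y _ => ?_
    have e4 : 1 - conj (b x) * b y = φ y + conj (φ x) - φ y * conj (φ x) := by
      simp only [hφ, map_sub, map_one, map_mul]
      linear_combination (b y * conj (b x)) * hββ
    unfold dbrKernel
    rw [e4]
    ring
  unfold dbrForm
  rw [h1, ← circleAverage_norm_sq_szegoSum, Complex.sub_re, Complex.ofReal_re, Complex.add_re,
    Complex.conj_re]
  have : 0 ≤ Real.circleAverage (fun z => ‖szegoSum s (fun x => c x * conj (φ x)) z‖ ^ 2) 0 1 :=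
    Real.circleAverage_nonneg_of_nonneg fun z _ => sq_nonneg _
  linarith

/-- The sum bounding the form is the circle mean of `φ|F|²`, and on the circle the hypothesis reads
`Re φ ≤ C|z - ζ|²`. As `b` need not extend to the boundary, this is done for `b(r ·)` and `r → 1`.
-/
lemma dbrForm_le_circleAverage (b : SchurFunction) {ζ β : ℂ} {C : ℝ} (hζ : ‖ζ‖ = 1) (hβ : ‖β‖ = 1)
    (hC : 0 ≤ C) (h : ∀ z, ‖z‖ < 1 → (1 - β * b z).re ≤ C * (‖z - ζ‖ ^ 2 + (1 - ‖z‖)))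
    (s : Finset Complex.UnitDisc) (c : Complex.UnitDisc → ℂ) :
    dbrForm b s c
      ≤ 2 * C * Real.circleAverage (fun z => ‖(z - ζ) * szegoSum s c z‖ ^ 2) 0 1 := by
  refine (dbrForm_le_re_sum hβ s c).trans ?_
  rw [mul_assoc]
  refine mul_le_mul_of_nonneg_left ?_ two_pos.le
  set F := szegoSum s c with hF
  have hFc : ContinuousOn F (Metric.sphere 0 1) :=
    (continuousOn_szegoSum s c).mono Metric.sphere_subset_closedBall
  have hlim : Filter.Tendsto (fun r : ℝ =>
      (∑ y ∈ s, conj (c y) * ((1 - β * b (r * y)) * F y)).re) (𝓝[<] 1)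
      (𝓝 (∑ y ∈ s, conj (c y) * ((1 - β * b y) * F y)).re) := by
    refine (Complex.continuous_re.tendsto _).comp ?_
    refine tendsto_finsetSum _ fun y _ => ?_
    have hy : (y : ℂ) ∈ Metric.ball (0 : ℂ) 1 := by simpa using y.norm_lt_one
    have h1 : ContinuousAt b (y : ℂ) :=
      (b.isHol.differentiableAt (Metric.isOpen_ball.mem_nhds hy)).continuousAt
    have h2 : Filter.Tendsto (fun r : ℝ => (r : ℂ) * y) (𝓝[<] 1) (𝓝 (y : ℂ)) := by
      have : Continuous (fun r : ℝ => (r : ℂ) * y) := by fun_prop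
      simpa using (this.tendsto 1).mono_left (nhdsWithin_le_nhds (s := Set.Iio (1 : ℝ)))
    exact ((((h1.tendsto.comp h2).const_mul β).const_sub 1).mul_const (F y)).const_mul _
  set I := Real.circleAverage (fun z => ‖(z - ζ) * F z‖ ^ 2) 0 1 with hI
  set J := Real.circleAverage (fun z => ‖F z‖ ^ 2) 0 1 with hJ
  -- Dilation costs `6(1 - r)`: one from `1 - |rz|` and five from `|rz - ζ|² ≤ |z - ζ|² + 5(1 - r)`.
  have hlim2 : Filter.Tendsto (fun r : ℝ => C * (I + 6 * (1 - r) * J)) (𝓝[<] 1) (𝓝 (C * I)) := by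
    have : Continuous (fun r : ℝ => C * (I + 6 * (1 - r) * J)) := by fun_prop
    simpa using (this.tendsto 1).mono_left (nhdsWithin_le_nhds (s := Set.Iio (1 : ℝ)))
  refine le_of_tendsto_of_tendsto hlim hlim2 ?_
  filter_upwards [Ioo_mem_nhdsLT (zero_lt_one (α := ℝ))] with r hr
  have hmem : ∀ z ∈ Metric.closedBall (0 : ℂ) 1, (r : ℂ) * z ∈ Metric.ball (0 : ℂ) 1 := by
    intro z hz
    rw [mem_closedBall_zero_iff] at hz
    rw [mem_ball_zero_iff, norm_mul, Complex.norm_real, Real.norm_of_nonneg hr.1.le]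
    nlinarith [hr.1, hr.2, norm_nonneg z]
  have hbr : DiffContOnCl ℂ (fun z => b (r * z)) (Metric.ball 0 1) := by
    refine DifferentiableOn.diffContOnCl ?_
    rw [closure_ball _ one_ne_zero]
    exact b.isHol.comp (by fun_prop) hmem
  have hk : DiffContOnCl ℂ (fun z => (1 - β * b (r * z)) * F z) (Metric.ball 0 1) :=
    ((diffContOnCl_const (c := (1 : ℂ))).sub (hbr.const_smul β)).smul (diffContOnCl_szegoSum s c)
  have hi := circleIntegrable_mul_conj hk s c
  rw [← circleAverage_mul_conj hk s c]
  have e1 : (Real.circleAverage (fun z => (1 - β * b (r * z)) * F z * conj (szegoSum s c z)) 0 1).re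
      = Real.circleAverage (Complex.reCLM ∘
        fun z => (1 - β * b (r * z)) * F z * conj (szegoSum s c z)) 0 1 :=
    (Complex.reCLM.circleAverage_comp_comm hi).symm
  have hc1 : ContinuousOn (fun z => ‖(z - ζ) * F z‖ ^ 2) (Metric.sphere 0 1) := by fun_prop
  have hc2 : ContinuousOn (fun z => 6 * (1 - r) * ‖F z‖ ^ 2) (Metric.sphere 0 1) := by fun_prop
  have hi1 := ContinuousOn.circleIntegrable (c := (0 : ℂ)) zero_le_one hc1
  have hi2 := ContinuousOn.circleIntegrable (c := (0 : ℂ)) zero_le_one hc2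
  have e2 : C * (I + 6 * (1 - r) * J) = Real.circleAverage
      (fun z => C • (‖(z - ζ) * F z‖ ^ 2 + 6 * (1 - r) * ‖F z‖ ^ 2)) 0 1 := by
    rw [Real.circleAverage_fun_smul, Real.circleAverage_fun_add hi1 hi2, smul_eq_mul, hJ,
      ← smul_eq_mul (6 * (1 - r)), ← Real.circleAverage_fun_smul]
    rfl
  rw [e1, e2]
  have hc3 : ContinuousOn (fun z => C • (‖(z - ζ) * F z‖ ^ 2 + 6 * (1 - r) * ‖F z‖ ^ 2))
      (Metric.sphere 0 1) := (hc1.add hc2).const_smul C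
  have hc4 : ContinuousOn (Complex.reCLM ∘
      fun z => (1 - β * b (r * z)) * F z * conj (szegoSum s c z)) (Metric.sphere 0 1) := by
    have h5 := hk.continuousOn
    rw [closure_ball _ one_ne_zero] at h5
    exact Complex.continuous_re.comp_continuousOn
      ((h5.mono Metric.sphere_subset_closedBall).mul
        (Complex.continuous_conj.comp_continuousOn hFc))
  refine Real.circleAverage_mono (ContinuousOn.circleIntegrable zero_le_one hc4)
    (ContinuousOn.circleIntegrable zero_le_one hc3) fun z hz => ?_
  have hz1 : ‖z‖ = 1 := by simpa using hz
  have hrz : ‖(r : ℂ) * z‖ = r := by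
    rw [norm_mul, hz1, mul_one, Complex.norm_real, Real.norm_of_nonneg hr.1.le]
  have h1 := h (r * z) (by rw [hrz]; exact hr.2)
  rw [hrz] at h1
  have h2 : ‖(r : ℂ) * z - ζ‖ ≤ (1 - r) + ‖z - ζ‖ := by
    have h3 : ‖(r : ℂ) * z - z‖ = 1 - r := by
      have : (r : ℂ) * z - z = ((r - 1 : ℝ) : ℂ) * z := by push_cast; ring
      rw [this, norm_mul, Complex.norm_real, Real.norm_eq_abs,
        abs_of_nonpos (by linarith [hr.2]), hz1]
      ring
    rw [← h3]
    simpa using norm_add_le ((r : ℂ) * z - z) (z - ζ)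
  have h3 : ‖z - ζ‖ ≤ 2 := (norm_sub_le _ _).trans (by rw [hz1, hζ]; norm_num)
  have h4 : ‖(r : ℂ) * z - ζ‖ ^ 2 ≤ ‖z - ζ‖ ^ 2 + 5 * (1 - r) := by
    have h5 : ‖(r : ℂ) * z - ζ‖ ^ 2 ≤ ((1 - r) + ‖z - ζ‖) ^ 2 :=
      pow_le_pow_left₀ (norm_nonneg _) h2 2
    have h6 : 0 ≤ (1 - r) * (2 - ‖z - ζ‖) := mul_nonneg (by linarith [hr.2]) (by linarith)
    have h7 : 0 ≤ r * (1 - r) := mul_nonneg hr.1.le (by linarith [hr.2])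
    nlinarith
  have h5 : (1 - β * b (r * z)).re ≤ C * (‖z - ζ‖ ^ 2 + 6 * (1 - r)) :=
    h1.trans (mul_le_mul_of_nonneg_left (by linarith) hC)
  have e3 : (1 - β * b (r * z)) * F z * conj (szegoSum s c z)
      = (1 - β * b (r * z)) * ((‖F z‖ ^ 2 : ℝ) : ℂ) := by
    rw [mul_assoc, Complex.mul_conj']
    push_cast
    rfl
  simp only [Function.comp_apply, e3, Complex.reCLM_apply, smul_eq_mul]
  rw [Complex.re_mul_ofReal, norm_mul, mul_pow]
  have := mul_le_mul_of_nonneg_right h5 (sq_nonneg ‖F z‖)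
  linarith

/-! ### Riesz representation along a linear map -/

/-- The bound makes `l` factor through the range of `V`; Hahn–Banach extends the resulting
functional with the same norm and Riesz represents it. -/
lemma exists_inner_eq_of_norm_le {M E : Type*} [AddCommGroup M] [Module ℂ M]
    [NormedAddCommGroup E] [InnerProductSpace ℂ E] [CompleteSpace E] (V : M →ₗ[ℂ] E)
    (l : M →ₗ[ℂ] ℂ) {K : ℝ} (hK : 0 ≤ K) (h : ∀ m, ‖l m‖ ≤ K * ‖V m‖) :
    ∃ g : E, ‖g‖ ≤ K ∧ ∀ m, l m = inner ℂ g (V m) := by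
  obtain ⟨σ, hσ⟩ := V.rangeRestrict.exists_rightInverse_of_surjective V.range_rangeRestrict
  have hσ' : ∀ y : LinearMap.range V, V (σ y) = y := fun y => by
    have := congrArg (fun f => ((f y : LinearMap.range V) : E)) hσ
    simpa using this
  let l' : StrongDual ℂ (LinearMap.range V) := (l.comp σ).mkContinuous K fun y => by
    have := h (σ y)
    rwa [hσ'] at this
  obtain ⟨L, hL, hLn⟩ := exists_extension_norm_eq (LinearMap.range V) l'
  refine ⟨(InnerProductSpace.toDual ℂ E).symm L, ?_, fun m => ?_⟩
  · rw [LinearIsometryEquiv.norm_map, hLn]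
    exact LinearMap.mkContinuous_norm_le _ hK _
  · rw [InnerProductSpace.toDual_symm_apply]
    have h1 := hL ⟨V m, LinearMap.mem_range_self V m⟩
    simp only at h1
    rw [h1]
    -- `m` and its chosen lift differ by an element of `ker V`, on which `l` vanishes.
    have h2 := h (m - σ ⟨V m, LinearMap.mem_range_self V m⟩)
    rw [map_sub, map_sub, hσ', sub_self, norm_zero, mul_zero] at h2
    exact sub_eq_zero.mp (norm_le_zero_iff.mp h2)

/-! ### The coefficients of `(z - ζ) k_x` -/

/-- The Taylor coefficients of `(z - ζ) / (1 - conj x z)`. -/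
def shiftedSzegoCoeff (ζ : ℂ) (x : Complex.UnitDisc) (n : ℕ) : ℂ :=
  (if n = 0 then 0 else conj (x : ℂ) ^ (n - 1)) - ζ * conj (x : ℂ) ^ n

lemma norm_conj_unitDisc_lt_one (x : Complex.UnitDisc) : ‖conj (x : ℂ)‖ < 1 := by
  rw [RCLike.norm_conj]
  exact x.norm_lt_one

lemma hasSum_shiftedSzegoCoeff (ζ : ℂ) (x : Complex.UnitDisc) {z : ℂ} (hz : ‖z‖ ≤ 1) :
    HasSum (fun n => shiftedSzegoCoeff ζ x n * z ^ n) ((z - ζ) / (1 - conj (x : ℂ) * z)) := by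
  have hlt : ‖conj (x : ℂ) * z‖ < 1 := by
    rw [norm_mul]
    have := norm_conj_unitDisc_lt_one x
    nlinarith [norm_nonneg z, norm_nonneg (conj (x : ℂ))]
  have h1 := hasSum_geometric_of_norm_lt_one hlt
  have h2 : HasSum (fun n => (if n = 0 then 0 else conj (x : ℂ) ^ (n - 1)) * z ^ n)
      (z * (1 - conj (x : ℂ) * z)⁻¹) := by
    rw [← hasSum_nat_add_iff' 1]
    simp only [Finset.range_one, Finset.sum_singleton, if_true, zero_mul, sub_zero]
    refine (h1.mul_left z).congr_fun fun n => ?_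
    simp only [Nat.add_eq_zero_iff, one_ne_zero, and_false, if_false, Nat.add_sub_cancel]
    ring
  have h3 := h2.sub (h1.mul_left ζ)
  rw [← sub_mul, ← div_eq_mul_inv] at h3
  refine h3.congr_fun fun n => ?_
  unfold shiftedSzegoCoeff
  ring

lemma summable_norm_shiftedSzegoCoeff (ζ : ℂ) (x : Complex.UnitDisc) :
    Summable fun n => ‖shiftedSzegoCoeff ζ x n‖ := by
  have h := (hasSum_shiftedSzegoCoeff ζ x (z := 1) (by simp)).summable.norm
  simpa using h

lemma memℓp_shiftedSzegoCoeff (ζ : ℂ) (x : Complex.UnitDisc) :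
    Memℓp (shiftedSzegoCoeff ζ x) 2 := by
  have h1 : Memℓp (shiftedSzegoCoeff ζ x) 1 := by
    rw [memℓp_gen_iff (by norm_num)]
    simpa using summable_norm_shiftedSzegoCoeff ζ x
  exact h1.of_exponent_ge (by norm_num)

lemma hasSum_norm_sq_lp (g : lp (fun _ : ℕ => ℂ) 2) : HasSum (fun n => ‖g n‖ ^ 2) (‖g‖ ^ 2) := by
  have h := lp.hasSum_norm (p := 2) (by norm_num) g
  simpa using h

lemma norm_sq_linearCombination (ζ : ℂ) (c : Complex.UnitDisc →₀ ℂ) :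
    ‖Finsupp.linearCombination ℂ (fun x =>
        (⟨shiftedSzegoCoeff ζ x, memℓp_shiftedSzegoCoeff ζ x⟩ : lp (fun _ : ℕ => ℂ) 2)) c‖ ^ 2
      = Real.circleAverage (fun z => ‖(z - ζ) * szegoSum c.support c z‖ ^ 2) 0 1 := by
  set v := Finsupp.linearCombination ℂ (fun x =>
        (⟨shiftedSzegoCoeff ζ x, memℓp_shiftedSzegoCoeff ζ x⟩ : lp (fun _ : ℕ => ℂ) 2)) c with hv
  have hvn : ∀ n, v n = ∑ x ∈ c.support, c x * shiftedSzegoCoeff ζ x n := by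
    intro n
    rw [hv, Finsupp.linearCombination_apply, Finsupp.sum, lp.coeFn_sum, Finset.sum_apply]
    rfl
  have hs : Summable fun n => ‖v n‖ := by
    have h1 : Summable fun n => ∑ x ∈ c.support, ‖c x‖ * ‖shiftedSzegoCoeff ζ x n‖ :=
      summable_sum fun x _ => (summable_norm_shiftedSzegoCoeff ζ x).mul_left _
    refine h1.of_nonneg_of_le (fun _ => norm_nonneg _) fun n => ?_
    rw [hvn]
    refine (norm_sum_le _ _).trans (le_of_eq ?_)
    simp only [norm_mul]
  refine (hasSum_norm_sq_lp v).unique (hasSum_norm_sq_circleAverage hs fun z hz => ?_)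
  have hz1 : ‖z‖ = 1 := by simpa using hz
  have h1 : HasSum (fun n => ∑ x ∈ c.support, c x * (shiftedSzegoCoeff ζ x n * z ^ n))
      (∑ x ∈ c.support, c x * ((z - ζ) / (1 - conj (x : ℂ) * z))) :=
    hasSum_sum fun x _ => (hasSum_shiftedSzegoCoeff ζ x hz1.le).mul_left _
  have e : ∑ x ∈ c.support, c x * ((z - ζ) / (1 - conj (x : ℂ) * z))
      = (z - ζ) * szegoSum c.support c z := by
    unfold szegoSum
    rw [Finset.mul_sum]
    exact Finset.sum_congr rfl fun x _ => by ring
  rw [e] at h1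
  refine h1.congr_fun fun n => ?_
  rw [hvn, Finset.sum_mul]
  exact Finset.sum_congr rfl fun x _ => by ring

/-! ### Membership in `𝒟_ζ` from a bound by the quadratic form of `k^b` -/

/-- Comparing forms bounds `∑ c_x k_x ↦ ∑ c_x conj (f x)` by `‖(z - ζ) ∑ c_x k_x‖`. The representing
`g` satisfies `f(x) = ⟨g, (z - ζ) k_x⟩`, that is, `f` is the adjoint of multiplication by `z - ζ`
applied to `g`. -/
lemma exists_lp_of_form_bound (b : SchurFunction) {ζ β : ℂ} {C : ℝ} (hζ : ‖ζ‖ = 1) (hβ : ‖β‖ = 1)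
    (hC : 0 ≤ C) (h : ∀ z, ‖z‖ < 1 → (1 - β * b z).re ≤ C * (‖z - ζ‖ ^ 2 + (1 - ‖z‖)))
    {f : ℂ → ℂ} {N : ℝ} (hN : 0 ≤ N)
    (hf : ∀ (s : Finset Complex.UnitDisc) (c : Complex.UnitDisc → ℂ),
      ‖∑ x ∈ s, conj (c x) * f x‖ ^ 2 ≤ N * dbrForm b s c) :
    ∃ g : lp (fun _ : ℕ => ℂ) 2, ‖g‖ ^ 2 ≤ 2 * C * N ∧
      ∀ z ∈ Metric.ball (0 : ℂ) 1, HasSum (fun n => (g (n + 1) - conj ζ * g n) * z ^ n) (f z) := by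
  set V := Finsupp.linearCombination ℂ (fun x : Complex.UnitDisc =>
        (⟨shiftedSzegoCoeff ζ x, memℓp_shiftedSzegoCoeff ζ x⟩ : lp (fun _ : ℕ => ℂ) 2)) with hV
  -- Conjugating `f` makes the functional linear in the coefficients.
  set l : (Complex.UnitDisc →₀ ℂ) →ₗ[ℂ] ℂ :=
    Finsupp.linearCombination ℂ (fun x : Complex.UnitDisc => conj (f x)) with hl
  have hbound : ∀ c, ‖l c‖ ≤ Real.sqrt (2 * C * N) * ‖V c‖ := by
    intro c
    have h1 : ‖l c‖ = ‖∑ x ∈ c.support, conj (c x) * f x‖ := by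
      rw [← RCLike.norm_conj, hl, Finsupp.linearCombination_apply, Finsupp.sum, map_sum]
      simp
    refine abs_le_of_sq_le_sq' ?_ (by positivity) |>.2
    rw [mul_pow, Real.sq_sqrt (by positivity), h1, norm_sq_linearCombination]
    refine (hf c.support c).trans ?_
    have := mul_le_mul_of_nonneg_left (dbrForm_le_circleAverage b hζ hβ hC h c.support c) hN
    linarith
  obtain ⟨g, hg, hgl⟩ := exists_inner_eq_of_norm_le V l (Real.sqrt_nonneg _) hbound
  refine ⟨g, ?_, fun z hz => ?_⟩
  · have := pow_le_pow_left₀ (norm_nonneg g) hg 2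
    rwa [Real.sq_sqrt (by positivity)] at this
  have hz1 : ‖z‖ < 1 := by simpa using hz
  set x : Complex.UnitDisc := Complex.UnitDisc.mk z hz1 with hx
  have hxz : (x : ℂ) = z := rfl
  have h1 := hgl (Finsupp.single x 1)
  rw [hl, hV, Finsupp.linearCombination_single, Finsupp.linearCombination_single, one_smul,
    one_smul] at h1
  have h2 := lp.hasSum_inner (𝕜 := ℂ) g
    (⟨shiftedSzegoCoeff ζ x, memℓp_shiftedSzegoCoeff ζ x⟩ : lp (fun _ : ℕ => ℂ) 2)
  rw [← h1] at h2
  have h3 : HasSum (fun n => g n * conj (shiftedSzegoCoeff ζ x n)) (f z) := by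
    rw [← hxz]
    refine Complex.hasSum_conj'.mp ?_
    refine h2.congr_fun fun n => ?_
    simp [mul_comm]
  have h4 : Summable fun n => g n * z ^ n := by
    refine Summable.of_norm_bounded
      (summable_geometric_of_lt_one (norm_nonneg z) hz1 |>.mul_left ‖g‖) fun n => ?_
    rw [norm_mul, norm_pow]
    exact mul_le_mul_of_nonneg_right (lp.norm_apply_le_norm (by norm_num) g n) (by positivity)
  obtain ⟨G, hG⟩ := h4
  -- Adding back `conj ζ ∑ g n zⁿ` isolates the backward shift, whose term at index `0` vanishes and
  -- can be dropped.
  have h5 : HasSum (fun n => g n * (if n = 0 then 0 else z ^ (n - 1))) (f z + conj ζ * G) := by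
    refine (h3.add (hG.mul_left (conj ζ))).congr_fun fun n => ?_
    unfold shiftedSzegoCoeff
    rw [hxz]
    split_ifs with hn <;> simp <;> ring
  rw [← hasSum_nat_add_iff' 1] at h5
  simp only [Finset.range_one, Finset.sum_singleton, if_true, mul_zero, sub_zero,
    Nat.add_eq_zero_iff, one_ne_zero, and_false, if_false, Nat.add_sub_cancel] at h5
  have h6 := h5.sub (hG.mul_left (conj ζ))
  rw [add_sub_cancel_right] at h6
  exact h6.congr_fun fun n => by ring

/-- The Dirichlet integral costs `‖g‖²` and the Hardy norm `4‖g‖²`, with `‖g‖² ≤ 2CN`; hence the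
constant `10CN`. -/
lemma mem_dirichletSpace_of_form_bound (b : SchurFunction) {ζ β : ℂ} {C : ℝ} (hζ : ‖ζ‖ = 1)
    (hβ : ‖β‖ = 1) (hC : 0 ≤ C)
    (h : ∀ z, ‖z‖ < 1 → (1 - β * b z).re ≤ C * (‖z - ζ‖ ^ 2 + (1 - ‖z‖)))
    {f : ℂ → ℂ} {N : ℝ} (hN : 0 ≤ N)
    (hf : ∀ (s : Finset Complex.UnitDisc) (c : Complex.UnitDisc → ℂ),
      ‖∑ x ∈ s, conj (c x) * f x‖ ^ 2 ≤ N * dbrForm b s c) :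
    f ∈ dirichletSpace ζ ∧ dirichletNormSq ζ f ≤ ENNReal.ofReal (10 * C * N) := by
  obtain ⟨g, hg, hsum⟩ := exists_lp_of_form_bound b hζ hβ hC h hN hf
  obtain ⟨hhol, hcoef⟩ := taylorCoeff_of_hasSum hsum
  have hgs := hasSum_norm_sq_lp g
  have hgs1 : Summable fun n => ‖g (n + 1)‖ ^ 2 := (summable_nat_add_iff 1).mpr hgs.summable
  have hgs1' : ∑' n, ‖g (n + 1)‖ ^ 2 ≤ ‖g‖ ^ 2 := by
    have := hgs.summable.sum_add_tsum_nat_add 1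
    rw [hgs.tsum_eq] at this
    simp only [Finset.range_one, Finset.sum_singleton] at this
    nlinarith [sq_nonneg ‖g 0‖]
  have hD : dirichletIntegral ζ f ≤ ENNReal.ofReal (‖g‖ ^ 2) := by
    have h1 : ∀ n, ‖-conj ζ * g (n + 1)‖ ^ 2 = ‖g (n + 1)‖ ^ 2 := fun n => by
      rw [norm_mul, norm_neg, RCLike.norm_conj, hζ, one_mul]
    -- Since `ζ conj ζ = 1`, the sequence `G n = -conj ζ * g (n+1)` satisfies `G n - ζ G (n+1) = g
    -- (n+2) - conj ζ * g (n+1)`, which writes `f` as `a + (z - ζ)G`.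
    have h2 := dirichletIntegral_le_tsum hζ hhol (g := fun n => -conj ζ * g (n + 1))
      (by simpa only [h1] using hgs1) (fun n => by
        have hζζ : ζ * conj ζ = 1 := by rw [Complex.mul_conj', hζ]; simp
        rw [hcoef]
        linear_combination (- g (n + 1 + 1)) * hζζ)
    simp only [h1] at h2
    exact h2.trans (ENNReal.ofReal_le_ofReal hgs1')
  have hH : hardyNormSq f ≤ ENNReal.ofReal (4 * ‖g‖ ^ 2) := by
    have h1 : ∀ n, ‖taylorCoeff f n‖ₑ ^ 2
        ≤ ENNReal.ofReal (2 * ‖g (n + 1)‖ ^ 2 + 2 * ‖g n‖ ^ 2) := fun n => by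
      rw [← ofReal_norm, ← ENNReal.ofReal_pow (norm_nonneg _), hcoef]
      refine ENNReal.ofReal_le_ofReal ?_
      have h2 : ‖g (n + 1) - conj ζ * g n‖ ≤ ‖g (n + 1)‖ + ‖g n‖ := by
        refine (norm_sub_le _ _).trans ?_
        rw [norm_mul, RCLike.norm_conj, hζ, one_mul]
      have h3 := pow_le_pow_left₀ (norm_nonneg _) h2 2
      nlinarith [sq_nonneg (‖g (n + 1)‖ - ‖g n‖)]
    refine (ENNReal.tsum_le_tsum h1).trans ?_
    have hs : Summable fun n => 2 * ‖g (n + 1)‖ ^ 2 + 2 * ‖g n‖ ^ 2 :=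
      (hgs1.mul_left 2).add (hgs.summable.mul_left 2)
    rw [← ENNReal.ofReal_tsum_of_nonneg (fun n => by positivity) hs]
    refine ENNReal.ofReal_le_ofReal ?_
    rw [(hgs1.mul_left 2).tsum_add (hgs.summable.mul_left 2), tsum_mul_left, tsum_mul_left,
      hgs.tsum_eq]
    linarith
  refine ⟨⟨hhol, hD.trans_lt ENNReal.ofReal_lt_top⟩, ?_⟩
  refine (add_le_add hH hD).trans ?_
  rw [← ENNReal.ofReal_add (by positivity) (by positivity)]
  exact ENNReal.ofReal_le_ofReal (by linarith)

/-! ### Points outside the boundary spectrum -/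

lemma eventually_lt_norm_of_notMem {b : ℂ → ℂ} {ζ : ℂ} (hζ : ‖ζ‖ = 1) (h : ζ ∉ boundarySpectrum b) {c : ℝ}
    (hc : c < 1) : ∀ᶠ z in 𝓝[Metric.ball 0 1] ζ, c < ‖b z‖ := by
  have h1 : 1 ≤ Filter.liminf (fun z => ‖b z‖ₑ) (𝓝[Metric.ball 0 1] ζ) := by
    by_contra hlt
    exact h ⟨hζ, not_le.mp hlt⟩
  have h2 : ENNReal.ofReal c < Filter.liminf (fun z => ‖b z‖ₑ) (𝓝[Metric.ball 0 1] ζ) :=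
    lt_of_lt_of_le (by rwa [ENNReal.ofReal_lt_one]) h1
  filter_upwards [Filter.eventually_lt_of_lt_liminf h2 (by isBoundedDefault)] with z hz
  rw [← ofReal_norm] at hz
  exact (ENNReal.ofReal_lt_ofReal_iff').mp hz |>.1

lemma exists_re_one_sub_le_of_notMem (b : SchurFunction) {ζ : ℂ} (hζ : ‖ζ‖ = 1)
    (h : ζ ∉ boundarySpectrum b) {ε : ℝ} (hε : 0 < ε)
    (hlim : ∀ᵐ θ : ℝ, ‖circleMap 0 1 θ - ζ‖ < ε →
      Filter.Tendsto (fun s : ℝ => ‖b (s * circleMap 0 1 θ)‖) (𝓝[<] 1) (𝓝 1)) :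
    ∃ (β : ℂ) (C : ℝ), ‖β‖ = 1 ∧ 0 ≤ C ∧
      ∀ z, ‖z‖ < 1 → (1 - β * b z).re ≤ C * (‖z - ζ‖ ^ 2 + (1 - ‖z‖)) := by
  have h1 := eventually_lt_norm_of_notMem hζ h (show (1 / 2 : ℝ) < 1 by norm_num)
  obtain ⟨δ, hδ, hδb⟩ := Metric.mem_nhdsWithin_iff.mp h1
  set ρ := min (min ε δ) 1 with hρ
  have hρ0 : 0 < ρ := lt_min (lt_min hε hδ) one_pos
  have hρε : ρ ≤ ε := (min_le_left _ _).trans (min_le_left _ _)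
  have hρδ : ρ ≤ δ := (min_le_left _ _).trans (min_le_right _ _)
  refine exists_re_one_sub_le b hζ (η := ρ / 4) (by positivity) fun z hz hzζ =>
    one_sub_norm_le_of_unimodular b hζ hρ0 (min_le_right _ _) (fun w hw hwζ => ?_) ?_ hz hzζ
  · exact le_of_lt (hδb ⟨mem_ball_iff_norm.mpr (hwζ.trans_le hρδ), by simpa using hw⟩)
  · filter_upwards [hlim] with θ hθ hθε
    exact hθ (hθε.trans_le hρε)

lemma tendsto_norm_radial_of_notMem (b : SchurFunction) {ζ : ℂ} (hζ : ‖ζ‖ = 1)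
    (h : ζ ∉ boundarySpectrum b) :
    Filter.Tendsto (fun s : ℝ => ‖b (s * ζ)‖) (𝓝[<] 1) (𝓝 1) := by
  have hmem : ∀ s ∈ Set.Ioo (0 : ℝ) 1, (s : ℂ) * ζ ∈ Metric.ball (0 : ℂ) 1 := fun s hs => by
    rw [mem_ball_zero_iff, norm_mul, hζ, mul_one, Complex.norm_real, Real.norm_of_nonneg hs.1.le]
    exact hs.2
  have hr : Filter.Tendsto (fun s : ℝ => (s : ℂ) * ζ) (𝓝[<] 1) (𝓝[Metric.ball 0 1] ζ) := by
    refine tendsto_nhdsWithin_iff.mpr ⟨?_, ?_⟩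
    · have : Continuous (fun s : ℝ => (s : ℂ) * ζ) := by fun_prop
      simpa using (this.tendsto 1).mono_left (nhdsWithin_le_nhds (s := Set.Iio (1 : ℝ)))
    · filter_upwards [Ioo_mem_nhdsLT (zero_lt_one (α := ℝ))] with s hs using hmem s hs
  refine tendsto_order.mpr ⟨fun c hc => hr.eventually (eventually_lt_norm_of_notMem hζ h hc),
    fun c hc => ?_⟩
  filter_upwards [Ioo_mem_nhdsLT (zero_lt_one (α := ℝ))] with s hs
  exact (b.norm_apply_le (hmem s hs)).trans_lt hc

/-! ### The de Branges–Rovnyak space -/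

lemma extendDisc_coe (f : Complex.UnitDisc → ℂ) (x : Complex.UnitDisc) : extendDisc f x = f x := by
  unfold extendDisc
  rw [dif_pos x.norm_lt_one]
  rfl

lemma kerFun_apply_eq (b : SchurFunction) (w x : Complex.UnitDisc) :
    RKHS.kerFun (DeBrangesRovnyak b) w 1 x = dbrKernel b x w := by
  rw [RKHS.kerFun_apply, RKHS.OfKernel.kernel_ofKernel]
  simp [dbrMatrix]

lemma inner_kerFun_kerFun (b : SchurFunction) (x y : Complex.UnitDisc) :
    inner ℂ (RKHS.kerFun (DeBrangesRovnyak b) x 1) (RKHS.kerFun (DeBrangesRovnyak b) y 1)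
      = conj (dbrKernel b y x) := by
  rw [RKHS.inner_kerFun, kerFun_apply_eq]
  simp

lemma norm_sum_kerFun_sq (b : SchurFunction) (s : Finset Complex.UnitDisc)
    (c : Complex.UnitDisc → ℂ) :
    ‖∑ x ∈ s, c x • RKHS.kerFun (DeBrangesRovnyak b) x 1‖ ^ 2 = dbrForm b s c := by
  rw [← inner_self_eq_norm_sq (𝕜 := ℂ), sum_inner]
  unfold dbrForm
  rw [← Complex.conj_re]
  simp only [map_sum, RCLike.re_to_complex, Complex.re_sum]
  refine Finset.sum_congr rfl fun x _ => ?_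
  rw [inner_sum, Complex.re_sum]
  refine Finset.sum_congr rfl fun y _ => ?_
  rw [inner_smul_left, inner_smul_right, inner_kerFun_kerFun]
  simp only [map_mul, Complex.conj_conj]
  congr 1
  ring

/-- By the reproducing property the sum is the inner product of `f` with a combination of kernels
whose squared norm is `dbrForm`. -/
lemma norm_sum_conj_mul_extendDisc_sq_le (b : SchurFunction) (f : DeBrangesRovnyak b)
    (s : Finset Complex.UnitDisc) (c : Complex.UnitDisc → ℂ) :
    ‖∑ x ∈ s, conj (c x) * extendDisc f x‖ ^ 2 ≤ ‖f‖ ^ 2 * dbrForm b s c := by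
  have h1 : ∑ x ∈ s, conj (c x) * extendDisc f x
      = inner ℂ (∑ x ∈ s, c x • RKHS.kerFun (DeBrangesRovnyak b) x 1) f := by
    rw [sum_inner]
    refine Finset.sum_congr rfl fun x _ => ?_
    rw [inner_smul_left, RKHS.kerFun_inner, extendDisc_coe]
    simp
  rw [h1, ← norm_sum_kerFun_sq, ← mul_pow, mul_comm]
  exact pow_le_pow_left₀ (norm_nonneg _) (norm_inner_le_norm _ _) 2

theorem deBrangesRovnyakEmbeds_of_notMem {ζ : ℂ} (hζ : ‖ζ‖ = 1) (b : SchurFunction)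
    (hcl : IsClosed (boundarySpectrum b)) (h : ζ ∉ boundarySpectrum b) :
    DeBrangesRovnyakEmbeds b ζ := by
  -- Closedness is used only here: a whole arc around `ζ` avoids the spectrum, so `|b|` has radial
  -- limit `1` at each of its points.
  obtain ⟨ε, hε, hball⟩ := Metric.isOpen_iff.mp hcl.isOpen_compl ζ h
  obtain ⟨β, C, hβ, hC, hre⟩ := exists_re_one_sub_le_of_notMem b hζ h hε
    (Filter.Eventually.of_forall fun θ hθ =>
      tendsto_norm_radial_of_notMem b (by simp) (hball (mem_ball_iff_norm.mpr hθ)))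
  have key := fun f : DeBrangesRovnyak b => mem_dirichletSpace_of_form_bound b hζ hβ hC hre
    (sq_nonneg ‖f‖) (norm_sum_conj_mul_extendDisc_sq_le b f)
  refine ⟨fun f => (key f).1, (10 * C).toNNReal, fun f => (key f).2.trans (le_of_eq ?_)⟩
  rw [ENNReal.ofReal_mul (by positivity), ENNReal.ofReal_pow (norm_nonneg _), ofReal_norm]
  rfl

theorem notMem_of_deBrangesRovnyakEmbeds {ζ : ℂ} (hζ : ‖ζ‖ = 1) (b : SchurFunction)
    (h : DeBrangesRovnyakEmbeds b ζ) : ζ ∉ boundarySpectrum b := by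
  obtain ⟨-, C, hC⟩ := h
  refine notMem_boundarySpectrum_of_kernel_bound hζ b C fun w hw => ?_
  set x : Complex.UnitDisc := Complex.UnitDisc.mk w hw with hx
  have h1 := hC (RKHS.kerFun (DeBrangesRovnyak b) x 1)
  have e1 : dirichletIntegral ζ (fun z => dbrKernel b z w)
      = dirichletIntegral ζ (extendDisc (RKHS.kerFun (DeBrangesRovnyak b) x 1)) := by
    refine dirichletIntegral_congr ζ fun z hz => ?_
    have hz1 : ‖z‖ < 1 := by simpa using hz
    have := extendDisc_coe (RKHS.kerFun (DeBrangesRovnyak b) x 1) (Complex.UnitDisc.mk z hz1)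
    rw [kerFun_apply_eq] at this
    exact this.symm
  have e2 : ‖RKHS.kerFun (DeBrangesRovnyak b) x 1‖ₑ ^ 2
      = ENNReal.ofReal ((1 - ‖b w‖ ^ 2) / (1 - ‖w‖ ^ 2)) := by
    rw [← ofReal_norm, ← ENNReal.ofReal_pow (norm_nonneg _), ← inner_self_eq_norm_sq (𝕜 := ℂ),
      inner_kerFun_kerFun, show (x : ℂ) = w from rfl, dbrKernel_self,
      Complex.conj_ofReal]
    rfl
  rw [e1, ← e2]
  exact le_add_self.trans h1

/-! ### `H²` inside `ℓ²` -/

lemma memℓp_taylorCoeff {f : ℂ → ℂ} (hf : f ∈ hardySpace) : Memℓp (taylorCoeff f) 2 := by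
  rw [memℓp_gen_iff (by norm_num)]
  simpa using summable_norm_sq_of_hardyNormSq hf.2

/-- The sequence of Taylor coefficients of a function in `H²`. -/
def hardyVec (f : hardySpace) : lp (fun _ : ℕ => ℂ) 2 :=
  ⟨taylorCoeff f, memℓp_taylorCoeff f.2⟩

lemma hardyNormSq_eq_norm_hardyVec (f : hardySpace) :
    hardyNormSq f = ENNReal.ofReal (‖hardyVec f‖ ^ 2) := by
  rw [hardyNormSq_eq_ofReal f.2.2, ← (hasSum_norm_sq_lp (hardyVec f)).tsum_eq]
  rfl

/-- The arguments are swapped because `inner` is conjugate-linear in its first slot. -/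
lemma hardyInner_eq_inner (f g : hardySpace) :
    hardyInner f g = inner ℂ (hardyVec g) (hardyVec f) := by
  rw [lp.inner_eq_tsum]
  unfold hardyInner
  refine tsum_congr fun n => ?_
  simp [hardyVec]

lemma taylorCoeff_add_mul {f g : ℂ → ℂ} (hf : IsHol f) (hg : IsHol g) (t : ℂ) (n : ℕ) :
    taylorCoeff (fun z => f z + t * g z) n = taylorCoeff f n + t * taylorCoeff g n := by
  refine (taylorCoeff_of_hasSum (a := fun n => taylorCoeff f n + t * taylorCoeff g n)
    fun z hz => ?_).2 n
  refine ((hasSum_taylorCoeff hf hz).add ((hasSum_taylorCoeff hg hz).mul_left t)).congr_fun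
    fun n => ?_
  ring

lemma add_mul_mem_hardySpace {f g : ℂ → ℂ} (hf : f ∈ hardySpace) (hg : g ∈ hardySpace) (t : ℂ) :
    (fun z => f z + t * g z) ∈ hardySpace := by
  refine ⟨DifferentiableOn.add hf.1 (DifferentiableOn.const_mul hg.1 t), ?_⟩
  have h : Memℓp (taylorCoeff fun z => f z + t * g z) 2 := by
    have e : taylorCoeff (fun z => f z + t * g z) = taylorCoeff f + t • taylorCoeff g := by
      ext n
      exact taylorCoeff_add_mul hf.1 hg.1 t n
    rw [e]
    exact (memℓp_taylorCoeff hf).add ((memℓp_taylorCoeff hg).const_smul t)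
  rw [memℓp_gen_iff (by norm_num)] at h
  have h2 : Summable fun n => ‖taylorCoeff (fun z => f z + t * g z) n‖ ^ 2 := by simpa using h
  unfold hardyNormSq
  have e : ∀ n, ‖taylorCoeff (fun z => f z + t * g z) n‖ₑ ^ 2
      = ENNReal.ofReal (‖taylorCoeff (fun z => f z + t * g z) n‖ ^ 2) := fun n => by
    rw [ENNReal.ofReal_pow (norm_nonneg _), ofReal_norm]
  simp only [e]
  rw [← ENNReal.ofReal_tsum_of_nonneg (fun _ => sq_nonneg _) h2]
  exact ENNReal.ofReal_lt_top

lemma hardyVec_add_mul (f g : hardySpace) (t : ℂ) :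
    hardyVec ⟨fun z => (f : ℂ → ℂ) z + t * (g : ℂ → ℂ) z, add_mul_mem_hardySpace f.2 g.2 t⟩
      = hardyVec f + t • hardyVec g := by
  ext n
  exact taylorCoeff_add_mul f.2.1 g.2.1 t n

/-! ### Szegő kernels in `H²` -/

lemma hasSum_szegoSum (s : Finset Complex.UnitDisc) (a : Complex.UnitDisc → ℂ) {z : ℂ}
    (hz : ‖z‖ ≤ 1) :
    HasSum (fun n => (∑ x ∈ s, a x * conj (x : ℂ) ^ n) * z ^ n) (szegoSum s a z) := by
  have h1 : HasSum (fun n => ∑ x ∈ s, a x * (conj (x : ℂ) * z) ^ n)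
      (∑ x ∈ s, a x * (1 - conj (x : ℂ) * z)⁻¹) := by
    refine hasSum_sum fun x _ => HasSum.mul_left _ (hasSum_geometric_of_norm_lt_one ?_)
    rw [norm_mul]
    have := norm_conj_unitDisc_lt_one x
    nlinarith [norm_nonneg z, norm_nonneg (conj (x : ℂ))]
  unfold szegoSum
  simp only [div_eq_mul_inv]
  refine h1.congr_fun fun n => ?_
  rw [Finset.sum_mul]
  exact Finset.sum_congr rfl fun x _ => by ring

lemma isHol_szegoSum (s : Finset Complex.UnitDisc) (a : Complex.UnitDisc → ℂ) :
    IsHol (szegoSum s a) :=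
  (diffContOnCl_szegoSum s a).differentiableOn

lemma taylorCoeff_szegoSum (s : Finset Complex.UnitDisc) (a : Complex.UnitDisc → ℂ) (n : ℕ) :
    taylorCoeff (szegoSum s a) n = ∑ x ∈ s, a x * conj (x : ℂ) ^ n :=
  (taylorCoeff_of_hasSum fun _ hz => hasSum_szegoSum s a (mem_ball_zero_iff.mp hz).le).2 n

lemma hardyInner_szegoSum {f : ℂ → ℂ} (hf : IsHol f) (s : Finset Complex.UnitDisc)
    (a : Complex.UnitDisc → ℂ) :
    hardyInner f (szegoSum s a) = ∑ x ∈ s, conj (a x) * f x := by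
  have h : HasSum (fun n => ∑ x ∈ s, conj (a x) * (taylorCoeff f n * (x : ℂ) ^ n))
      (∑ x ∈ s, conj (a x) * f x) :=
    hasSum_sum fun x _ => HasSum.mul_left _ (hasSum_taylorCoeff hf (by simpa using x.norm_lt_one))
  unfold hardyInner
  rw [← h.tsum_eq]
  refine tsum_congr fun n => ?_
  rw [taylorCoeff_szegoSum, map_sum, Finset.mul_sum]
  refine Finset.sum_congr rfl fun x _ => ?_
  simp only [map_mul, map_pow, Complex.conj_conj]
  ring

/-! ### Multiplication by bounded and by inner functions on `H²` -/

/-- Radial limits of `L²` means for `u G` with `u` bounded of unimodular boundary values and `G`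
continuous up to the boundary. -/
lemma tendsto_circleAverage_mul {u G : ℂ → ℂ} (hu : IsHol u) {M : ℝ}
    (hM : ∀ z ∈ Metric.ball (0 : ℂ) 1, ‖u z‖ ≤ M)
    (hlim : ∀ᵐ θ : ℝ, Filter.Tendsto (fun r : ℝ => ‖u (r * circleMap 0 1 θ)‖) (𝓝[<] 1) (𝓝 1))
    (hG : ContinuousOn G (Metric.closedBall 0 1)) :
    Filter.Tendsto (fun r : ℝ => Real.circleAverage (fun z => ‖u z * G z‖ ^ 2) 0 r) (𝓝[<] 1)
      (𝓝 (Real.circleAverage (fun z => ‖G z‖ ^ 2) 0 1)) := by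
  obtain ⟨K, hK⟩ := (isCompact_closedBall (0 : ℂ) 1).exists_bound_of_continuousOn hG
  have hM0 : 0 ≤ M := (norm_nonneg _).trans (hM 0 (by simp))
  have hK0 : 0 ≤ K := (norm_nonneg _).trans (hK 0 (by simp))
  have hmem : ∀ r ∈ Set.Ioo (0 : ℝ) 1, ∀ θ, (r : ℂ) * circleMap 0 1 θ ∈ Metric.ball (0 : ℂ) 1 := by
    intro r hr θ
    rw [mem_ball_zero_iff, norm_mul, Complex.norm_real, Real.norm_of_nonneg hr.1.le]
    simpa using hr.2
  have hIoo : Set.Ioo (0 : ℝ) 1 ∈ 𝓝[<] (1 : ℝ) := Ioo_mem_nhdsLT zero_lt_one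
  have e : ∀ r : ℝ, Real.circleAverage (fun z => ‖u z * G z‖ ^ 2) 0 r
      = (2 * Real.pi)⁻¹ • ∫ θ in (0 : ℝ)..2 * Real.pi,
        ‖u (r * circleMap 0 1 θ) * G (r * circleMap 0 1 θ)‖ ^ 2 := fun r => by
    unfold Real.circleAverage
    simp [circleMap]
  simp only [e]
  unfold Real.circleAverage
  refine Filter.Tendsto.const_smul ?_ _
  refine intervalIntegral.tendsto_integral_filter_of_dominated_convergence
    (fun _ => (M * K) ^ 2) ?_ ?_ (by simp) ?_
  · filter_upwards [hIoo] with r hr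
    refine Continuous.aestronglyMeasurable ?_
    have h1 : Continuous fun θ => u (r * circleMap 0 1 θ) :=
      hu.continuousOn.comp_continuous (by fun_prop) (hmem r hr)
    have h2 : Continuous fun θ => G (r * circleMap 0 1 θ) :=
      hG.comp_continuous (by fun_prop) fun θ => Metric.ball_subset_closedBall (hmem r hr θ)
    exact (h1.mul h2).norm.pow 2
  · filter_upwards [hIoo] with r hr
    refine Filter.Eventually.of_forall fun θ _ => ?_
    rw [Real.norm_of_nonneg (sq_nonneg _), norm_mul]
    refine pow_le_pow_left₀ (by positivity) (mul_le_mul (hM _ (hmem r hr θ))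
      (hK _ (Metric.ball_subset_closedBall (hmem r hr θ))) (norm_nonneg _) hM0) 2
  · filter_upwards [hlim] with θ hθ _
    have h1 : Filter.Tendsto (fun r : ℝ => (r : ℂ) * circleMap 0 1 θ) (𝓝[<] 1)
        (𝓝[Metric.closedBall 0 1] (circleMap 0 1 θ)) := by
      refine tendsto_nhdsWithin_iff.mpr ⟨?_, ?_⟩
      · have : Continuous (fun s : ℝ => (s : ℂ) * circleMap 0 1 θ) := by fun_prop
        simpa using (this.tendsto 1).mono_left (nhdsWithin_le_nhds (s := Set.Iio (1 : ℝ)))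
      · filter_upwards [hIoo] with r hr using Metric.ball_subset_closedBall (hmem r hr θ)
    have h2 := (hG (circleMap 0 1 θ) (by simp)).tendsto.comp h1
    have h3 := (hθ.mul h2.norm).pow 2
    simpa only [norm_mul, one_mul, Function.comp_def] using h3

lemma hardyNormSq_mul_szegoSum_le {u : ℂ → ℂ} (hu : IsHol u) {M : ℝ}
    (hM : ∀ z ∈ Metric.ball (0 : ℂ) 1, ‖u z‖ ≤ M)
    (hlim : ∀ᵐ θ : ℝ, Filter.Tendsto (fun r : ℝ => ‖u (r * circleMap 0 1 θ)‖) (𝓝[<] 1) (𝓝 1))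
    (s : Finset Complex.UnitDisc) (a : Complex.UnitDisc → ℂ) :
    hardyNormSq (fun z => u z * szegoSum s a z)
      ≤ ENNReal.ofReal (Real.circleAverage (fun z => ‖szegoSum s a z‖ ^ 2) 0 1) :=
  hardyNormSq_le_of_circleAverage_le (DifferentiableOn.mul hu (isHol_szegoSum s a))
    (fun _ _ => le_rfl) (tendsto_circleAverage_mul hu hM hlim (continuousOn_szegoSum s a))

lemma hardyNormSq_szegoSum_le (s : Finset Complex.UnitDisc) (a : Complex.UnitDisc → ℂ) :
    hardyNormSq (szegoSum s a)
      ≤ ENNReal.ofReal (Real.circleAverage (fun z => ‖szegoSum s a z‖ ^ 2) 0 1) := by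
  have h := hardyNormSq_mul_szegoSum_le (u := fun _ => 1) (differentiableOn_const _) (M := 1)
    (by simp) (Filter.Eventually.of_forall fun θ => by simp) s a
  simpa using h

lemma szegoSum_mem_hardySpace (s : Finset Complex.UnitDisc) (a : Complex.UnitDisc → ℂ) :
    szegoSum s a ∈ hardySpace :=
  ⟨isHol_szegoSum s a, (hardyNormSq_szegoSum_le s a).trans_lt ENNReal.ofReal_lt_top⟩

lemma IsInner.exists_bound {u : ℂ → ℂ} (hu : IsInner u) :
    ∃ M : ℝ, ∀ z ∈ Metric.ball (0 : ℂ) 1, ‖u z‖ ≤ M := by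
  refine ⟨(hInftyNorm u).toReal, fun z hz => ?_⟩
  have h : ‖u z‖ₑ ≤ hInftyNorm u := le_iSup₂_of_le (f := fun z _ => ‖u z‖ₑ) z hz le_rfl
  have h2 := ENNReal.toReal_mono hu.bounded.ne h
  simpa using h2

lemma IsInner.tendsto_norm {u : ℂ → ℂ} (hu : IsInner u) :
    ∀ᵐ θ : ℝ, Filter.Tendsto (fun r : ℝ => ‖u (r * circleMap 0 1 θ)‖) (𝓝[<] 1) (𝓝 1) := by
  filter_upwards [hu.unimodular] with θ ⟨l, hl, h⟩
  simpa [circleMap, hl] using h.norm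

/-- For the Szegő kernel `G = k_w`, `u(w) G(w) = ⟨uG, G⟩` while `‖uG‖²` and `‖G‖²` are at most `K =
G(w)`; Cauchy–Schwarz gives `|u(w)| K ≤ K`. -/
lemma IsInner.norm_le_one {u : ℂ → ℂ} (hu : IsInner u) {w : ℂ} (hw : w ∈ Metric.ball (0 : ℂ) 1) :
    ‖u w‖ ≤ 1 := by
  obtain ⟨M, hM⟩ := hu.exists_bound
  have hw1 : ‖w‖ < 1 := by simpa using hw
  set x : Complex.UnitDisc := Complex.UnitDisc.mk w hw1 with hx
  have hxw : (x : ℂ) = w := rfl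
  set G := szegoSum {x} (fun _ => 1) with hG
  have hGw : G w = (((1 - ‖w‖ ^ 2)⁻¹ : ℝ) : ℂ) := by
    simp only [hG, szegoSum, Finset.sum_singleton, hxw]
    rw [Complex.conj_mul']
    push_cast
    rw [one_div]
  set K := (1 - ‖w‖ ^ 2)⁻¹ with hK
  have hK0 : 0 < K := inv_pos.mpr (by nlinarith [norm_nonneg w])
  have hav : Real.circleAverage (fun z => ‖G z‖ ^ 2) 0 1 = K := by
    have h := circleAverage_norm_sq_szegoSum {x} (fun _ => 1)
    rw [Finset.sum_singleton, map_one, one_mul, hxw, ← hG, hGw] at h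
    exact_mod_cast h
  have h1 := hardyNormSq_mul_szegoSum_le hu.isHol hM hu.tendsto_norm {x} (fun _ => 1)
  have h2 := hardyNormSq_szegoSum_le {x} (fun _ => 1)
  rw [← hG, hav] at h1 h2
  set uG : hardySpace := ⟨fun z => u z * G z, DifferentiableOn.mul hu.isHol (isHol_szegoSum _ _),
    h1.trans_lt ENNReal.ofReal_lt_top⟩ with huG
  set G' : hardySpace := ⟨G, szegoSum_mem_hardySpace _ _⟩ with hG'
  have h3 : ‖hardyVec uG‖ ^ 2 ≤ K := by
    have := hardyNormSq_eq_norm_hardyVec uG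
    rw [← ENNReal.ofReal_le_ofReal_iff hK0.le, ← this]
    exact h1
  have h4 : ‖hardyVec G'‖ ^ 2 ≤ K := by
    have := hardyNormSq_eq_norm_hardyVec G'
    rw [← ENNReal.ofReal_le_ofReal_iff hK0.le, ← this]
    exact h2
  have h5 : ‖u w * G w‖ ≤ ‖hardyVec G'‖ * ‖hardyVec uG‖ := by
    have h6 := hardyInner_szegoSum uG.2.1 {x} (fun _ => 1)
    rw [Finset.sum_singleton, map_one, one_mul, hxw] at h6
    have h7 := hardyInner_eq_inner uG G'
    have h8 : u w * G w = inner ℂ (hardyVec G') (hardyVec uG) := h6.symm.trans h7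
    rw [h8]
    exact norm_inner_le_norm _ _
  rw [hGw, norm_mul, Complex.norm_real, Real.norm_of_nonneg hK0.le] at h5
  have h6 : ‖u w‖ * K ≤ K := by nlinarith [sq_nonneg (‖hardyVec G'‖ - ‖hardyVec uG‖)]
  exact le_of_mul_le_mul_right (by linarith) hK0

/-- An inner function as an element of the Schur class. -/
def IsInner.toSchur {u : ℂ → ℂ} (hu : IsInner u) : SchurFunction where
  toFun := u
  isHol := hu.isHol
  norm_le := iSup₂_le fun z hz => by
    rw [← ofReal_norm, ← ENNReal.ofReal_one]
    exact ENNReal.ofReal_le_ofReal (hu.norm_le_one hz)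

lemma mul_mem_hardySpace (u : SchurFunction) {h : ℂ → ℂ} (hh : h ∈ hardySpace) :
    (fun z => u z * h z) ∈ hardySpace ∧ hardyNormSq (fun z => u z * h z) ≤ hardyNormSq h := by
  have hhol : IsHol fun z => u z * h z := DifferentiableOn.mul u.isHol hh.1
  have key : hardyNormSq (fun z => u z * h z) ≤ hardyNormSq h := by
    rw [hardyNormSq_eq_ofReal hh.2]
    refine hardyNormSq_le_of_circleAverage_le hhol (fun r hr => ?_) tendsto_const_nhds
    refine le_trans ?_ (circleAverage_le_tsum hh hr.1.le hr.2)
    have hc1 : ContinuousOn (fun z => ‖u z * h z‖ ^ 2) (Metric.sphere 0 r) :=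
      (hhol.continuousOn_sphere hr.2).norm.pow 2
    have hc2 : ContinuousOn (fun z => ‖h z‖ ^ 2) (Metric.sphere 0 r) :=
      (hh.1.continuousOn_sphere hr.2).norm.pow 2
    refine Real.circleAverage_mono (ContinuousOn.circleIntegrable hr.1.le hc1)
      (ContinuousOn.circleIntegrable hr.1.le hc2) fun z hz => ?_
    have hz1 : ‖z‖ = r := by simpa [abs_of_pos hr.1] using hz
    have hu1 := u.norm_apply_le (z := z) (by rw [mem_ball_zero_iff, hz1]; exact hr.2)
    rw [norm_mul]
    exact pow_le_pow_left₀ (by positivity) (mul_le_of_le_one_left (norm_nonneg _) hu1) 2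
  exact ⟨⟨hhol, key.trans_lt hh.2⟩, key⟩

/-- Multiplication by a Schur function on `H²`. -/
def schurMul (u : SchurFunction) (h : hardySpace) : hardySpace :=
  ⟨fun z => u z * (h : ℂ → ℂ) z, (mul_mem_hardySpace u h.2).1⟩

lemma norm_hardyVec_schurMul_le (u : SchurFunction) (h : hardySpace) :
    ‖hardyVec (schurMul u h)‖ ≤ ‖hardyVec h‖ := by
  have h1 := (mul_mem_hardySpace u h.2).2
  have h2 := hardyNormSq_eq_norm_hardyVec (schurMul u h)
  have h3 := hardyNormSq_eq_norm_hardyVec h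
  rw [h3] at h1
  have h4 := h2.symm.trans_le h1
  rw [ENNReal.ofReal_le_ofReal_iff (sq_nonneg _)] at h4
  exact abs_le_of_sq_le_sq' h4 (norm_nonneg _) |>.2

/-- Perturbation argument: a linear contraction that does not shrink `G` preserves inner products
with `G`. For inner `u` this avoids boundary values of a general `h ∈ H²`, since only Szegő sums
need `‖uG‖ = ‖G‖`. -/
lemma inner_eq_of_contraction {E : Type*} [NormedAddCommGroup E] [InnerProductSpace ℂ E]
    {G h G' h' : E} (hc : ∀ t : ℂ, ‖G' + t • h'‖ ≤ ‖G + t • h‖) (hG : ‖G‖ ≤ ‖G'‖) :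
    inner ℂ G' h' = inner ℂ G h := by
  set D := (inner ℂ G' h' : ℂ) - inner ℂ G h with hD
  have h1 : ∀ t : ℂ, 2 * (t * D).re ≤ ‖t‖ ^ 2 * ‖h‖ ^ 2 := by
    intro t
    have h2 := pow_le_pow_left₀ (norm_nonneg _) (hc t) 2
    rw [norm_add_sq (𝕜 := ℂ), norm_add_sq (𝕜 := ℂ), inner_smul_right, inner_smul_right, norm_smul,
      norm_smul, mul_pow, mul_pow] at h2
    have h3 := pow_le_pow_left₀ (norm_nonneg _) hG 2
    have h4 : 0 ≤ ‖t‖ ^ 2 * ‖h'‖ ^ 2 := by positivity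
    rw [hD, mul_sub, Complex.sub_re]
    simp only [RCLike.re_to_complex] at h2
    linarith
  -- With `t = e conj D` the inequality becomes `2e|D|² ≤ e²|D|²‖h‖² ≤ e|D|²`, so `D = 0`.
  set e := 1 / (‖h‖ ^ 2 + 1) with he
  have he0 : 0 < e := by positivity
  have he1 : e * ‖h‖ ^ 2 ≤ 1 := by
    rw [he, one_div, inv_mul_le_iff₀ (by positivity)]
    linarith
  have h2 := h1 (e * conj D)
  have h3 : ((e : ℂ) * conj D * D).re = e * ‖D‖ ^ 2 := by
    rw [mul_assoc, Complex.conj_mul', ← Complex.ofReal_pow, ← Complex.ofReal_mul, Complex.ofReal_re]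
  rw [h3, norm_mul, Complex.norm_real, Real.norm_of_nonneg he0.le, RCLike.norm_conj] at h2
  have h4 : 0 ≤ e * ‖D‖ ^ 2 * (1 - e * ‖h‖ ^ 2) := mul_nonneg (by positivity) (by linarith)
  have h5 : e * ‖D‖ ^ 2 ≤ 0 := by linarith
  have h6 : ‖D‖ ^ 2 = 0 := by
    have := sq_nonneg ‖D‖
    nlinarith
  exact sub_eq_zero.mp (norm_eq_zero.mp (pow_eq_zero_iff two_ne_zero |>.mp h6))

lemma IsInner.inner_schurMul {u : ℂ → ℂ} (hu : IsInner u) (s : Finset Complex.UnitDisc)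
    (a : Complex.UnitDisc → ℂ) (h : hardySpace) :
    inner ℂ (hardyVec (schurMul hu.toSchur ⟨szegoSum s a, szegoSum_mem_hardySpace s a⟩))
        (hardyVec (schurMul hu.toSchur h))
      = inner ℂ (hardyVec ⟨szegoSum s a, szegoSum_mem_hardySpace s a⟩) (hardyVec h) := by
  set G : hardySpace := ⟨szegoSum s a, szegoSum_mem_hardySpace s a⟩ with hG
  refine inner_eq_of_contraction (fun t => ?_) ?_
  · rw [← hardyVec_add_mul, ← hardyVec_add_mul]
    have e : (⟨_, add_mul_mem_hardySpace (schurMul hu.toSchur G).2 (schurMul hu.toSchur h).2 t⟩ :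
        hardySpace) = schurMul hu.toSchur ⟨_, add_mul_mem_hardySpace G.2 h.2 t⟩ := by
      refine Subtype.ext (funext fun z => ?_)
      simp only [schurMul]
      ring
    rw [e]
    exact norm_hardyVec_schurMul_le _ _
  · set L := Real.circleAverage (fun z => ‖szegoSum s a z‖ ^ 2) 0 1 with hL
    have hL0 : 0 ≤ L := Real.circleAverage_nonneg_of_nonneg fun z _ => sq_nonneg _
    have h1 : ‖hardyVec G‖ ^ 2 ≤ L := by
      rw [← ENNReal.ofReal_le_ofReal_iff hL0, ← hardyNormSq_eq_norm_hardyVec]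
      exact hardyNormSq_szegoSum_le s a
    have h2 : L ≤ ‖hardyVec (schurMul hu.toSchur G)‖ ^ 2 := by
      obtain ⟨M, hM⟩ := hu.exists_bound
      refine le_of_tendsto (tendsto_circleAverage_mul hu.isHol hM hu.tendsto_norm
        (continuousOn_szegoSum s a)) ?_
      filter_upwards [Ioo_mem_nhdsLT (zero_lt_one (α := ℝ))] with r hr
      rw [← (hasSum_norm_sq_lp _).tsum_eq]
      exact circleAverage_le_tsum (schurMul hu.toSchur G).2 hr.1.le hr.2
    exact abs_le_of_sq_le_sq' (h1.trans h2) (norm_nonneg _) |>.2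

/-! ### The model space -/

/-- The function `∑ c_x k^u(·, x)`, written as `F - u G` with Szegő sums `F` and `G`. -/
def modelSum (u : ℂ → ℂ) (s : Finset Complex.UnitDisc) (c : Complex.UnitDisc → ℂ) (z : ℂ) : ℂ :=
  szegoSum s c z + (-1) * (u z * szegoSum s (fun x => c x * conj (u x)) z)

lemma modelSum_mem_hardySpace (u : SchurFunction) (s : Finset Complex.UnitDisc)
    (c : Complex.UnitDisc → ℂ) : modelSum u s c ∈ hardySpace :=
  add_mul_mem_hardySpace (szegoSum_mem_hardySpace s c)
    (mul_mem_hardySpace u (szegoSum_mem_hardySpace s _)).1 (-1)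

lemma hardyVec_modelSum (u : SchurFunction) (s : Finset Complex.UnitDisc)
    (c : Complex.UnitDisc → ℂ) :
    hardyVec ⟨modelSum u s c, modelSum_mem_hardySpace u s c⟩
      = hardyVec ⟨szegoSum s c, szegoSum_mem_hardySpace s c⟩
        - hardyVec (schurMul u ⟨szegoSum s (fun x => c x * conj (u x)),
          szegoSum_mem_hardySpace s _⟩) := by
  rw [sub_eq_add_neg, ← neg_one_smul ℂ (hardyVec _), ← hardyVec_add_mul]
  rfl

lemma inner_hardyVec_szegoSum (f : hardySpace) (s : Finset Complex.UnitDisc)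
    (a : Complex.UnitDisc → ℂ) :
    inner ℂ (hardyVec ⟨szegoSum s a, szegoSum_mem_hardySpace s a⟩) (hardyVec f)
      = ∑ x ∈ s, conj (a x) * (f : ℂ → ℂ) x := by
  rw [← hardyInner_eq_inner, hardyInner_szegoSum f.2.1]

/-- Since `⟨F, uG⟩ = ‖G‖²`, expanding `‖F - uG‖²` and using `‖uG‖ ≤ ‖G‖` leaves `‖F‖² - ‖G‖²`, which
is the form. -/
lemma norm_hardyVec_modelSum_sq_le (u : SchurFunction) (s : Finset Complex.UnitDisc)
    (c : Complex.UnitDisc → ℂ) :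
    ‖hardyVec ⟨modelSum u s c, modelSum_mem_hardySpace u s c⟩‖ ^ 2 ≤ dbrForm u s c := by
  set G : hardySpace := ⟨szegoSum s (fun x => c x * conj (u x)), szegoSum_mem_hardySpace s _⟩
    with hG
  set F : hardySpace := ⟨szegoSum s c, szegoSum_mem_hardySpace s c⟩ with hF
  rw [hardyVec_modelSum, norm_sub_sq (𝕜 := ℂ)]
  have h1 := norm_hardyVec_schurMul_le u G
  have h2 := pow_le_pow_left₀ (norm_nonneg _) h1 2
  have h3 : ‖hardyVec F‖ ^ 2 = (∑ x ∈ s, conj (c x) * szegoSum s c x).re := by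
    rw [← inner_self_eq_norm_sq (𝕜 := ℂ), inner_hardyVec_szegoSum]
    rfl
  have h4 : ‖hardyVec G‖ ^ 2
      = (∑ x ∈ s, conj (c x) * (u x * szegoSum s (fun x => c x * conj (u x)) x)).re := by
    rw [← inner_self_eq_norm_sq (𝕜 := ℂ), inner_hardyVec_szegoSum]
    simp only [RCLike.re_to_complex]
    congr 1
    refine Finset.sum_congr rfl fun x _ => ?_
    simp only [map_mul, Complex.conj_conj, hG]
    ring
  have h5 : RCLike.re (inner ℂ (hardyVec F) (hardyVec (schurMul u G)) : ℂ)
      = (∑ x ∈ s, conj (c x) * (u x * szegoSum s (fun x => c x * conj (u x)) x)).re := by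
    rw [inner_hardyVec_szegoSum]
    rfl
  have h6 : dbrForm u s c = (∑ x ∈ s, conj (c x) * szegoSum s c x).re
      - (∑ x ∈ s, conj (c x) * (u x * szegoSum s (fun x => c x * conj (u x)) x)).re := by
    unfold dbrForm
    rw [← Complex.sub_re, ← Finset.sum_sub_distrib, Finset.sum_comm]
    congr 1
    refine Finset.sum_congr rfl fun y _ => ?_
    unfold szegoSum
    rw [← mul_sub, Finset.mul_sum, ← Finset.sum_sub_distrib, Finset.mul_sum]
    refine Finset.sum_congr rfl fun x _ => ?_
    unfold dbrKernel
    ring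
  rw [h5, h3, h6, ← h4]
  linarith

/-- As `f` is orthogonal to `uG`, pairing it with `F - uG` is the same as pairing it with `F`. -/
lemma norm_sum_conj_mul_modelSpace_sq_le (u : SchurFunction) (f : hardySpace)
    (hf : (f : ℂ → ℂ) ∈ modelSpace u) (s : Finset Complex.UnitDisc) (c : Complex.UnitDisc → ℂ) :
    ‖∑ x ∈ s, conj (c x) * (f : ℂ → ℂ) x‖ ^ 2 ≤ ‖hardyVec f‖ ^ 2 * dbrForm u s c := by
  have h1 := hf.2 _ (szegoSum_mem_hardySpace s (fun x => c x * conj (u x)))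
  have h2 := hardyInner_eq_inner f
    (schurMul u ⟨szegoSum s (fun x => c x * conj (u x)), szegoSum_mem_hardySpace s _⟩)
  have h3 : inner ℂ (hardyVec ⟨modelSum u s c, modelSum_mem_hardySpace u s c⟩) (hardyVec f)
      = ∑ x ∈ s, conj (c x) * (f : ℂ → ℂ) x := by
    rw [hardyVec_modelSum, inner_sub_left, inner_hardyVec_szegoSum, ← h2]
    simp only [schurMul]
    rw [h1, sub_zero]
  rw [← h3]
  refine (pow_le_pow_left₀ (norm_nonneg _) (norm_inner_le_norm _ _) 2).trans ?_
  rw [mul_pow, mul_comm]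
  exact mul_le_mul_of_nonneg_left (norm_hardyVec_modelSum_sq_le u s c) (sq_nonneg _)

/-- `⟨F, uh⟩` and `⟨uG, uh⟩ = ⟨G, h⟩` are the same finite sum of point values of `uh`; this makes
the kernels admissible test functions for `K_u`. -/
lemma IsInner.modelSum_mem_modelSpace {u : ℂ → ℂ} (hu : IsInner u) (s : Finset Complex.UnitDisc)
    (c : Complex.UnitDisc → ℂ) : modelSum u s c ∈ modelSpace u := by
  refine ⟨modelSum_mem_hardySpace hu.toSchur s c, fun h hh => ?_⟩
  have h1 := hardyInner_eq_inner ⟨modelSum u s c, modelSum_mem_hardySpace hu.toSchur s c⟩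
    (schurMul hu.toSchur ⟨h, hh⟩)
  refine h1.trans ?_
  rw [← inner_conj_symm, map_eq_zero]
  have h2 := hardyVec_modelSum hu.toSchur s c
  have h3 := hu.inner_schurMul s (fun x => c x * conj (u x)) ⟨h, hh⟩
  have h4 : inner ℂ (hardyVec ⟨modelSum u s c, modelSum_mem_hardySpace hu.toSchur s c⟩)
      (hardyVec (schurMul hu.toSchur ⟨h, hh⟩))
      = inner ℂ (hardyVec ⟨szegoSum s c, szegoSum_mem_hardySpace s c⟩)
          (hardyVec (schurMul hu.toSchur ⟨h, hh⟩))
        - inner ℂ (hardyVec ⟨szegoSum s (fun x => c x * conj (u x)), szegoSum_mem_hardySpace s _⟩)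
          (hardyVec ⟨h, hh⟩) := by
    rw [← h3, ← inner_sub_left]
    exact congrArg (fun v => inner ℂ v (hardyVec (schurMul hu.toSchur ⟨h, hh⟩))) h2
  rw [h4, inner_hardyVec_szegoSum, inner_hardyVec_szegoSum, ← Finset.sum_sub_distrib]
  refine Finset.sum_eq_zero fun x _ => ?_
  simp only [schurMul, IsInner.toSchur, map_mul, Complex.conj_conj]
  ring

theorem modelSpaceEmbeds_of_notMem {ζ : ℂ} (hζ : ‖ζ‖ = 1) {u : ℂ → ℂ} (hu : IsInner u)
    (h : ζ ∉ boundarySpectrum u) : ModelSpaceEmbeds u ζ := by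
  obtain ⟨β, C, hβ, hC, hre⟩ := exists_re_one_sub_le_of_notMem hu.toSchur hζ h one_pos
    -- Radial limits are unimodular almost everywhere on the whole circle, so any radius will do and
    -- the spectrum need not be assumed closed.
    (hu.tendsto_norm.mono fun θ hθ _ => hθ)
  have key := fun f : modelSpace u => mem_dirichletSpace_of_form_bound hu.toSchur hζ hβ hC hre
    (sq_nonneg ‖hardyVec ⟨f, f.2.1⟩‖)
    (norm_sum_conj_mul_modelSpace_sq_le hu.toSchur ⟨f, f.2.1⟩ f.2)
  refine ⟨fun f => (key f).1, (10 * C).toNNReal, fun f => (key f).2.trans (le_of_eq ?_)⟩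
  rw [ENNReal.ofReal_mul (by positivity), ← hardyNormSq_eq_norm_hardyVec]
  rfl

theorem notMem_of_modelSpaceEmbeds {ζ : ℂ} (hζ : ‖ζ‖ = 1) {u : ℂ → ℂ} (hu : IsInner u)
    (h : ModelSpaceEmbeds u ζ) : ζ ∉ boundarySpectrum u := by
  obtain ⟨-, C, hC⟩ := h
  refine notMem_boundarySpectrum_of_kernel_bound hζ hu.toSchur C fun w hw => ?_
  set x : Complex.UnitDisc := Complex.UnitDisc.mk w hw with hx
  have hxw : (x : ℂ) = w := rfl
  have h1 := hC ⟨modelSum u {x} (fun _ => 1), hu.modelSum_mem_modelSpace {x} (fun _ => 1)⟩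
  have e1 : (fun z => dbrKernel hu.toSchur z w) = modelSum u {x} (fun _ => 1) := by
    ext z
    simp only [modelSum, szegoSum, Finset.sum_singleton, hxw, dbrKernel, IsInner.toSchur]
    ring
  have h2 := norm_hardyVec_modelSum_sq_le hu.toSchur {x} (fun _ => 1)
  have h3 := hardyNormSq_eq_norm_hardyVec
    ⟨modelSum u {x} (fun _ => 1), modelSum_mem_hardySpace hu.toSchur {x} (fun _ => 1)⟩
  have e2 : dbrForm hu.toSchur {x} (fun _ => 1)
      = (1 - ‖hu.toSchur w‖ ^ 2) / (1 - ‖w‖ ^ 2) := by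
    simp only [dbrForm, Finset.sum_singleton, map_one, mul_one, hxw]
    rw [dbrKernel_self, Complex.ofReal_re]
  rw [e1]
  refine le_add_self.trans (h1.trans (mul_le_mul_right ?_ _))
  refine h3.trans_le (ENNReal.ofReal_le_ofReal ?_)
  rw [← e2]
  exact h2

end LocalDirichlet

end

theorem corollary4p1 (ζ : ℂ) (hζ : ‖ζ‖ = 1) :
    (∀ b : LocalDirichlet.SchurFunction,
      LocalDirichlet.hInftyNorm b = 1 →
      IsClosed (LocalDirichlet.boundarySpectrum b) →
      (LocalDirichlet.DeBrangesRovnyakEmbeds b ζ ↔ ζ ∉ LocalDirichlet.boundarySpectrum b)) ∧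
    (∀ u : ℂ → ℂ, LocalDirichlet.IsInner u →
      (LocalDirichlet.ModelSpaceEmbeds u ζ ↔ ζ ∉ LocalDirichlet.boundarySpectrum u)) :=
  ⟨fun b _ hcl => ⟨LocalDirichlet.notMem_of_deBrangesRovnyakEmbeds hζ b,
    LocalDirichlet.deBrangesRovnyakEmbeds_of_notMem hζ b hcl⟩,
   fun _ hu => ⟨LocalDirichlet.notMem_of_modelSpaceEmbeds hζ hu,
    LocalDirichlet.modelSpaceEmbeds_of_notMem hζ hu⟩⟩
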